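/- Let $n\ge 3$, $\sigma>0$, and let $\mathcal C$ be a binary linear code of length $n$ and dimension $k\ge 2$, with $A_d$ codewords of Hamming weight $d$. A codeword $c$ has bipolar image $s(c)=(1-2c_t)_t\in\mathbb R^n$. The all-zero codeword is sent, so $y=s^{(0)}+z$ with $s^{(0)}=(1,\dots,1)$ and $z\sim N(0,\sigma^2I_n)$. The error event $E$ is that $\|y-s(c)\|\le\|y-s^{(0)}\|$ for some nonzero $c\in\mathcal C$. Let $Z_{\xi_1}=\langle z,-s^{(0)}/\sqrt n\rangle$ and $g(z)=\frac{1}{\sqrt{2\pi}\,\sigma}e^{-z^2/(2\sigma^2)}$. In the hyperplane $Z_{\xi_1}=z$ consider the sphere of radius $r>0$ centred at $(1-z/\sqrt n)s^{(0)}$. Let $U(z,r)=\sum_{c\in\mathcal C\setminus\{0\}}\Pr\{\|y-s(c)\|\le\|y-s^{(0)}\|\}$ for $y$ uniformly distributed on this sphere (the conditional union bound). With $$g_s(s,r)=\frac{2r^{n-2}e^{-r^2/(2s^2)}}{2^{(n-1)/2}s^{n-1}\Gamma(\frac{n-1}2)},$$ let $B(z,\rho)=\int_0^\rho U(z,r)g_s(\sigma,r)\,dr+\int_\rho^\infty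 g_s(\sigma,r)\,dr$, and let $f_u(z)=\inf_{\rho\ge 0}B(z,\rho)$ be the conditional sphere bound given $Z_{\xi_1}=z$. For the nested half-spaces $Z_{\xi_1}\le z$, the first Gallager bound is $T(z)=\int_{-\infty}^{z}f_u\,g+\int_{z}^{\infty}g$. For a region $\mathcal R\subset\mathbb R^n$ put $G(\mathcal R)=\sum_{c\in\mathcal C\setminus\{0\}}\Pr\{\|y-s(c)\|\le\|y-s^{(0)}\|,\,y\in\mathcal R\}+\Pr\{y\notin\mathcal R\}$. For $r>0$ put $$f_s(r)=\sum_{1\le d\le \frac{r^2n}{r^2+n}}A_d\,\frac{\Gamma(\frac{n-1}2)}{\sqrt\pi\,\Gamma(\frac{n-2}2)}\int_0^{\arccos\left(\sqrt{nd/(n-d)}/r\right)}\sin^{n-3}\phi\,d\phi .$$ Poltyrev's tangential-sphere bound with cone parameter $r>0$, including the correction term, is $$P(r)=\int_{-\infty}^{\sqrt n}g(z)\Big\{\sum_{d:\,\sqrt d<\alpha_d}A_d\int_{\beta_d(z)}^{r_z}g(x)\int_0^{r_z^2-x^2}f_V(v)\,dv\,dx+1-\gamma\Big(\frac{n-1}2,\frac{r_z^2}{2\sigma^2}\Big)\Big\}dz+\Pr\{Z_{\xi_1}\ge\sqrt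 n\},$$ where $d$ ranges over $1,\dots,n$, $r_z=(1-z/\sqrt n)r$, $\alpha_d=r\sqrt{1-d/n}$, $\beta_d(z)=\frac{(1-z/\sqrt n)\sqrt d}{\sqrt{1-d/n}}$, $f_V(v)=\frac{v^{(n-4)/2}e^{-v/(2\sigma^2)}}{2^{(n-2)/2}\sigma^{n-2}\Gamma(\frac{n-2}2)}$ and $\gamma(a,x)=\frac1{\Gamma(a)}\int_0^xt^{a-1}e^{-t}\,dt$. Poltyrev's equation for $r$ is $$\sum_{d:\,\sqrt d<\alpha_d}A_d\int_0^{\arccos(\sqrt d/\alpha_d)}\sin^{n-3}\phi\,d\phi=\frac{\sqrt\pi\,\Gamma(\frac{n-2}2)}{\Gamma(\frac{n-1}2)} .$$ Then the following hold. 1. $f_u(z)<1$ for $z<\sqrt n$. For $z\ge\sqrt n$, $f_u(z)=1$, attained at radius $0$. 2. $Z_{\xi_1}$ has density $g$; $\Pr\{E,Z_{\xi_1}\in B\}\le\int_Bf_u\,g$ for every Borel set $B\subset\mathbb R$; and $f_u\,g$ is integrable. 3. $z^*=\sqrt n$ is an optimal parameter: $T(\sqrt n)\le T(z)$ for all $z\in\mathbb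 R$, with equality if and only if $z\ge\sqrt n$. 4. $\Pr\{E\}\le T(\sqrt n)=\int_{-\infty}^{\sqrt n}f_u\,g+\Pr\{Z_{\xi_1}\ge\sqrt n\}$. 5. $U(z,r)=f_s\big(r\sqrt n/(\sqrt n-z)\big)$ for $z<\sqrt n$ and $r>0$. 6. $T(\sqrt n)=\inf_{r>0}P(r)$, and for $r>0$ the equation $f_s(r)=1$ is equivalent to Poltyrev's equation. 7. $T(\sqrt n)\le G(\mathcal R)$ for every region $\mathcal R$ that is defined by a Borel condition on $Z_{\xi_1}$ and the distance of $y$ from the axis $\mathbb R s^{(0)}$. 8. Unless $k=2$ and $\mathcal C$ contains the all-one word, the equation $f_s(r)=1$ has a unique solution $r_1>0$. For $z<\sqrt n$, with $\tilde\sigma=\sqrt n\,\sigma/(\sqrt n-z)$, $$f_u(z)=\int_0^{r_1}f_s(r)g_s(\tilde\sigma,r)\,dr+\int_{r_1}^\infty g_s(\tilde\sigma,r)\,dr=B\Big(z,\frac{r_1(\sqrt n-z)}{\sqrt n}\Big).$$ Moreover $T(\sqrt n)=P(r_1)=G(\mathcal K)$, where $\mathcal K$ is the half-cone with apex $0$,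 axis through $s^{(0)}$ and half-angle $\arctan(r_1/\sqrt n)$. By item 7 this half-cone is an optimal region. 9. If $k=2$ and $\mathcal C$ contains the all-one word, then $f_s(r)<1$ for all $r>0$, and $T(\sqrt n)=G(\mathcal K)$ for the half-cone $\mathcal K$ of half-angle $\pi/2$, i.e. the half-space $Z_{\xi_1}\le\sqrt n$. -/

import Mathlib

open MeasureTheory ProbabilityTheory Set

namespace TSB

noncomputable section

/-- Signal space `ℝⁿ` with the Euclidean norm. -/
abbrev Signal (n : ℕ) := EuclideanSpace ℝ (Fin n)

/-- The bipolar (BPSK) image `s_t = 1 - 2 c_t` of a binary word. -/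
def bpsk {n : ℕ} (c : Fin n → ZMod 2) : Signal n :=
  WithLp.toLp 2 (fun t => 1 - 2 * ((c t).val : ℝ))

/-- The transmitted signal: the bipolar image of the all-zero codeword. -/
def sent (n : ℕ) : Signal n := bpsk 0

/-- The law of the received vector `y = s⁽⁰⁾ + z`, where `z` has i.i.d. `N(0, σ²)` entries. -/
def received (n : ℕ) (σ : ℝ) : Measure (Signal n) :=
  (Measure.pi (fun _ : Fin n => gaussianReal 0 ⟨σ ^ 2, sq_nonneg σ⟩)).map
    (fun z => sent n + WithLp.toLp 2 z)

/-- The pair-wise error event: `y` is at least as close to the image of `c` as to `s⁽⁰⁾`. -/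
def pairError {n : ℕ} (c : Fin n → ZMod 2) : Set (Signal n) :=
  {y | ‖y - bpsk c‖ ≤ ‖y - sent n‖}

/-- The (maximum-likelihood) decoding error event `E`. -/
def errorEvent {n : ℕ} (C : Submodule (ZMod 2) (Fin n → ZMod 2)) : Set (Signal n) :=
  {y | ∃ c ∈ C, c ≠ 0 ∧ y ∈ pairError c}

/-- The weight distribution: `A_d` is the number of codewords of Hamming weight `d`. -/
def weightCount {n : ℕ} (C : Submodule (ZMod 2) (Fin n → ZMod 2)) (d : ℕ) : ℕ :=
  {c : Fin n → ZMod 2 | c ∈ C ∧ hammingNorm c = d}.ncard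

open Classical in
/-- The nonzero codewords. -/
def nonzeroWords {n : ℕ} (C : Submodule (ZMod 2) (Fin n → ZMod 2)) : Finset (Fin n → ZMod 2) :=
  Finset.univ.filter (fun c => c ∈ C ∧ c ≠ 0)

/-- The radial noise component `Z_{ξ₁} = ⟪z, -s⁽⁰⁾/√n⟫`, as a function of `y = s⁽⁰⁾ + z`. -/
def radial {n : ℕ} (y : Signal n) : ℝ :=
  inner ℝ (y - sent n) (-((Real.sqrt n)⁻¹ • sent n))

/-- The point of the axis `ℝ s⁽⁰⁾` that lies in the hyperplane `Z_{ξ₁} = z`. -/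
def center (n : ℕ) (z : ℝ) : Signal n := (1 - z / Real.sqrt n) • sent n

/-- Length of the tangential noise component: the distance from `y` to the centre of the
hyperplane `Z_{ξ₁} = const` that contains it. -/
def tangentialNorm {n : ℕ} (y : Signal n) : ℝ := ‖y - center n (radial y)‖

/-- The directions of the hyperplanes `Z_{ξ₁} = z`. -/
abbrev Tangent (n : ℕ) : Submodule ℝ (Signal n) := (Submodule.span ℝ {sent n})ᗮ

/-- The pair-wise error probability conditional on the received vector being (uniformly
distributed) on the sphere of radius `r` about `center n z` inside the hyperplane `Z_{ξ₁} = z`: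
a ratio of two surface areas, pulled back to the unit sphere of directions. -/
def condPairError {n : ℕ} (z r : ℝ) (c : Fin n → ZMod 2) : ℝ :=
  ((volume : Measure (Tangent n)).toSphere).real
      {u | center n z + r • ((u : Tangent n) : Signal n) ∈ pairError c} /
    ((volume : Measure (Tangent n)).toSphere).real univ

/-- The conditional union bound on the sphere of radius `r` in the hyperplane `Z_{ξ₁} = z`. -/
def condUnion {n : ℕ} (C : Submodule (ZMod 2) (Fin n → ZMod 2)) (z r : ℝ) : ℝ :=
  ∑ c ∈ nonzeroWords C, condPairError z r c

/-- The density, at `r ≥ 0`, of the norm of `n - 1` i.i.d. `N(0, s²)` variables. -/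
def normDensity (n : ℕ) (s r : ℝ) : ℝ :=
  2 * r ^ (n - 2) * Real.exp (-r ^ 2 / (2 * s ^ 2)) /
    ((2 : ℝ) ^ (((n : ℝ) - 1) / 2) * s ^ (n - 1) * Real.Gamma (((n : ℝ) - 1) / 2))

/-- The sphere bound with radius `ρ ≥ 0`, conditional on `Z_{ξ₁} = z`. -/
def condSphereBound {n : ℕ} (C : Submodule (ZMod 2) (Fin n → ZMod 2)) (σ z ρ : ℝ) : ℝ :=
  (∫ r in (0 : ℝ)..ρ, condUnion C z r * normDensity n σ r) +
    ∫ r in Ioi ρ, normDensity n σ r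

/-- `f_u(z)`: the conditional sphere bound given `Z_{ξ₁} = z`, optimized over the radius. -/
def fu {n : ℕ} (C : Submodule (ZMod 2) (Fin n → ZMod 2)) (σ z : ℝ) : ℝ :=
  ⨅ ρ : Ici (0 : ℝ), condSphereBound C σ z ρ

/-- `g(z)`: the density of `Z_{ξ₁}`. -/
def radialDensity (σ z : ℝ) : ℝ := gaussianPDFReal 0 ⟨σ ^ 2, sq_nonneg σ⟩ z

/-- The parameterized first Gallager bound for the half-spaces `Z_{ξ₁} ≤ z`:
`∫_{-∞}^z f_u g + ∫_z^∞ g`. -/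
def halfSpaceBound {n : ℕ} (C : Submodule (ZMod 2) (Fin n → ZMod 2)) (σ z : ℝ) : ℝ :=
  (∫ x in Iic z, fu C σ x * radialDensity σ x) + ∫ x in Ioi z, radialDensity σ x

/-- The first Gallager bound with region `R`, its first term being bounded by the union bound. -/
def regionBound {n : ℕ} (C : Submodule (ZMod 2) (Fin n → ZMod 2)) (σ : ℝ)
    (R : Set (Signal n)) : ℝ :=
  (∑ c ∈ nonzeroWords C, (received n σ).real (pairError c ∩ R)) + (received n σ).real Rᶜ

/-- The half-cone with apex `0`, axis through `s⁽⁰⁾` and half-angle `θ`. -/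
def halfCone (n : ℕ) (θ : ℝ) : Set (Signal n) :=
  {y | InnerProductGeometry.angle (sent n) y ≤ θ}

/-- The explicit function `f_s(r)`: the union bound on the sphere of radius `r` in the
hyperplane `Z_{ξ₁} = 0`, written with the weight distribution. -/
def fs {n : ℕ} (C : Submodule (ZMod 2) (Fin n → ZMod 2)) (r : ℝ) : ℝ :=
  ∑ d ∈ (Finset.Icc 1 n).filter (fun d : ℕ => (d : ℝ) ≤ r ^ 2 * n / (r ^ 2 + n)),
    (weightCount C d : ℝ) *
      (Real.Gamma (((n : ℝ) - 1) / 2) / (Real.sqrt Real.pi * Real.Gamma (((n : ℝ) - 2) / 2)) *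
        ∫ φ in (0 : ℝ)..Real.arccos (Real.sqrt ((n : ℝ) * d / ((n : ℝ) - d)) / r),
          Real.sin φ ^ (n - 3))

/-- The scaled noise deviation `σ̃ = √n σ / (√n - z)`. -/
def scaledDev (n : ℕ) (σ z : ℝ) : ℝ := Real.sqrt n * σ / (Real.sqrt n - z)

/-! ### Poltyrev's tangential-sphere bound (unit symbol energy) -/

/-- Radius of the section of the cone at radial noise `z`: `r_z = (1 - z/√n) r`. -/
def coneRadius (n : ℕ) (r z : ℝ) : ℝ := (1 - z / Real.sqrt n) * r

/-- `α_d = r √(1 - δ_d²/(4n))`, with `δ_d = 2√d`. -/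
def alpha (n : ℕ) (r : ℝ) (d : ℕ) : ℝ := r * Real.sqrt (1 - (d : ℝ) / n)

/-- `β_d(z) = (1 - z/√n) / √(1 - δ_d²/(4n)) · δ_d/2`, with `δ_d = 2√d`. -/
def beta (n : ℕ) (z : ℝ) (d : ℕ) : ℝ :=
  (1 - z / Real.sqrt n) / Real.sqrt (1 - (d : ℝ) / n) * Real.sqrt d

/-- The density `f_V(v)`, `v ≥ 0`, of the sum of squares of `n - 2` i.i.d. `N(0, σ²)` variables. -/
def chiSqDensity (n : ℕ) (σ v : ℝ) : ℝ :=
  v ^ (((n : ℝ) - 4) / 2) * Real.exp (-v / (2 * σ ^ 2)) /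
    ((2 : ℝ) ^ (((n : ℝ) - 2) / 2) * σ ^ (n - 2) * Real.Gamma (((n : ℝ) - 2) / 2))

/-- The regularized lower incomplete gamma function `γ(a, x)`. -/
def lowerGammaReg (a x : ℝ) : ℝ :=
  (∫ t in (0 : ℝ)..x, t ^ (a - 1) * Real.exp (-t)) / Real.Gamma a

/-- The bracket in Poltyrev's bound. -/
def poltyrevIntegrand {n : ℕ} (C : Submodule (ZMod 2) (Fin n → ZMod 2)) (σ r z : ℝ) : ℝ :=
  (∑ d ∈ (Finset.Icc 1 n).filter (fun d : ℕ => Real.sqrt d < alpha n r d),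
      (weightCount C d : ℝ) *
        ∫ x in beta n z d..coneRadius n r z,
          gaussianPDFReal 0 ⟨σ ^ 2, sq_nonneg σ⟩ x *
            ∫ v in (0 : ℝ)..(coneRadius n r z ^ 2 - x ^ 2), chiSqDensity n σ v) +
    (1 - lowerGammaReg (((n : ℝ) - 1) / 2) (coneRadius n r z ^ 2 / (2 * σ ^ 2)))

/-- Poltyrev's tangential-sphere bound with cone parameter `r`, including the correction
term `Pr {Z_{ξ₁} ≥ √n}`. -/
def poltyrevBound {n : ℕ} (C : Submodule (ZMod 2) (Fin n → ZMod 2)) (σ r : ℝ) : ℝ :=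
  (∫ z in Iio (Real.sqrt n), radialDensity σ z * poltyrevIntegrand C σ r z) +
    (received n σ).real {y | Real.sqrt n ≤ radial y}

/-- Poltyrev's equation for the optimal cone parameter. -/
def PoltyrevOptimal {n : ℕ} (C : Submodule (ZMod 2) (Fin n → ZMod 2)) (r : ℝ) : Prop :=
  ∑ d ∈ (Finset.Icc 1 n).filter (fun d : ℕ => Real.sqrt d < alpha n r d),
      (weightCount C d : ℝ) *
        ∫ φ in (0 : ℝ)..Real.arccos (Real.sqrt d / alpha n r d), Real.sin φ ^ (n - 3) =
    Real.sqrt Real.pi * Real.Gamma (((n : ℝ) - 2) / 2) / Real.Gamma (((n : ℝ) - 1) / 2)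

end

end TSB

/-! Comparison with a nonzero word c gives the half-space ⟪y, c⟫ ≤ 0, with c read as a real 0/1
vector, so its boundary passes through the origin. Write y as the axis point at radial noise z plus
r u, with u a unit tangent vector. For Gaussian noise z, r and u are independent and u is uniform
(`lintegral_received_polar`). Given (z, r), the error region of c cuts out a spherical cap whose
height depends only on the weight of c and on t = (1 - z/√n)/r (`toSphere_cap`,
`condPairError_eq_pairProb`); the all-one word gives everything or nothing. Hence the conditional
union bound is U(z, r) = Φ(t) for one nonincreasing function Φ, namely `unionProb`.

A Gallager bound with a region A in the variables (z, r) is the expectation of U on A and of 1 off A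
(`regionBound_eq`). Minimizing pointwise gives E min(U, 1), attained on {U ≤ 1}
(`jointBound_optimalSet_le`), and every bound of the theorem is compared with this number. When
Φ(t₁) = 1, monotonicity makes {U ≤ 1} the set t ≥ t₁ below z = √n, which is the half-cone r ≤ (1 -
z/√n)/t₁. Its sections are balls, so restricting to spheres loses nothing, and f_u(z) is the
conditional expectation of min(U, 1) (`fu_eq`).

For z ≥ √n one has t ≤ 0; each of the at least three nonzero words then has probability at least
1/2, so U ≥ 1 and f_u = 1. For z < √n, U vanishes on small spheres, so f_u < 1. As T(z) is ∫ f_u g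
plus ∫ (1 - f_u) g over (z, ∞) (`halfSpaceBound_eq`), √n is the least optimal parameter.

Poltyrev's bracket is the sphere bound on a section of his cone, with the Gaussian mass of a cap
computed in cylindrical instead of polar coordinates (`lintegral_capProb_mul_normDensity`,
`poltyrevIntegrand_eq`). His bound is therefore that of a half-cone, and the best half-cone is the
optimal region.

As t decreases to 0, each word other than the all-one word has probability tending to 1/2. At least
three such words make Φ cross 1. If k = 2 and the all-one word is present, only two remain, Φ stays
below 1 for t > 0, and the cones open up to the half-space z ≤ √n in the limit. -/

namespace TSB

noncomputable section

/-! ### Polar and cylindrical coordinates; areas of spheres and spherical caps -/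

section Geometry

open Metric Module
open scoped ENNReal

variable {E : Type*} [NormedAddCommGroup E] [InnerProductSpace ℝ E] [FiniteDimensional ℝ E]
  [MeasurableSpace E] [BorelSpace E]

/-- Integration in polar coordinates. -/
theorem lintegral_polar [Nontrivial E] (f : E → ℝ≥0∞) (hf : Measurable f) :
    ∫⁻ x, f x = ∫⁻ r in Ioi (0 : ℝ), ENNReal.ofReal (r ^ (finrank ℝ E - 1)) *
      ∫⁻ u, f (r • (u : E)) ∂(volume : Measure E).toSphere := by
  have h := (volume : Measure E).measurePreserving_homeomorphUnitSphereProd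
  have h1 : ∫⁻ x, f x = ∫⁻ x : ({0}ᶜ : Set E), f x ∂((volume : Measure E).comap (↑)) := by
    rw [lintegral_subtype_comap (measurableSet_singleton _).compl, restrict_compl_singleton]
  have h2 : ∀ x : ({0}ᶜ : Set E), f x =
      (fun p : sphere (0 : E) 1 × Ioi (0 : ℝ) => f (p.2.1 • p.1.1)) (homeomorphUnitSphereProd E x) := by
    intro x
    have := congrArg Subtype.val ((homeomorphUnitSphereProd E).symm_apply_apply x)
    rw [homeomorphUnitSphereProd_symm_apply_coe] at this
    simp only [this]
  have hm : Measurable (fun p : sphere (0 : E) 1 × Ioi (0 : ℝ) => f (p.2.1 • p.1.1)) := by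
    fun_prop
  rw [h1, lintegral_congr h2, h.lintegral_comp hm, lintegral_prod_symm _ hm.aemeasurable,
    Measure.volumeIoiPow, lintegral_withDensity_eq_lintegral_mul₀ (by fun_prop)]
  · rw [← lintegral_subtype_comap measurableSet_Ioi]
    rfl
  · exact (Measurable.lintegral_prod_left hm).aemeasurable

theorem lintegral_norm [Nontrivial E] (f : ℝ → ℝ≥0∞) (hf : Measurable f) :
    ∫⁻ x : E, f ‖x‖ = (volume : Measure E).toSphere univ *
      ∫⁻ r in Ioi (0 : ℝ), ENNReal.ofReal (r ^ (finrank ℝ E - 1)) * f r := by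
  rw [lintegral_polar (fun x => f ‖x‖) (by fun_prop), ← lintegral_const_mul _ (by fun_prop)]
  refine setLIntegral_congr_fun measurableSet_Ioi fun r hr => ?_
  have : ∀ u : sphere (0 : E) 1, f ‖r • (u : E)‖ = f r := fun u => by
    simp [norm_smul, abs_of_pos (mem_Ioi.1 hr)]
  simp only [this, lintegral_const]
  ring

/-- Cartesian product of a line and its orthogonal complement. -/
theorem measurePreserving_smul_add (v : E) (hv : ‖v‖ = 1) (L : Submodule ℝ E)
    (hL : L = (Submodule.span ℝ {v})ᗮ) :
    MeasurePreserving (fun p : ℝ × L => p.1 • v + (p.2 : E)) := by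
  subst hL
  let K := Submodule.span ℝ {v}
  have h1 := (LinearIsometryEquiv.toSpanUnitSingleton v hv).measurePreserving
  have h2 := h1.prod (MeasurePreserving.id (volume : Measure Kᗮ))
  have h3 := (WithLp.volume_preserving_toLp K Kᗮ).comp h2
  have h4 := (K.orthogonalDecomposition.symm.measurePreserving).comp h3
  convert h4 using 1
  · ext p
    simp [K]
  · rfl

/-- The surface area `2 π^{p/2} / Γ(p/2)` of the unit sphere of `ℝᵖ`. -/
def sphereArea (p : ℕ) : ℝ := 2 * Real.pi ^ ((p : ℝ) / 2) / Real.Gamma ((p : ℝ) / 2)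

theorem sphereArea_pos {p : ℕ} (hp : 0 < p) : 0 < sphereArea p := by
  have := Real.Gamma_pos_of_pos (s := (p : ℝ) / 2) (by positivity)
  unfold sphereArea
  positivity

/-- The area is the dimension times the volume of the unit ball. -/
theorem toSphere_univ [Nontrivial E] :
    (volume : Measure E).toSphere univ = ENNReal.ofReal (sphereArea (finrank ℝ E)) := by
  have hp : 0 < finrank ℝ E := finrank_pos
  rw [Measure.toSphere_apply_univ, InnerProductSpace.volume_ball, ENNReal.ofReal_one, one_pow,
    one_mul, ← ENNReal.ofReal_natCast, ← ENNReal.ofReal_mul (by positivity)]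
  congr 1
  have hp' : (0 : ℝ) < (finrank ℝ E : ℝ) / 2 := by positivity
  have := Real.Gamma_pos_of_pos hp'
  rw [Real.Gamma_add_one hp'.ne', sphereArea, Real.sqrt_eq_rpow, ← Real.rpow_natCast,
    ← Real.rpow_mul Real.pi_pos.le]
  field_simp

/-- Integration of a function of the norm and of one coordinate. -/
theorem lintegral_axial (hE : 2 ≤ finrank ℝ E) (v : E) (hv : ‖v‖ = 1) (F : ℝ × ℝ → ℝ≥0∞)
    (hF : Measurable F) :
    ∫⁻ x : E, F (inner ℝ x v, ‖x‖) = ENNReal.ofReal (sphereArea (finrank ℝ E - 1)) *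
      ∫⁻ t : ℝ, ∫⁻ s in Ioi (0 : ℝ),
        ENNReal.ofReal (s ^ (finrank ℝ E - 2)) * F (t, Real.sqrt (t ^ 2 + s ^ 2)) := by
  have hv0 : v ≠ 0 := by
    rintro rfl
    simp at hv
  have hfin : finrank ℝ (Submodule.span ℝ {v})ᗮ = finrank ℝ E - 1 := by
    have := (Submodule.span ℝ {v}).finrank_add_finrank_orthogonal
    rw [finrank_span_singleton hv0] at this
    omega
  have : Nontrivial (Submodule.span ℝ {v})ᗮ := by
    rw [← finrank_pos_iff (R := ℝ), hfin]
    omega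
  have h := measurePreserving_smul_add v hv _ rfl
  have hm : Measurable fun x : E => F (inner ℝ x v, ‖x‖) := by fun_prop
  rw [← h.lintegral_comp hm, Measure.volume_eq_prod, lintegral_prod _ (by fun_prop),
    ← lintegral_const_mul]
  · refine lintegral_congr fun t => ?_
    have key : ∀ x : (Submodule.span ℝ {v})ᗮ,
        F (inner ℝ (t • v + (x : E)) v, ‖t • v + (x : E)‖) =
          (fun s => F (t, Real.sqrt (t ^ 2 + s ^ 2))) ‖x‖ := by
      intro x
      have hx : inner ℝ (x : E) v = 0 := by
        rw [real_inner_comm]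
        exact Submodule.mem_orthogonal_singleton_iff_inner_right.1 x.2
      have h1 : inner ℝ (t • v + (x : E)) v = t := by
        simp [inner_add_left, inner_smul_left, hx, hv]
      have h2 : ‖t • v + (x : E)‖ = Real.sqrt (t ^ 2 + ‖x‖ ^ 2) := by
        rw [eq_comm, Real.sqrt_eq_iff_eq_sq (by positivity) (by positivity), norm_add_sq_real,
          inner_smul_left, real_inner_comm, hx, norm_smul, hv]
        simp
      simp only [h1, h2]
    rw [lintegral_congr key, lintegral_norm (fun s => F (t, Real.sqrt (t ^ 2 + s ^ 2))) (by fun_prop),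
      toSphere_univ, hfin]
    rfl
  · have hm2 : Measurable fun p : ℝ × ℝ => ENNReal.ofReal (p.2 ^ (finrank ℝ E - 2)) *
        F (p.1, Real.sqrt (p.1 ^ 2 + p.2 ^ 2)) := by fun_prop
    exact hm2.lintegral_prod_right'

/-- No range condition on τ is needed because `Real.arccos` is constant outside [-1, 1]. Excluding θ
= 0 matters: for τ > 1 the right side would hold there and the left side would not. -/
theorem le_cos_iff_le_arccos {τ θ : ℝ} (h0 : 0 < θ) (hπ : θ ≤ Real.pi) :
    τ ≤ Real.cos θ ↔ θ ≤ Real.arccos τ := by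
  constructor
  · intro h
    simpa [Real.arccos_cos h0.le hπ] using Real.arccos_le_arccos h
  · intro h
    rcases le_or_gt τ (-1) with h1 | h1
    · exact h1.trans (Real.neg_one_le_cos θ)
    rcases le_or_gt 1 τ with h2 | h2
    · rw [Real.arccos_of_one_le h2] at h
      exact absurd h (not_le.2 h0)
    · simpa [Real.cos_arccos h1.le h2.le] using
        Real.cos_le_cos_of_nonneg_of_le_pi h0.le (Real.arccos_le_pi τ) h

/-- The integral of `sin ^ q` over the angles of a spherical cap. -/
def capIntegral (q : ℕ) (τ : ℝ) : ℝ := ∫ φ in (0 : ℝ)..Real.arccos τ, Real.sin φ ^ q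

/-- The domain (-π, π) is that of planar polar coordinates, and the condition sin θ > 0 selects the
half-plane where the distance from the axis is positive. -/
theorem lintegral_sin_pow_cap (q : ℕ) (τ : ℝ) :
    ∫⁻ θ in Ioo (-Real.pi) Real.pi, (if 0 < Real.sin θ ∧ τ ≤ Real.cos θ then
      ENNReal.ofReal (Real.sin θ ^ q) else 0) = ENNReal.ofReal (capIntegral q τ) := by
  have hsub : Ioc 0 (Real.arccos τ) ⊆ Icc 0 Real.pi := fun θ h =>
    ⟨h.1.le, h.2.trans (Real.arccos_le_pi τ)⟩
  rw [capIntegral, intervalIntegral.integral_of_le (Real.arccos_nonneg τ),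
    ofReal_integral_eq_lintegral_ofReal]
  · rw [← lintegral_indicator measurableSet_Ioo, ← lintegral_indicator measurableSet_Ioc]
    have hne : ∀ᵐ θ : ℝ, θ ≠ Real.pi := by simp [ae_iff]
    refine lintegral_congr_ae ?_
    filter_upwards [hne] with θ hθ
    simp only [indicator, mem_Ioo, mem_Ioc]
    rcases le_or_gt θ 0 with h0 | h0
    · rw [if_neg (c := 0 < θ ∧ _) (fun h => absurd h.1 (not_lt.2 h0))]
      split_ifs with h1 h2
      · exact absurd h2.1 (not_lt.2 (Real.sin_nonpos_of_nonpos_of_neg_pi_le h0 h1.1.le))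
      · rfl
      · rfl
    · rcases lt_or_ge θ Real.pi with h1 | h1
      · rw [if_pos ⟨by linarith [Real.pi_pos], h1⟩]
        simp only [Real.sin_pos_of_pos_of_lt_pi h0 h1, le_cos_iff_le_arccos h0 h1.le, h0, true_and]
      · have : Real.arccos τ < θ := (Real.arccos_le_pi τ).trans_lt (lt_of_le_of_ne h1 hθ.symm)
        rw [if_neg (fun h => absurd h.2 (not_lt.2 h1)), if_neg (fun h => absurd h.2 (not_le.2 this))]
  · exact (Continuous.intervalIntegrable (by fun_prop) _ _).1
  · filter_upwards [ae_restrict_mem measurableSet_Ioc] with θ hθ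
    exact pow_nonneg (Real.sin_nonneg_of_mem_Icc (hsub hθ)) _

/-- The surface area of a spherical cap. -/
theorem toSphere_cap (hE : 2 ≤ finrank ℝ E) (v : E) (hv : ‖v‖ = 1) (τ : ℝ) :
    (volume : Measure E).toSphere {u | τ ≤ inner ℝ (u : E) v} =
      ENNReal.ofReal (sphereArea (finrank ℝ E - 1)) *
        ENNReal.ofReal (capIntegral (finrank ℝ E - 2) τ) := by
  classical
  have : Nontrivial E := by
    rw [← finrank_pos_iff (R := ℝ)]
    omega
  set m := finrank ℝ E with hm
  -- Indicator of the cone over the cap, cut off by the open unit ball. Its volume is computed in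
  -- polar coordinates of E and in cylindrical coordinates; both results contain the radial factor
  -- `I`, which is positive and finite and cancels.
  let F : ℝ × ℝ → ℝ≥0∞ := fun p => if τ * p.2 ≤ p.1 ∧ p.2 < 1 then 1 else 0
  have hF : Measurable F := by
    have h1 : MeasurableSet {p : ℝ × ℝ | τ * p.2 ≤ p.1} :=
      measurableSet_le (by fun_prop) (by fun_prop)
    have h2 : MeasurableSet {p : ℝ × ℝ | p.2 < 1} := measurableSet_lt (by fun_prop) (by fun_prop)
    exact Measurable.ite (h1.inter h2) measurable_const measurable_const
  let I : ℝ≥0∞ := ∫⁻ r in Ioi (0 : ℝ), ENNReal.ofReal (r ^ (m - 1)) * (if r < 1 then 1 else 0)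
  have hI : I = ENNReal.ofReal (1 / m) := by
    have h1 : I = ∫⁻ r in Ioc (0 : ℝ) 1, ENNReal.ofReal (r ^ (m - 1)) := by
      simp only [I]
      rw [← lintegral_indicator measurableSet_Ioi, ← lintegral_indicator measurableSet_Ioc]
      have hne : ∀ᵐ θ : ℝ, θ ≠ 1 := by simp [ae_iff]
      refine lintegral_congr_ae ?_
      filter_upwards [hne] with r hr
      simp only [indicator, mem_Ioi, mem_Ioc]
      rcases lt_or_ge r 1 with h | h
      · simp [h, h.le]
      · have : ¬ r ≤ 1 := fun h' => hr (le_antisymm h' h)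
        simp [this, not_lt.2 h]
    rw [h1, ← ofReal_integral_eq_lintegral_ofReal (intervalIntegral.intervalIntegrable_pow _).1,
      ← intervalIntegral.integral_of_le zero_le_one, integral_pow]
    · rw [Nat.cast_sub (by omega), Nat.sub_add_cancel (by omega)]
      have : m ≠ 0 := by omega
      simp [this]
    · filter_upwards [ae_restrict_mem measurableSet_Ioc] with r hr
      exact pow_nonneg hr.1.le _
  have hI0 : I ≠ 0 := by
    rw [hI]
    have : (0 : ℝ) < m := by
      have : 0 < m := by omega
      exact_mod_cast this
    simp [this]
  have hIt : I ≠ ∞ := by simp [hI]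
  have hA : ∫⁻ x : E, F (inner ℝ x v, ‖x‖) =
      I * (volume : Measure E).toSphere {u | τ ≤ inner ℝ (u : E) v} := by
    rw [lintegral_polar (fun x => F (inner ℝ x v, ‖x‖)) (by fun_prop),
      ← lintegral_mul_const _ (by
        refine Measurable.mul (by fun_prop) (Measurable.ite measurableSet_Iio ?_ ?_) <;> fun_prop)]
    refine setLIntegral_congr_fun measurableSet_Ioi fun r hr => ?_
    have hr' : 0 < r := hr
    have key : ∀ u : sphere (0 : E) 1, F (inner ℝ (r • (u : E)) v, ‖r • (u : E)‖) =
        (if r < 1 then 1 else 0) * {u : sphere (0 : E) 1 | τ ≤ inner ℝ (u : E) v}.indicator 1 u := by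
      intro u
      have e1 : ‖r • (u : E)‖ = r := by simp [norm_smul, abs_of_pos hr']
      have e2 : inner ℝ (r • (u : E)) v = r * inner ℝ (u : E) v := by simp [inner_smul_left]
      have e3 : τ * r ≤ r * inner ℝ (u : E) v ↔ τ ≤ inner ℝ (u : E) v := by
        rw [mul_comm τ, mul_le_mul_iff_right₀ hr']
      simp only [F, e1, e2, e3, indicator, mem_ofPred_eq]
      split_ifs <;> simp_all
    have hms : MeasurableSet {u : sphere (0 : E) 1 | τ ≤ inner ℝ (u : E) v} :=
      measurableSet_le (by fun_prop) (by fun_prop)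
    rw [lintegral_congr key, lintegral_const_mul _ (measurable_one.indicator hms),
      lintegral_indicator_one hms, mul_assoc]
  have hB : ∫⁻ t : ℝ, ∫⁻ s in Ioi (0 : ℝ),
        ENNReal.ofReal (s ^ (m - 2)) * F (t, Real.sqrt (t ^ 2 + s ^ 2)) =
      I * ENNReal.ofReal (capIntegral (m - 2) τ) := by
    -- Extension by zero from the half-plane to the plane, so that planar polar coordinates apply.
    let G : ℝ × ℝ → ℝ≥0∞ := fun p => if 0 < p.2 then
      ENNReal.ofReal (p.2 ^ (m - 2)) * F (p.1, Real.sqrt (p.1 ^ 2 + p.2 ^ 2)) else 0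
    have hG : Measurable G := by
      refine Measurable.ite (measurableSet_lt measurable_const measurable_snd) ?_ measurable_const
      fun_prop
    have h1 : ∫⁻ t : ℝ, ∫⁻ s in Ioi (0 : ℝ),
        ENNReal.ofReal (s ^ (m - 2)) * F (t, Real.sqrt (t ^ 2 + s ^ 2)) = ∫⁻ p, G p := by
      rw [Measure.volume_eq_prod, lintegral_prod _ hG.aemeasurable]
      refine lintegral_congr fun t => ?_
      rw [← lintegral_indicator measurableSet_Ioi]
      rfl
    rw [h1, ← lintegral_comp_polarCoord_symm, polarCoord_target, Measure.volume_eq_prod,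
      ← Measure.prod_restrict, lintegral_prod]
    · rw [← lintegral_mul_const _ (by
        refine Measurable.mul (by fun_prop) (Measurable.ite measurableSet_Iio ?_ ?_) <;> fun_prop)]
      refine setLIntegral_congr_fun measurableSet_Ioi fun r hr => ?_
      have hr' : 0 < r := hr
      simp only
      rw [← lintegral_sin_pow_cap, ← lintegral_const_mul]
      · refine lintegral_congr fun θ => ?_
        have e1 : Real.sqrt ((r * Real.cos θ) ^ 2 + (r * Real.sin θ) ^ 2) = r := by
          rw [mul_pow, mul_pow, ← mul_add, Real.cos_sq_add_sin_sq, mul_one, Real.sqrt_sq hr'.le]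
        have e3 : τ * r ≤ r * Real.cos θ ↔ τ ≤ Real.cos θ := by
          rw [mul_comm τ, mul_le_mul_iff_right₀ hr']
        have e4 : 0 < r * Real.sin θ ↔ 0 < Real.sin θ := mul_pos_iff_of_pos_left hr'
        simp only [polarCoord_symm_apply, G, F, e1, e3, e4, smul_eq_mul]
        by_cases h2 : 0 < Real.sin θ
        · have e5 : ENNReal.ofReal (r ^ (m - 1)) * ENNReal.ofReal (Real.sin θ ^ (m - 2)) =
              ENNReal.ofReal r * ENNReal.ofReal ((r * Real.sin θ) ^ (m - 2)) := by
            rw [← ENNReal.ofReal_mul (by positivity), ← ENNReal.ofReal_mul (by positivity), mul_pow,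
              show m - 1 = (m - 2) + 1 by omega, pow_succ]
            congr 1
            ring
          by_cases h3 : τ ≤ Real.cos θ <;> by_cases h4 : r < 1 <;> simp [h2, h3, h4, e5]
        · simp [h2]
      · have h2 : MeasurableSet {θ : ℝ | 0 < Real.sin θ} :=
          measurableSet_lt (by fun_prop) (by fun_prop)
        have h3 : MeasurableSet {θ : ℝ | τ ≤ Real.cos θ} :=
          measurableSet_le (by fun_prop) (by fun_prop)
        exact Measurable.ite (h2.inter h3) (by fun_prop) measurable_const
    · have h2 : Measurable fun p => G (polarCoord.symm p) :=
        hG.comp continuous_polarCoord_symm.measurable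
      have h3 : Measurable fun p : ℝ × ℝ => ENNReal.ofReal p.1 • G (polarCoord.symm p) :=
        (ENNReal.measurable_ofReal.comp measurable_fst).mul h2
      exact h3.aemeasurable
  have hax := lintegral_axial hE v hv F hF
  rw [hA, hB, ← hm] at hax
  rw [← ENNReal.mul_right_inj hI0 hIt, hax]
  ring

end Geometry

/-! ### The Gaussian law in radial, tangential and directional components -/

section Gaussian

open Metric Module
open scoped ENNReal NNReal

theorem pi_gaussianReal_eq_withDensity {ι : Type*} [Fintype ι] {v : ℝ≥0} (hv : v ≠ 0) :
    Measure.pi (fun _ : ι => gaussianReal 0 v) =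
      volume.withDensity (fun x => ENNReal.ofReal (∏ i, gaussianPDFReal 0 v (x i))) := by
  refine Measure.pi_eq fun s hs => ?_
  have hms : MeasurableSet (pi univ s) := MeasurableSet.univ_pi hs
  have hint : Integrable (fun x : ι → ℝ => ∏ i, gaussianPDFReal 0 v (x i)) :=
    Integrable.fintype_prod fun _ => integrable_gaussianPDFReal 0 v
  rw [withDensity_apply _ hms, ← ofReal_integral_eq_lintegral_ofReal hint.integrableOn
    (Filter.Eventually.of_forall fun x => Finset.prod_nonneg fun i _ => gaussianPDFReal_nonneg 0 v _),
    volume_pi, Measure.restrict_pi_pi, integral_fintype_prod_eq_prod (𝕜 := ℝ)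
      (fun _ : ι => gaussianPDFReal 0 v),
    ENNReal.ofReal_prod_of_nonneg fun i _ => integral_nonneg fun x => gaussianPDFReal_nonneg 0 v _]
  exact Finset.prod_congr rfl fun i _ => (gaussianReal_apply_eq_integral 0 hv _).symm

/-- The `N(0, σ² I_p)` density at distance `r` from the mean. -/
def gaussDensity (p : ℕ) (σ r : ℝ) : ℝ :=
  (Real.sqrt (2 * Real.pi * σ ^ 2))⁻¹ ^ p * Real.exp (-r ^ 2 / (2 * σ ^ 2))

theorem gaussDensity_nonneg (p : ℕ) (σ r : ℝ) : 0 ≤ gaussDensity p σ r := by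
  unfold gaussDensity
  positivity

@[fun_prop]
theorem continuous_gaussDensity (p : ℕ) (σ : ℝ) : Continuous (gaussDensity p σ) := by
  unfold gaussDensity
  fun_prop

/-- The noise variance. -/
def noiseVar (σ : ℝ) : ℝ≥0 := ⟨σ ^ 2, sq_nonneg σ⟩

theorem coe_noiseVar (σ : ℝ) : (noiseVar σ : ℝ) = σ ^ 2 := rfl

theorem radialDensity_eq (σ z : ℝ) : radialDensity σ z =
    (Real.sqrt (2 * Real.pi * σ ^ 2))⁻¹ * Real.exp (-z ^ 2 / (2 * σ ^ 2)) := by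
  change gaussianPDFReal 0 (noiseVar σ) z = _
  simp [gaussianPDFReal, coe_noiseVar]

theorem noiseVar_ne_zero {σ : ℝ} (hσ : 0 < σ) : noiseVar σ ≠ 0 := by
  rw [← NNReal.coe_ne_zero]
  exact (pow_pos hσ 2).ne'

theorem received_eq (n : ℕ) (σ : ℝ) : received n σ =
    (Measure.pi (fun _ : Fin n => gaussianReal 0 (noiseVar σ))).map
      (fun z => sent n + WithLp.toLp 2 z) := rfl

variable {n : ℕ} {σ : ℝ}

theorem lintegral_received (hσ : 0 < σ) (f : Signal n → ℝ≥0∞) (hf : Measurable f) :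
    ∫⁻ y, f y ∂received n σ =
      ∫⁻ x : Signal n, f (sent n + x) * ENNReal.ofReal (gaussDensity n σ ‖x‖) := by
  have h := (PiLp.volume_preserving_toLp (Fin n)).lintegral_comp
    (f := fun x : Signal n => f (sent n + x) * ENNReal.ofReal (gaussDensity n σ ‖x‖)) (by fun_prop)
  rw [← h, received_eq, pi_gaussianReal_eq_withDensity (noiseVar_ne_zero hσ),
    lintegral_map hf (by fun_prop), lintegral_withDensity_eq_lintegral_mul _ (by
      refine ENNReal.measurable_ofReal.comp ?_
      exact Finset.measurable_prod _ fun i _ =>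
        (measurable_gaussianPDFReal 0 _).comp (measurable_pi_apply i)) (by fun_prop)]
  refine lintegral_congr fun x => ?_
  rw [Pi.mul_apply, mul_comm]
  congr 2
  have e1 : ∀ i, gaussianPDFReal 0 (noiseVar σ) (x i) =
      (Real.sqrt (2 * Real.pi * σ ^ 2))⁻¹ * Real.exp (-(x i) ^ 2 / (2 * σ ^ 2)) :=
    fun i => radialDensity_eq σ (x i)
  rw [Finset.prod_congr rfl fun i _ => e1 i, Finset.prod_mul_distrib, ← Real.exp_sum, gaussDensity,
    ← Finset.sum_div, Finset.sum_neg_distrib, EuclideanSpace.real_norm_sq_eq]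
  simp

instance isProbabilityMeasure_received : IsProbabilityMeasure (received n σ) := by
  rw [received_eq]
  exact Measure.isProbabilityMeasure_map (by fun_prop)

theorem norm_sent (n : ℕ) : ‖sent n‖ = Real.sqrt n := by
  simp [sent, bpsk, EuclideanSpace.norm_eq]

/-- The unit vector of the axis along which the radial noise component is measured. -/
def axis (n : ℕ) : Signal n := -((Real.sqrt n)⁻¹ • sent n)

theorem norm_axis (hn : 0 < n) : ‖axis n‖ = 1 := by
  have : (0 : ℝ) < n := by exact_mod_cast hn
  have h := Real.sqrt_pos.2 this
  rw [axis, norm_neg, norm_smul, norm_sent, norm_inv, Real.norm_of_nonneg h.le,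
    inv_mul_cancel₀ h.ne']

theorem tangent_eq (hn : 0 < n) : Tangent n = (Submodule.span ℝ {axis n})ᗮ := by
  have : (0 : ℝ) < n := by exact_mod_cast hn
  have h := Real.sqrt_pos.2 this
  rw [axis, ← neg_smul, Submodule.span_singleton_smul_eq
    (IsUnit.mk0 _ (neg_ne_zero.2 (inv_ne_zero h.ne')))]

theorem sent_ne_zero (hn : 0 < n) : sent n ≠ 0 := by
  have : (0 : ℝ) < n := by exact_mod_cast hn
  rw [← norm_ne_zero_iff, norm_sent]
  exact (Real.sqrt_pos.2 this).ne'

theorem finrank_tangent (hn : 0 < n) : finrank ℝ (Tangent n) = n - 1 := by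
  have := (Submodule.span ℝ {sent n}).finrank_add_finrank_orthogonal
  rw [finrank_span_singleton (sent_ne_zero hn), finrank_euclideanSpace, Fintype.card_fin] at this
  change finrank ℝ ↥(Submodule.span ℝ {sent n})ᗮ = _
  omega

theorem nontrivial_tangent (hn : 2 ≤ n) : Nontrivial (Tangent n) := by
  rw [← finrank_pos_iff (R := ℝ), finrank_tangent (by omega)]
  omega

theorem inner_tangent_sent (x : Tangent n) : inner ℝ (x : Signal n) (sent n) = 0 := by
  rw [real_inner_comm]
  exact Submodule.mem_orthogonal_singleton_iff_inner_right.1 x.2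

theorem inner_tangent_axis (x : Tangent n) : inner ℝ (x : Signal n) (axis n) = 0 := by
  simp [axis, inner_neg_right, inner_smul_right, inner_tangent_sent]

theorem center_eq (z : ℝ) : center n z = sent n + z • axis n := by
  rw [center, axis, sub_smul, one_smul, smul_neg, smul_smul, sub_eq_add_neg, div_eq_mul_inv]

theorem radial_center_add (hn : 0 < n) (z : ℝ) (x : Tangent n) : radial (center n z + (x : Signal n)) = z := by
  have : radial (center n z + (x : Signal n)) = inner ℝ (center n z + x - sent n) (axis n) := rfl
  rw [this, center_eq, add_assoc, add_sub_cancel_left, inner_add_left, inner_tangent_axis,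
    inner_smul_left, real_inner_self_eq_norm_sq, norm_axis hn]
  simp

theorem tangentialNorm_center_add (hn : 0 < n) (z : ℝ) (x : Tangent n) :
    tangentialNorm (center n z + (x : Signal n)) = ‖x‖ := by
  unfold tangentialNorm
  rw [radial_center_add hn, add_sub_cancel_left]
  rfl

@[fun_prop]
theorem continuous_center (n : ℕ) : Continuous (center n) := by
  unfold center
  fun_prop

@[fun_prop]
theorem continuous_radial : Continuous (radial (n := n)) := by
  unfold radial
  fun_prop

@[fun_prop]
theorem continuous_tangentialNorm : Continuous (tangentialNorm (n := n)) := by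
  unfold tangentialNorm
  fun_prop

/-- By Pythagoras the exponent splits; this is the independence of the radial and tangential noise.
-/
theorem gaussDensity_norm_add (hn : 0 < n) (z : ℝ) (x : Tangent n) :
    gaussDensity n σ ‖z • axis n + (x : Signal n)‖ =
      radialDensity σ z * gaussDensity (n - 1) σ ‖x‖ := by
  have h1 : ‖z • axis n + (x : Signal n)‖ ^ 2 = z ^ 2 + ‖x‖ ^ 2 := by
    rw [norm_add_sq_real, inner_smul_left, real_inner_comm, inner_tangent_axis, norm_smul,
      norm_axis hn]
    simp
  obtain ⟨m, rfl⟩ : ∃ m, n = m + 1 := ⟨n - 1, by omega⟩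
  rw [gaussDensity, h1, radialDensity_eq, gaussDensity, neg_add, add_div, Real.exp_add,
    Nat.add_sub_cancel, pow_succ]
  ring

theorem normDensity_eq (hn : 2 ≤ n) (hσ : 0 < σ) (r : ℝ) : normDensity n σ r =
    sphereArea (n - 1) * (r ^ (n - 2) * gaussDensity (n - 1) σ r) := by
  obtain ⟨m, rfl⟩ : ∃ m, n = m + 2 := ⟨n - 2, by omega⟩
  have hc : ((m + 2 - 1 : ℕ) : ℝ) = ((m + 2 : ℕ) : ℝ) - 1 := by
    rw [Nat.cast_sub (by omega)]
    simp
  have h1 : Real.sqrt (2 * Real.pi * σ ^ 2) ^ (m + 2 - 1) =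
      2 ^ ((((m + 2 : ℕ) : ℝ) - 1) / 2) * Real.pi ^ ((((m + 2 : ℕ) : ℝ) - 1) / 2) *
        σ ^ (m + 2 - 1) := by
    rw [Real.sqrt_mul (by positivity), Real.sqrt_sq hσ.le, mul_pow,
      Real.sqrt_eq_rpow, ← Real.rpow_natCast, ← Real.rpow_mul (by positivity), hc,
      ← Real.mul_rpow (by positivity) (by positivity)]
    congr 2
    ring
  have h2 := Real.Gamma_pos_of_pos (s := (((m + 2 : ℕ) : ℝ) - 1) / 2) (by
    push_cast
    have : (0 : ℝ) ≤ m := by positivity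
    linarith)
  have h3 : (0 : ℝ) < Real.pi ^ ((((m + 2 : ℕ) : ℝ) - 1) / 2) := Real.rpow_pos_of_pos Real.pi_pos _
  have h4 : (0 : ℝ) < 2 ^ ((((m + 2 : ℕ) : ℝ) - 1) / 2) := Real.rpow_pos_of_pos two_pos _
  rw [normDensity, sphereArea, gaussDensity, inv_pow, h1, hc]
  field_simp

theorem normDensity_nonneg (hn : 2 ≤ n) (hσ : 0 < σ) {r : ℝ} (hr : 0 ≤ r) :
    0 ≤ normDensity n σ r := by
  rw [normDensity_eq hn hσ]
  have := sphereArea_pos (p := n - 1) (by omega)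
  have := gaussDensity_nonneg (n - 1) σ r
  positivity

theorem normDensity_pos (hn : 2 ≤ n) (hσ : 0 < σ) {r : ℝ} (hr : 0 < r) :
    0 < normDensity n σ r := by
  rw [normDensity_eq hn hσ]
  have := sphereArea_pos (p := n - 1) (by omega)
  unfold gaussDensity
  positivity

@[fun_prop]
theorem continuous_normDensity (n : ℕ) (σ : ℝ) : Continuous (normDensity n σ) := by
  unfold normDensity
  fun_prop

/-- The uniform distribution on the unit sphere of the tangent space. -/
def uniformDirection (n : ℕ) : Measure (sphere (0 : Tangent n) 1) :=
  ((volume : Measure (Tangent n)).toSphere univ)⁻¹ • (volume : Measure (Tangent n)).toSphere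

theorem isProbabilityMeasure_uniformDirection (hn : 2 ≤ n) :
    IsProbabilityMeasure (uniformDirection n) := by
  have := nontrivial_tangent hn
  refine ⟨?_⟩
  rw [uniformDirection, Measure.smul_apply, smul_eq_mul, ENNReal.inv_mul_cancel]
  · rw [Ne, Measure.measure_univ_eq_zero]
    exact Measure.toSphere_ne_zero _
  · exact measure_ne_top _ _

/-- The law of the tangential noise length. -/
def normLaw (n : ℕ) (σ : ℝ) : Measure ℝ :=
  (volume.restrict (Ioi 0)).withDensity fun r => ENNReal.ofReal (normDensity n σ r)

/-- The law of the radial noise component. -/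
def radialLaw (σ : ℝ) : Measure ℝ := gaussianReal 0 (noiseVar σ)

instance : IsProbabilityMeasure (radialLaw σ) := by
  unfold radialLaw
  infer_instance

instance : SFinite (normLaw n σ) := by
  unfold normLaw
  infer_instance

theorem radialLaw_eq (hσ : 0 < σ) :
    radialLaw σ = volume.withDensity fun z => ENNReal.ofReal (radialDensity σ z) :=
  gaussianReal_of_var_ne_zero 0 (noiseVar_ne_zero hσ)

@[fun_prop]
theorem continuous_radialDensity (σ : ℝ) : Continuous (radialDensity σ) := by
  have : radialDensity σ = fun z => _ := funext (radialDensity_eq σ)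
  rw [this]
  fun_prop

theorem radialDensity_nonneg (σ z : ℝ) : 0 ≤ radialDensity σ z := gaussianPDFReal_nonneg 0 _ z

theorem radialDensity_pos (hσ : 0 < σ) (z : ℝ) : 0 < radialDensity σ z :=
  gaussianPDFReal_pos 0 _ z (noiseVar_ne_zero hσ)

/-- The sphere measure is normalized and its total area moved into the radial weight, so that the
inner integral is an average over a uniform direction, independent of the norm. -/
theorem lintegral_mul_norm_polar {E : Type*} [NormedAddCommGroup E] [InnerProductSpace ℝ E]
    [FiniteDimensional ℝ E] [MeasurableSpace E] [BorelSpace E] [Nontrivial E] (F : E → ℝ≥0∞)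
    (hF : Measurable F) (w : ℝ → ℝ≥0∞) (hw : Measurable w) :
    ∫⁻ x, F x * w ‖x‖ = ∫⁻ r in Ioi (0 : ℝ),
      ENNReal.ofReal (sphereArea (finrank ℝ E)) * ENNReal.ofReal (r ^ (finrank ℝ E - 1)) * w r *
        ∫⁻ u, F (r • (u : E))
          ∂(((volume : Measure E).toSphere univ)⁻¹ • (volume : Measure E).toSphere) := by
  rw [lintegral_polar _ (by fun_prop)]
  refine setLIntegral_congr_fun measurableSet_Ioi fun r hr => ?_
  have hr' : 0 < r := hr
  have e2 : ∀ u : sphere (0 : E) 1, ‖r • (u : E)‖ = r := fun u => by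
    simp [norm_smul, abs_of_pos hr']
  simp only [e2]
  rw [lintegral_mul_const _ (by fun_prop), lintegral_smul_measure, toSphere_univ, smul_eq_mul]
  have hS := sphereArea_pos (p := finrank ℝ E) finrank_pos
  have hS0 : ENNReal.ofReal (sphereArea (finrank ℝ E)) ≠ 0 := by simpa using hS
  have hc := ENNReal.mul_inv_cancel hS0 ENNReal.ofReal_ne_top
  set L := ∫⁻ u : sphere (0 : E) 1, F (r • (u : E)) ∂(volume : Measure E).toSphere
  calc _ = (ENNReal.ofReal (sphereArea (finrank ℝ E)) *
        (ENNReal.ofReal (sphereArea (finrank ℝ E)))⁻¹) *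
        (ENNReal.ofReal (r ^ (finrank ℝ E - 1)) * w r * L) := by
        rw [hc]
        ring
    _ = _ := by ring

theorem lintegral_tangent (hn : 2 ≤ n) (hσ : 0 < σ) (F : Tangent n → ℝ≥0∞) (hF : Measurable F) :
    ∫⁻ x, F x * ENNReal.ofReal (gaussDensity (n - 1) σ ‖x‖) =
      ∫⁻ r, ∫⁻ u : sphere (0 : Tangent n) 1, F (r • (u : Tangent n)) ∂uniformDirection n
        ∂normLaw n σ := by
  have := nontrivial_tangent hn
  have := isProbabilityMeasure_uniformDirection hn
  have hm : Measurable fun q : ℝ × sphere (0 : Tangent n) 1 => F (q.1 • (q.2 : Tangent n)) := by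
    fun_prop
  have hm1 : Measurable fun r : ℝ => ∫⁻ u : sphere (0 : Tangent n) 1,
      F (r • (u : Tangent n)) ∂uniformDirection n := hm.lintegral_prod_right'
  rw [lintegral_mul_norm_polar F hF (fun r => ENNReal.ofReal (gaussDensity (n - 1) σ r))
    (by fun_prop), normLaw, lintegral_withDensity_eq_lintegral_mul _ (by fun_prop) hm1]
  refine setLIntegral_congr_fun measurableSet_Ioi fun r hr => ?_
  have hr' : 0 < r := hr
  have hS := sphereArea_pos (p := n - 1) (by omega)
  simp only [Pi.mul_apply, finrank_tangent (show 0 < n by omega), uniformDirection]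
  rw [normDensity_eq hn hσ, ENNReal.ofReal_mul hS.le, ENNReal.ofReal_mul (by positivity),
    show n - 1 - 1 = n - 2 by omega, mul_assoc (ENNReal.ofReal (sphereArea (n - 1)))]

/-- The map from polar coordinates to the signal space. -/
def point (q : (ℝ × ℝ) × sphere (0 : Tangent n) 1) : Signal n :=
  center n q.1.1 + q.1.2 • ((q.2 : Tangent n) : Signal n)

theorem measurable_point : Measurable (point (n := n)) := by
  have h1 : Continuous fun q : (ℝ × ℝ) × sphere (0 : Tangent n) 1 => ((q.2 : Tangent n) : Signal n) :=
    continuous_subtype_val.comp (continuous_subtype_val.comp continuous_snd)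
  have h2 : Continuous fun q : (ℝ × ℝ) × sphere (0 : Tangent n) 1 => center n q.1.1 :=
    (continuous_center n).comp (continuous_fst.comp continuous_fst)
  exact (h2.add ((continuous_snd.comp continuous_fst).smul h1)).measurable

theorem measurable_point_right (p : ℝ × ℝ) :
    Measurable fun u : sphere (0 : Tangent n) 1 => point (p, u) :=
  measurable_point.comp measurable_prodMk_left

/-- The received vector in terms of its radial component, the length of its tangential component,
and the direction of the latter. -/
theorem lintegral_received_polar (hn : 2 ≤ n) (hσ : 0 < σ) (f : Signal n → ℝ≥0∞)
    (hf : Measurable f) :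
    ∫⁻ y, f y ∂received n σ = ∫⁻ p, ∫⁻ u : sphere (0 : Tangent n) 1,
      f (point (p, u)) ∂uniformDirection n
        ∂(radialLaw σ).prod (normLaw n σ) := by
  have := isProbabilityMeasure_uniformDirection hn
  have hn0 : 0 < n := by omega
  have h := measurePreserving_smul_add (axis n) (norm_axis hn0) (Tangent n) (tangent_eq hn0)
  have hm : Measurable fun q : (ℝ × ℝ) × sphere (0 : Tangent n) 1 => f (point q) :=
    hf.comp measurable_point
  have hm1 : Measurable fun p : ℝ × ℝ => ∫⁻ u : sphere (0 : Tangent n) 1,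
      f (point (p, u)) ∂uniformDirection n :=
    hm.lintegral_prod_right'
  rw [lintegral_received hσ f hf, ← h.lintegral_comp (by fun_prop), Measure.volume_eq_prod,
    lintegral_prod _ (by fun_prop), lintegral_prod _ hm1.aemeasurable, radialLaw_eq hσ,
    lintegral_withDensity_eq_lintegral_mul _ (by fun_prop) hm1.lintegral_prod_right']
  refine lintegral_congr fun z => ?_
  have e1 : ∀ x : Tangent n, f (sent n + (z • axis n + (x : Signal n))) *
      ENNReal.ofReal (gaussDensity n σ ‖z • axis n + (x : Signal n)‖) =
      ENNReal.ofReal (radialDensity σ z) *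
        (f (center n z + (x : Signal n)) * ENNReal.ofReal (gaussDensity (n - 1) σ ‖x‖)) := by
    intro x
    rw [gaussDensity_norm_add hn0, ENNReal.ofReal_mul (radialDensity_nonneg σ z), center_eq,
      ← add_assoc]
    ring
  rw [lintegral_congr e1, lintegral_const_mul _ (by fun_prop), lintegral_tangent hn hσ
    (fun x => f (center n z + (x : Signal n))) (by fun_prop)]
  rfl

/-- The decomposition applied to the constant 1 gives the total mass, so no Gamma integral has to be
evaluated. -/
theorem isProbabilityMeasure_normLaw (hn : 2 ≤ n) (hσ : 0 < σ) :
    IsProbabilityMeasure (normLaw n σ) := by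
  have := isProbabilityMeasure_uniformDirection hn
  have h := lintegral_received_polar hn hσ (fun _ => 1) measurable_const
  refine ⟨?_⟩
  simpa [← univ_prod_univ] using h.symm

theorem measurableSet_pairError (c : Fin n → ZMod 2) : MeasurableSet (pairError c) :=
  measurableSet_le (by fun_prop) (by fun_prop)

theorem condPairError_eq (z r : ℝ) (c : Fin n → ZMod 2) : condPairError z r c =
    (uniformDirection n).real {u | point ((z, r), u) ∈ pairError c} := by
  rw [condPairError, uniformDirection, measureReal_ennreal_smul_apply, ENNReal.toReal_inv,
    div_eq_inv_mul]
  rfl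

theorem condPairError_nonneg (z r : ℝ) (c : Fin n → ZMod 2) : 0 ≤ condPairError z r c := by
  unfold condPairError
  positivity

theorem condPairError_le_one (hn : 2 ≤ n) (z r : ℝ) (c : Fin n → ZMod 2) :
    condPairError z r c ≤ 1 := by
  have := isProbabilityMeasure_uniformDirection hn
  rw [condPairError_eq]
  exact measureReal_le_one

theorem measurable_condPairError (hn : 2 ≤ n) (c : Fin n → ZMod 2) :
    Measurable fun p : ℝ × ℝ => condPairError p.1 p.2 c := by
  have := isProbabilityMeasure_uniformDirection hn
  have hms : MeasurableSet {q : (ℝ × ℝ) × sphere (0 : Tangent n) 1 |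
      point q ∈ pairError c} :=
    measurable_point (measurableSet_pairError c)
  simp only [condPairError_eq]
  exact (measurable_measure_prodMk_left hms).ennreal_toReal

theorem normLaw_ae_pos : ∀ᵐ r ∂normLaw n σ, 0 < r :=
  (withDensity_absolutelyContinuous _ _).ae_le (ae_restrict_mem measurableSet_Ioi)

theorem ae_snd_pos : ∀ᵐ p ∂(radialLaw σ).prod (normLaw n σ), 0 < p.2 :=
  Measure.quasiMeasurePreserving_snd.ae normLaw_ae_pos

/-- The radial and tangential noise components of the received vector. -/
def components (y : Signal n) : ℝ × ℝ := (radial y, tangentialNorm y)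

@[fun_prop]
theorem measurable_components : Measurable (components (n := n)) := by
  unfold components
  fun_prop

theorem components_point (hn : 0 < n) (z : ℝ) {r : ℝ} (hr : 0 ≤ r)
    (u : sphere (0 : Tangent n) 1) :
    components (point ((z, r), u)) = (z, r) := by
  have h1 := radial_center_add hn z (r • (u : Tangent n))
  have h2 := tangentialNorm_center_add hn z (r • (u : Tangent n))
  rw [norm_smul, norm_eq_of_mem_sphere, mul_one, Real.norm_of_nonneg hr] at h2
  exact Prod.ext h1 h2

/-- The components are constant on each sphere, so membership in A leaves the inner integral over
directions, and what remains inside is `condPairError`. The radius must be positive for the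
components to be recovered from polar coordinates, which holds almost everywhere. -/
theorem received_pairError_inter (hn : 2 ≤ n) (hσ : 0 < σ) (c : Fin n → ZMod 2) {A : Set (ℝ × ℝ)}
    (hA : MeasurableSet A) :
    (received n σ).real (pairError c ∩ components ⁻¹' A) =
      ∫ p in A, condPairError p.1 p.2 c ∂(radialLaw σ).prod (normLaw n σ) := by
  have := isProbabilityMeasure_uniformDirection hn
  have hn0 : 0 < n := by omega
  have hms : MeasurableSet (pairError c ∩ components ⁻¹' A) :=
    (measurableSet_pairError c).inter (measurable_components hA)
  have h1 : received n σ (pairError c ∩ components ⁻¹' A) =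
      ∫⁻ p in A, ENNReal.ofReal (condPairError p.1 p.2 c) ∂(radialLaw σ).prod (normLaw n σ) := by
    rw [← lintegral_indicator_one hms,
      lintegral_received_polar hn hσ _ (measurable_one.indicator hms), ← lintegral_indicator hA]
    refine lintegral_congr_ae ?_
    filter_upwards [ae_snd_pos (n := n) (σ := σ)] with p hp
    have hms2 : MeasurableSet {u : sphere (0 : Tangent n) 1 | point (p, u) ∈ pairError c} :=
      measurable_point_right p (measurableSet_pairError c)
    have hcomp : ∀ u, components (point (p, u)) = p := fun u => components_point hn0 p.1 hp.le u
    by_cases hpA : p ∈ A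
    · rw [indicator_of_mem hpA, condPairError_eq, ofReal_measureReal]
      refine Eq.trans (lintegral_congr fun u => ?_) (lintegral_indicator_one hms2)
      have hiff : point (p, u) ∈ pairError c ∩ components ⁻¹' A ↔ point (p, u) ∈ pairError c := by
        rw [mem_inter_iff, mem_preimage, hcomp]
        exact and_iff_left hpA
      by_cases hu : point (p, u) ∈ pairError c
      · rw [indicator_of_mem (hiff.2 hu), indicator_of_mem (by exact hu)]
        rfl
      · rw [indicator_of_notMem (mt hiff.1 hu), indicator_of_notMem (by exact hu)]
    · rw [indicator_of_notMem hpA, lintegral_eq_zero_of_ae_eq_zero]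
      refine Filter.Eventually.of_forall fun u => indicator_of_notMem (fun h => hpA ?_) _
      rw [← hcomp u]
      exact h.2
  have h2 := integral_eq_lintegral_of_nonneg_ae
    (μ := ((radialLaw σ).prod (normLaw n σ)).restrict A) (f := fun p => condPairError p.1 p.2 c)
    (Filter.Eventually.of_forall fun p => condPairError_nonneg p.1 p.2 c)
    (measurable_condPairError hn c).aestronglyMeasurable
  rw [h2, ← h1]
  rfl

theorem map_components_received (hn : 2 ≤ n) (hσ : 0 < σ) :
    (received n σ).map components = (radialLaw σ).prod (normLaw n σ) := by
  have := isProbabilityMeasure_uniformDirection hn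
  refine Measure.ext_of_lintegral _ fun f hf => ?_
  rw [lintegral_map hf measurable_components, lintegral_received_polar hn hσ (fun y => f (components y))
      (hf.comp measurable_components)]
  refine lintegral_congr_ae ?_
  filter_upwards [ae_snd_pos (n := n) (σ := σ)] with p hp
  simp [components_point (by omega : 0 < n) p.1 hp.le]

theorem map_radial_received (hn : 2 ≤ n) (hσ : 0 < σ) :
    (received n σ).map radial = radialLaw σ := by
  have := isProbabilityMeasure_normLaw hn hσ
  have h : (radial : Signal n → ℝ) = Prod.fst ∘ components := rfl
  rw [h, ← Measure.map_map measurable_fst measurable_components, map_components_received hn hσ,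
    Measure.map_fst_prod]
  simp

end Gaussian

/-! ### Monotonicity, continuity and normalization of the cap area -/

section Caps

open Metric Module
open scoped ENNReal

theorem capIntegral_sub (q : ℕ) (τ τ' : ℝ) : capIntegral q τ - capIntegral q τ' =
    ∫ φ in Real.arccos τ'..Real.arccos τ, Real.sin φ ^ q :=
  intervalIntegral.integral_interval_sub_left (Continuous.intervalIntegrable (by fun_prop) _ _)
    (Continuous.intervalIntegrable (by fun_prop) _ _)

theorem antitone_capIntegral (q : ℕ) : Antitone (capIntegral q) := by
  intro τ τ' h
  have h1 := Real.arccos_le_arccos h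
  rw [← sub_nonneg, capIntegral_sub]
  refine intervalIntegral.integral_nonneg h1 fun φ hφ => pow_nonneg ?_ _
  exact Real.sin_nonneg_of_nonneg_of_le_pi ((Real.arccos_nonneg _).trans hφ.1)
    (hφ.2.trans (Real.arccos_le_pi _))

theorem capIntegral_lt (q : ℕ) {τ τ' : ℝ} (h0 : -1 ≤ τ) (h1 : τ < 1) (h : τ < τ') :
    capIntegral q τ' < capIntegral q τ := by
  have hlt : Real.arccos τ' < Real.arccos τ := by
    -- `Real.arccos` is strictly decreasing only on [-1, 1]; since τ' may exceed 1, it is replaced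
    -- by its minimum with 1, which is still above τ.
    refine (Real.arccos_le_arccos (min_le_left τ' 1)).trans_lt ?_
    exact Real.strictAntiOn_arccos ⟨h0, h1.le⟩ ⟨h0.trans (le_min h.le h1.le), min_le_right _ _⟩
      (lt_min h h1)
  rw [← sub_pos, capIntegral_sub]
  refine intervalIntegral.intervalIntegral_pos_of_pos_on
    (Continuous.intervalIntegrable (by fun_prop) _ _) (fun φ hφ => pow_pos ?_ _) hlt
  exact Real.sin_pos_of_pos_of_lt_pi ((Real.arccos_nonneg _).trans_lt hφ.1)
    (hφ.2.trans_le (Real.arccos_le_pi _))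

theorem capIntegral_eq_zero (q : ℕ) {τ : ℝ} (h : 1 ≤ τ) : capIntegral q τ = 0 := by
  simp [capIntegral, Real.arccos_of_one_le h]

theorem capIntegral_nonneg (q : ℕ) (τ : ℝ) : 0 ≤ capIntegral q τ := by
  have h := antitone_capIntegral q (le_max_left τ 1)
  rwa [capIntegral_eq_zero q (le_max_right τ 1)] at h

@[fun_prop]
theorem continuous_capIntegral (q : ℕ) : Continuous (capIntegral q) := by
  have h := intervalIntegral.continuous_primitive (μ := volume) (f := fun φ => Real.sin φ ^ q)
    (fun _ _ => Continuous.intervalIntegrable (by fun_prop) _ _) 0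
  exact h.comp Real.continuous_arccos

/-- The reflection φ ↦ π - φ exchanges the two hemispheres. -/
theorem capIntegral_neg_one (q : ℕ) : capIntegral q (-1) = 2 * capIntegral q 0 := by
  have h1 : ∫ φ in Real.pi / 2..Real.pi, Real.sin φ ^ q =
      ∫ φ in (0 : ℝ)..Real.pi / 2, Real.sin φ ^ q := by
    have h := intervalIntegral.integral_comp_sub_left (a := 0) (b := Real.pi / 2)
      (fun φ => Real.sin φ ^ q) Real.pi
    simp only [Real.sin_pi_sub, sub_zero] at h
    rw [h]
    congr 1
    ring
  rw [capIntegral, capIntegral, Real.arccos_neg_one, Real.arccos_zero,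
    ← intervalIntegral.integral_add_adjacent_intervals (b := Real.pi / 2)
      (Continuous.intervalIntegrable (by fun_prop) _ _)
      (Continuous.intervalIntegrable (by fun_prop) _ _), h1]
  ring

/-- The ratio of the area of a spherical cap to that of the unit sphere of `ℝⁿ⁻¹`. -/
def capProb (n : ℕ) (τ : ℝ) : ℝ :=
  Real.Gamma (((n : ℝ) - 1) / 2) / (Real.sqrt Real.pi * Real.Gamma (((n : ℝ) - 2) / 2)) *
    capIntegral (n - 3) τ

variable {n : ℕ}

theorem gammaRatio_eq (hn : 3 ≤ n) :
    Real.Gamma (((n : ℝ) - 1) / 2) / (Real.sqrt Real.pi * Real.Gamma (((n : ℝ) - 2) / 2)) =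
      sphereArea (n - 2) / sphereArea (n - 1) := by
  obtain ⟨k, rfl⟩ : ∃ k, n = k + 3 := ⟨n - 3, by omega⟩
  have hk : (0 : ℝ) ≤ k := by positivity
  have c1 : ((k + 3 - 2 : ℕ) : ℝ) = ((k + 3 : ℕ) : ℝ) - 2 := by
    rw [Nat.cast_sub (by omega)]
    simp
  have c2 : ((k + 3 - 1 : ℕ) : ℝ) = ((k + 3 : ℕ) : ℝ) - 1 := by
    rw [Nat.cast_sub (by omega)]
    simp
  have h1 := Real.Gamma_pos_of_pos (s := (((k + 3 : ℕ) : ℝ) - 1) / 2) (by push_cast; linarith)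
  have h2 := Real.Gamma_pos_of_pos (s := (((k + 3 : ℕ) : ℝ) - 2) / 2) (by push_cast; linarith)
  have h3 : Real.pi ^ ((((k + 3 : ℕ) : ℝ) - 1) / 2) =
      Real.pi ^ ((((k + 3 : ℕ) : ℝ) - 2) / 2) * Real.sqrt Real.pi := by
    rw [Real.sqrt_eq_rpow, ← Real.rpow_add Real.pi_pos]
    congr 1
    ring
  have h4 : (0 : ℝ) < Real.pi ^ ((((k + 3 : ℕ) : ℝ) - 2) / 2) := Real.rpow_pos_of_pos Real.pi_pos _
  have h5 := Real.sqrt_pos.2 Real.pi_pos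
  rw [sphereArea, sphereArea, c1, c2, h3]
  field_simp

theorem capProb_eq (hn : 3 ≤ n) (τ : ℝ) :
    capProb n τ = sphereArea (n - 2) * capIntegral (n - 3) τ / sphereArea (n - 1) := by
  rw [capProb, gammaRatio_eq hn]
  ring

theorem gammaRatio_pos (hn : 3 ≤ n) :
    0 < Real.Gamma (((n : ℝ) - 1) / 2) / (Real.sqrt Real.pi * Real.Gamma (((n : ℝ) - 2) / 2)) := by
  rw [gammaRatio_eq hn]
  exact div_pos (sphereArea_pos (by omega)) (sphereArea_pos (by omega))

/-- The cap at height -1 is the whole sphere. Together with the reflection symmetry this normalizes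
hemispheres to 1/2 without a Beta integral. -/
theorem sphereArea_mul_capIntegral_neg_one (hn : 3 ≤ n) :
    sphereArea (n - 2) * capIntegral (n - 3) (-1) = sphereArea (n - 1) := by
  have hd : finrank ℝ (EuclideanSpace ℝ (Fin (n - 1))) = n - 1 := by simp
  have : Nontrivial (EuclideanSpace ℝ (Fin (n - 1))) := by
    rw [← finrank_pos_iff (R := ℝ), hd]
    omega
  obtain ⟨v, hv⟩ := exists_norm_eq (EuclideanSpace ℝ (Fin (n - 1))) zero_le_one
  have h := toSphere_cap (by rw [hd]; omega) v hv (-1)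
  have huniv : {u : sphere (0 : EuclideanSpace ℝ (Fin (n - 1))) 1 |
      -1 ≤ inner ℝ (u : EuclideanSpace ℝ (Fin (n - 1))) v} = univ := by
    refine eq_univ_of_forall fun u => ?_
    have := (abs_le.1 (abs_real_inner_le_norm (u : EuclideanSpace ℝ (Fin (n - 1))) v)).1
    rw [norm_eq_of_mem_sphere, hv, one_mul] at this
    exact this
  have h0 := sphereArea_pos (p := n - 1 - 1) (by omega)
  rw [huniv, toSphere_univ, hd, ← ENNReal.ofReal_mul h0.le,
    ENNReal.ofReal_eq_ofReal_iff (sphereArea_pos (by omega)).le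
      (mul_nonneg h0.le (capIntegral_nonneg _ _)), show n - 1 - 1 = n - 2 by omega,
    show n - 1 - 2 = n - 3 by omega] at h
  exact h.symm

theorem capProb_zero (hn : 3 ≤ n) : capProb n 0 = 1 / 2 := by
  have h := sphereArea_mul_capIntegral_neg_one hn
  have h1 := sphereArea_pos (p := n - 1) (by omega)
  rw [capIntegral_neg_one] at h
  rw [capProb_eq hn, div_eq_div_iff h1.ne' two_ne_zero]
  linarith

theorem antitone_capProb (hn : 3 ≤ n) : Antitone (capProb n) := fun _ _ h =>
  mul_le_mul_of_nonneg_left (antitone_capIntegral _ h) (gammaRatio_pos hn).le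

theorem capProb_lt (hn : 3 ≤ n) {τ τ' : ℝ} (h0 : -1 ≤ τ) (h1 : τ < 1) (h : τ < τ') :
    capProb n τ' < capProb n τ :=
  mul_lt_mul_of_pos_left (capIntegral_lt _ h0 h1 h) (gammaRatio_pos hn)

theorem capProb_nonneg (hn : 3 ≤ n) (τ : ℝ) : 0 ≤ capProb n τ :=
  mul_nonneg (gammaRatio_pos hn).le (capIntegral_nonneg _ _)

theorem capProb_eq_zero {τ : ℝ} (h : 1 ≤ τ) : capProb n τ = 0 := by
  rw [capProb, capIntegral_eq_zero _ h, mul_zero]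

@[fun_prop]
theorem continuous_capProb (n : ℕ) : Continuous (capProb n) := by
  unfold capProb
  fun_prop

end Caps

/-! ### Pair-wise errors as half-spaces through the origin -/

section PairError

open Metric Module

variable {n : ℕ}

/-- A binary word as a real vector. -/
def realWord (c : Fin n → ZMod 2) : Signal n := WithLp.toLp 2 fun t => ((c t).val : ℝ)

theorem bpsk_eq (c : Fin n → ZMod 2) : bpsk c = sent n - (2 : ℝ) • realWord c := by
  ext t
  simp [bpsk, sent, realWord]

theorem sum_val_eq_hammingNorm (c : Fin n → ZMod 2) :
    ∑ t, ((c t).val : ℝ) = (hammingNorm c : ℝ) := by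
  have h : ∀ x : ZMod 2, (x.val : ℝ) = if x ≠ 0 then 1 else 0 := by
    intro x
    fin_cases x
    · change ((0 : ℕ) : ℝ) = if (0 : ZMod 2) ≠ 0 then 1 else 0
      simp
    · change ((1 : ℕ) : ℝ) = if (1 : ZMod 2) ≠ 0 then 1 else 0
      simp
  simp only [h, hammingNorm, Finset.sum_boole]

theorem inner_sent_realWord (c : Fin n → ZMod 2) :
    inner ℝ (sent n) (realWord c) = (hammingNorm c : ℝ) := by
  rw [← sum_val_eq_hammingNorm]
  simp [PiLp.inner_apply, sent, bpsk, realWord]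

theorem norm_realWord_sq (c : Fin n → ZMod 2) : ‖realWord c‖ ^ 2 = (hammingNorm c : ℝ) := by
  have h : ∀ x : ZMod 2, (x.val : ℝ) ^ 2 = x.val := by
    intro x
    fin_cases x <;> simp [ZMod.val]
  rw [← sum_val_eq_hammingNorm, EuclideanSpace.real_norm_sq_eq]
  exact Finset.sum_congr rfl fun t _ => h (c t)

/-- All signals have the same norm, and the squared distances differ by 4⟪y, c⟫. The half-space has
the origin on its boundary, which is why the conditional bounds depend on z and r only through a
ratio. -/
theorem mem_pairError_iff (c : Fin n → ZMod 2) (y : Signal n) :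
    y ∈ pairError c ↔ inner ℝ y (realWord c) ≤ 0 := by
  have h1 : y - bpsk c = (y - sent n) + (2 : ℝ) • realWord c := by
    rw [bpsk_eq]
    abel
  have h2 : ‖y - bpsk c‖ ^ 2 = ‖y - sent n‖ ^ 2 + 4 * inner ℝ y (realWord c) := by
    rw [h1, norm_add_sq_real, inner_smul_right, inner_sub_left, inner_sent_realWord, norm_smul,
      mul_pow, norm_realWord_sq]
    norm_num
    ring
  change ‖y - bpsk c‖ ≤ ‖y - sent n‖ ↔ _
  rw [← sq_le_sq₀ (norm_nonneg _) (norm_nonneg _), h2]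
  constructor <;> intro h <;> linarith

theorem inner_center_realWord (z : ℝ) (c : Fin n → ZMod 2) :
    inner ℝ (center n z) (realWord c) = (1 - z / Real.sqrt n) * hammingNorm c := by
  rw [center, inner_smul_left, inner_sent_realWord]
  rfl

/-- The threshold `√(n d / (n - d))` of the spherical caps of a word of weight `d`. -/
def threshold (n d : ℕ) : ℝ := Real.sqrt ((n : ℝ) * d / ((n : ℝ) - d))

theorem threshold_pos {d : ℕ} (hd : 0 < d) (hdn : d < n) : 0 < threshold n d := by
  have h1 : (d : ℝ) < n := by exact_mod_cast hdn
  have h2 : (0 : ℝ) < d := by exact_mod_cast hd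
  refine Real.sqrt_pos.2 (div_pos (mul_pos (h2.trans h1) h2) (sub_pos.2 h1))

/-- The conditional pair-wise error probability of a word of weight `d` on a sphere of radius `r`
about the point `a • sent n` of the axis, as a function of `t = a / r`. -/
def pairProb (n d : ℕ) (t : ℝ) : ℝ :=
  if d < n then capProb n (threshold n d * t) else if t ≤ 0 then 1 else 0

/-- The tangential part of a word. -/
def tangentWord (c : Fin n → ZMod 2) : Signal n :=
  realWord c - ((hammingNorm c : ℝ) / n) • sent n

theorem tangentWord_mem (hn : 0 < n) (c : Fin n → ZMod 2) : tangentWord c ∈ Tangent n := by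
  have : (0 : ℝ) < n := by exact_mod_cast hn
  rw [Submodule.mem_orthogonal_singleton_iff_inner_right, tangentWord, inner_sub_right,
    inner_sent_realWord, inner_smul_right, real_inner_self_eq_norm_sq, norm_sent,
    Real.sq_sqrt this.le]
  field_simp
  ring

theorem norm_tangentWord_sq (hn : 0 < n) (c : Fin n → ZMod 2) :
    ‖tangentWord c‖ ^ 2 = hammingNorm c * (n - hammingNorm c) / n := by
  have : (0 : ℝ) < n := by exact_mod_cast hn
  rw [tangentWord, norm_sub_sq_real, inner_smul_right, real_inner_comm, inner_sent_realWord,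
    norm_realWord_sq, norm_smul, mul_pow, norm_sent, Real.sq_sqrt this.le, Real.norm_eq_abs, sq_abs]
  field_simp
  ring

theorem inner_tangent_realWord (x : Tangent n) (c : Fin n → ZMod 2) :
    inner ℝ (x : Signal n) (realWord c) = inner ℝ (x : Signal n) (tangentWord c) := by
  rw [tangentWord, inner_sub_right, inner_smul_right, inner_tangent_sent]
  simp

/-- The squared norm of the tangential part is d(n - d)/n, and its product with nd/(n - d) is d².
Thus the threshold is the distance, inside the hyperplane z = 0, from the transmitted signal to the
decision boundary. -/
theorem weight_eq (hn : 0 < n) {c : Fin n → ZMod 2} (h0 : c ≠ 0) (hd : hammingNorm c < n) :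
    (hammingNorm c : ℝ) = threshold n (hammingNorm c) * ‖tangentWord c‖ := by
  have h1 : (hammingNorm c : ℝ) < n := by exact_mod_cast hd
  have h2 : (0 : ℝ) < hammingNorm c := by exact_mod_cast hammingNorm_pos_iff.2 h0
  have h3 := sub_pos.2 h1
  rw [← sq_eq_sq₀ h2.le (by unfold threshold; positivity), mul_pow, norm_tangentWord_sq hn,
    threshold, Real.sq_sqrt (div_nonneg (by positivity) h3.le)]
  field_simp

/-- In terms of the unit vector opposite to the tangential part of a word, the pair-wise error
event is a half-space of the tangent space. -/
theorem exists_unit_pairError (hn : 0 < n) {c : Fin n → ZMod 2} (h0 : c ≠ 0)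
    (hd : hammingNorm c < n) : ∃ v : Tangent n, ‖v‖ = 1 ∧ ∀ (z : ℝ) (x : Tangent n),
      center n z + (x : Signal n) ∈ pairError c ↔
        threshold n (hammingNorm c) * (1 - z / Real.sqrt n) ≤ inner ℝ x v := by
  have h2 : (0 : ℝ) < hammingNorm c := by exact_mod_cast hammingNorm_pos_iff.2 h0
  have hw := weight_eq hn h0 hd
  have hpos : 0 < ‖tangentWord c‖ := by
    have := threshold_pos (hammingNorm_pos_iff.2 h0) hd
    by_contra hc
    have h3 : ‖tangentWord c‖ = 0 := le_antisymm (not_lt.1 hc) (norm_nonneg _)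
    rw [h3, mul_zero] at hw
    exact h2.ne' hw
  refine ⟨⟨-(‖tangentWord c‖⁻¹ • tangentWord c), Submodule.neg_mem _
    (Submodule.smul_mem _ _ (tangentWord_mem hn c))⟩, ?_, fun z x => ?_⟩
  · change ‖-(‖tangentWord c‖⁻¹ • tangentWord c)‖ = 1
    rw [norm_neg, norm_smul, norm_inv, norm_norm, inv_mul_cancel₀ hpos.ne']
  · have e : inner ℝ x (⟨-(‖tangentWord c‖⁻¹ • tangentWord c), Submodule.neg_mem _
        (Submodule.smul_mem _ _ (tangentWord_mem hn c))⟩ : Tangent n) =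
        inner ℝ (x : Signal n) (-(‖tangentWord c‖⁻¹ • tangentWord c)) := rfl
    rw [mem_pairError_iff, inner_add_left, inner_center_realWord, inner_tangent_realWord, e,
      inner_neg_right, inner_smul_right, inv_mul_eq_div, ← neg_div, le_div_iff₀ hpos, mul_right_comm, ← hw]
    constructor <;> intro h <;> linarith

theorem eq_one_of_hammingNorm_eq {c : Fin n → ZMod 2} (h : hammingNorm c = n) :
    c = fun _ => 1 := by
  have h1 : Finset.univ.filter (fun i => c i ≠ 0) = Finset.univ :=
    Finset.eq_univ_of_card _ (by simpa [hammingNorm] using h)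
  ext t
  have h2 : c t ≠ 0 := by
    have h3 := Finset.mem_univ t
    rw [← h1] at h3
    exact (Finset.mem_filter.1 h3).2
  have h3 : ∀ x : ZMod 2, x ≠ 0 → x = 1 := by decide
  exact h3 _ h2

theorem hammingNorm_le (c : Fin n → ZMod 2) : hammingNorm c ≤ n := by
  simpa using hammingNorm_le_card_fintype (x := c)

/-- For weight below n, dividing the half-space condition by r leaves a cap of the unit sphere. The
all-one word has no tangential part: its boundary is the hyperplane z = √n, so each sphere lies
wholly inside or wholly outside the error region. -/
theorem condPairError_eq_pairProb (hn : 3 ≤ n) {c : Fin n → ZMod 2} (h0 : c ≠ 0) (z : ℝ) {r : ℝ}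
    (hr : 0 < r) : condPairError z r c =
      pairProb n (hammingNorm c) ((1 - z / Real.sqrt n) / r) := by
  have hn0 : 0 < n := by omega
  have hnt := nontrivial_tangent (n := n) (by omega)
  have := isProbabilityMeasure_uniformDirection (n := n) (by omega)
  have hc : ∀ u : sphere (0 : Tangent n) 1, r • ((u : Tangent n) : Signal n) =
    ((r • (u : Tangent n) : Tangent n) : Signal n) := fun u => rfl
  rcases lt_or_ge (hammingNorm c) n with hd | hd
  · obtain ⟨v, hv, hiff⟩ := exists_unit_pairError hn0 h0 hd
    have hset : {u : sphere (0 : Tangent n) 1 |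
        center n z + r • ((u : Tangent n) : Signal n) ∈ pairError c} =
        {u : sphere (0 : Tangent n) 1 | threshold n (hammingNorm c) * ((1 - z / Real.sqrt n) / r) ≤
          inner ℝ (u : Tangent n) v} := by
      ext u
      rw [mem_ofPred_eq, mem_ofPred_eq, hc, hiff, inner_smul_left, ← mul_div_assoc, div_le_iff₀ hr, conj_trivial, mul_comm r]
    have hfin := finrank_tangent hn0
    rw [pairProb, if_pos hd, condPairError, hset, measureReal_def, measureReal_def,
      toSphere_cap (by rw [hfin]; omega) v hv, toSphere_univ, hfin, ENNReal.toReal_mul,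
      ENNReal.toReal_ofReal (sphereArea_pos (by omega)).le,
      ENNReal.toReal_ofReal (capIntegral_nonneg _ _),
      ENNReal.toReal_ofReal (sphereArea_pos (by omega)).le, capProb_eq hn,
      show n - 1 - 1 = n - 2 by omega, show n - 1 - 2 = n - 3 by omega]
  · have hcn : hammingNorm c = n := le_antisymm (hammingNorm_le c) hd
    have hnR : (0 : ℝ) < n := by exact_mod_cast hn0
    have htw : tangentWord c = 0 := by
      have h := norm_tangentWord_sq hn0 c
      rw [hcn, sub_self, mul_zero, zero_div] at h
      simpa using h
    have hset : ∀ u : sphere (0 : Tangent n) 1,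
        point ((z, r), u) ∈ pairError c ↔ (1 - z / Real.sqrt n) / r ≤ 0 := by
      intro u
      rw [show (1 - z / Real.sqrt n) / r ≤ 0 ↔ 1 - z / Real.sqrt n ≤ 0 by rw [div_le_iff₀ hr, zero_mul],
        point, hc, mem_pairError_iff, inner_add_left, inner_center_realWord,
        inner_tangent_realWord, htw, inner_zero_right, add_zero, hcn]
      constructor
      · intro h
        exact nonpos_of_mul_nonpos_left h hnR
      · intro h
        exact mul_nonpos_of_nonpos_of_nonneg h hnR.le
    rw [pairProb, if_neg (not_lt.2 hd), condPairError_eq]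
    simp only [hset]
    split_ifs with h <;> simp [h]

end PairError

/-! ### The union bound as a decreasing function of one variable -/

section Union

variable {n : ℕ}

theorem antitone_pairProb (hn : 3 ≤ n) (d : ℕ) : Antitone (pairProb n d) := by
  intro t t' h
  unfold pairProb
  split_ifs with h1 h2 h3 h3
  · exact antitone_capProb hn (mul_le_mul_of_nonneg_left h (Real.sqrt_nonneg _))
  · exact le_rfl
  · exact absurd (h.trans h2) h3
  · exact zero_le_one
  · exact le_rfl

theorem pairProb_nonneg (hn : 3 ≤ n) (d : ℕ) (t : ℝ) : 0 ≤ pairProb n d t := by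
  unfold pairProb
  split_ifs
  · exact capProb_nonneg hn _
  · exact zero_le_one
  · exact le_rfl

/-- At or beyond the apex the centre of the sphere lies in the error half-space, so the cap contains
a hemisphere. -/
theorem half_le_pairProb (hn : 3 ≤ n) (d : ℕ) {t : ℝ} (ht : t ≤ 0) : 1 / 2 ≤ pairProb n d t := by
  unfold pairProb
  rw [if_pos ht]
  split_ifs
  · rw [← capProb_zero hn]
    exact antitone_capProb hn (mul_nonpos_of_nonneg_of_nonpos (Real.sqrt_nonneg _) ht)
  · norm_num

theorem one_le_threshold {d : ℕ} (hd : 0 < d) (hdn : d < n) : 1 ≤ threshold n d := by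
  have h1 : (d : ℝ) + 1 ≤ n := by exact_mod_cast hdn
  have h2 : (1 : ℝ) ≤ d := by exact_mod_cast hd
  rw [threshold, Real.one_le_sqrt, le_div_iff₀ (by linarith)]
  nlinarith

/-- All thresholds are at least 1, so a sphere of radius at most 1 - z/√n does not cross any
decision boundary. -/
theorem pairProb_eq_zero {d : ℕ} (hd : 0 < d) {t : ℝ} (ht : 1 ≤ t) : pairProb n d t = 0 := by
  unfold pairProb
  split_ifs with h1 h2
  · exact capProb_eq_zero (one_le_mul_of_one_le_of_one_le (one_le_threshold hd h1) ht)
  · linarith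
  · rfl

theorem pairProb_lt_half (hn : 3 ≤ n) {d : ℕ} (hd : 0 < d) {t : ℝ} (ht : 0 < t) :
    pairProb n d t < 1 / 2 := by
  unfold pairProb
  split_ifs with h1 h2
  · rw [← capProb_zero hn]
    exact capProb_lt hn (by norm_num) one_pos (mul_pos (threshold_pos hd h1) ht)
  · linarith
  · norm_num

/-- Positivity at t' excludes the two ways to be constant: the all-one word, and caps already of
height at least 1. -/
theorem pairProb_lt (hn : 3 ≤ n) {d : ℕ} (hd : 0 < d) {t t' : ℝ} (ht : 0 < t) (h : t < t')
    (hp : 0 < pairProb n d t') : pairProb n d t' < pairProb n d t := by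
  have hdn : d < n := by
    by_contra hc
    rw [pairProb, if_neg hc, if_neg (not_le.2 (ht.trans h))] at hp
    exact lt_irrefl _ hp
  rw [pairProb, if_pos hdn] at hp ⊢
  rw [pairProb, if_pos hdn]
  have h1 := threshold_pos hd hdn
  have h2 : threshold n d * t < threshold n d * t' := mul_lt_mul_of_pos_left h h1
  refine capProb_lt hn (by linarith [mul_pos h1 ht]) ?_ h2
  by_contra hc
  rw [capProb_eq_zero ((not_lt.1 hc).trans h2.le)] at hp
  exact lt_irrefl _ hp

/-- At d = n the function jumps from 1 to 0 at the origin, so continuity is claimed only on the open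
half-line. -/
theorem continuousOn_pairProb (d : ℕ) : ContinuousOn (pairProb n d) (Ioi 0) := by
  rcases lt_or_ge d n with h | h
  · have : pairProb n d = fun t => capProb n (threshold n d * t) := by
      ext t
      rw [pairProb, if_pos h]
    rw [this]
    fun_prop
  · refine continuousOn_const (c := (0 : ℝ)).congr fun t ht => ?_
    rw [pairProb, if_neg (not_lt.2 h), if_neg (not_le.2 ht)]

variable (C : Submodule (ZMod 2) (Fin n → ZMod 2))

/-- The conditional union bound on a sphere of radius `r` about the point `a • sent n` of the axis,
as a function of `t = a / r`. -/
def unionProb (t : ℝ) : ℝ := ∑ c ∈ nonzeroWords C, pairProb n (hammingNorm c) t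

variable {C}

theorem mem_nonzeroWords {c : Fin n → ZMod 2} : c ∈ nonzeroWords C ↔ c ∈ C ∧ c ≠ 0 := by
  simp [nonzeroWords]

theorem hammingNorm_pos_of_mem {c : Fin n → ZMod 2} (hc : c ∈ nonzeroWords C) :
    0 < hammingNorm c := hammingNorm_pos_iff.2 (mem_nonzeroWords.1 hc).2

theorem card_nonzeroWords :
    (nonzeroWords C).card = 2 ^ Module.finrank (ZMod 2) C - 1 := by
  classical
  have h1 : Nat.card C = 2 ^ Module.finrank (ZMod 2) C := by
    rw [Module.natCard_eq_pow_finrank (K := ZMod 2), Nat.card_zmod]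
  have h2 : (Finset.univ.filter (fun c => c ∈ C)).card = Nat.card C := by
    rw [Nat.card_eq_fintype_card]
    exact (Fintype.card_of_subtype _ (by simp)).symm
  have h3 : nonzeroWords C = (Finset.univ.filter (fun c => c ∈ C)).erase 0 := by
    ext c
    rw [mem_nonzeroWords]
    simp [and_comm]
  rw [h3, Finset.card_erase_of_mem (by simp), h2, h1]

theorem three_le_card_nonzeroWords (hk : 2 ≤ Module.finrank (ZMod 2) C) :
    3 ≤ (nonzeroWords C).card := by
  rw [card_nonzeroWords]
  have := Nat.pow_le_pow_right two_pos hk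
  omega

theorem sum_weightCount (F : ℕ → ℝ) :
    ∑ d ∈ Finset.Icc 1 n, (weightCount C d : ℝ) * F d =
      ∑ c ∈ nonzeroWords C, F (hammingNorm c) := by
  classical
  rw [← Finset.sum_fiberwise_of_maps_to (s := nonzeroWords C) (t := Finset.Icc 1 n)
    (g := fun c => hammingNorm c)
    (fun c hc => Finset.mem_Icc.2 ⟨hammingNorm_pos_of_mem hc, hammingNorm_le c⟩)]
  refine Finset.sum_congr rfl fun d hd => ?_
  have h1 : weightCount C d = ((nonzeroWords C).filter fun c => hammingNorm c = d).card := by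
    rw [weightCount, ← Set.ncard_coe_finset]
    congr 1
    ext c
    simp only [mem_ofPred_eq, Finset.coe_filter, mem_nonzeroWords]
    constructor
    · rintro ⟨h, rfl⟩
      exact ⟨⟨h, hammingNorm_pos_iff.1 (Finset.mem_Icc.1 hd).1⟩, rfl⟩
    · exact fun h => ⟨h.1.1, h.2⟩
  rw [h1, Finset.sum_congr rfl (g := fun _ => F d)
    (fun c hc => by rw [(Finset.mem_filter.1 hc).2]), Finset.sum_const, nsmul_eq_mul]

theorem condUnion_eq (hn : 3 ≤ n) (z : ℝ) {r : ℝ} (hr : 0 < r) :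
    condUnion C z r = unionProb C ((1 - z / Real.sqrt n) / r) :=
  Finset.sum_congr rfl fun _ hc => condPairError_eq_pairProb hn (mem_nonzeroWords.1 hc).2 z hr

theorem antitone_unionProb (hn : 3 ≤ n) : Antitone (unionProb C) := fun _ _ h =>
  Finset.sum_le_sum fun _ _ => antitone_pairProb hn _ h

theorem unionProb_nonneg (hn : 3 ≤ n) (t : ℝ) : 0 ≤ unionProb C t :=
  Finset.sum_nonneg fun _ _ => pairProb_nonneg hn _ t

theorem pairProb_le_one (hn : 3 ≤ n) (d : ℕ) (t : ℝ) : pairProb n d t ≤ 1 := by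
  unfold pairProb
  split_ifs
  · have h := sphereArea_mul_capIntegral_neg_one hn
    have h1 := sphereArea_pos (p := n - 1) (by omega)
    have h2 : capProb n (-1) = 1 := by rw [capProb_eq hn, h, div_self h1.ne']
    rw [← h2]
    -- `Real.arccos` is constant below -1, so lowering the height further does not enlarge the cap.
    have h3 : capProb n (min (-1) (threshold n d * t)) = capProb n (-1) := by
      have : Real.arccos (min (-1) (threshold n d * t)) = Real.arccos (-1) := by
        rw [Real.arccos_of_le_neg_one (min_le_left _ _), Real.arccos_neg_one]
      rw [capProb, capProb, capIntegral, capIntegral, this]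
    rw [← h3]
    exact antitone_capProb hn (min_le_right _ _)
  · exact le_rfl
  · exact zero_le_one

theorem unionProb_le_card (hn : 3 ≤ n) (t : ℝ) : unionProb C t ≤ (nonzeroWords C).card := by
  have h := Finset.sum_le_card_nsmul (nonzeroWords C) (fun c => pairProb n (hammingNorm c) t) 1
    fun c _ => pairProb_le_one hn _ t
  simpa [unionProb] using h

/-- Dimension at least two provides three nonzero words, hence a sum of at least 3/2. -/
theorem one_le_unionProb (hn : 3 ≤ n) (hk : 2 ≤ Module.finrank (ZMod 2) C) {t : ℝ} (ht : t ≤ 0) :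
    1 ≤ unionProb C t := by
  have h := Finset.card_nsmul_le_sum (nonzeroWords C) (fun c => pairProb n (hammingNorm c) t) (1 / 2)
    fun c _ => half_le_pairProb hn _ ht
  have h3 : (3 : ℝ) ≤ (nonzeroWords C).card := by exact_mod_cast three_le_card_nonzeroWords hk
  rw [nsmul_eq_mul] at h
  have : unionProb C t = ∑ c ∈ nonzeroWords C, pairProb n (hammingNorm c) t := rfl
  linarith

theorem unionProb_eq_zero {t : ℝ} (ht : 1 ≤ t) : unionProb C t = 0 :=
  Finset.sum_eq_zero fun _ hc => pairProb_eq_zero (hammingNorm_pos_of_mem hc) ht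

theorem continuousOn_unionProb : ContinuousOn (unionProb C) (Ioi 0) := by
  unfold unionProb
  exact continuousOn_finsetSum _ fun c _ => continuousOn_pairProb _

theorem unionProb_lt (hn : 3 ≤ n) {t t' : ℝ} (ht : 0 < t) (h : t < t')
    (hp : 0 < unionProb C t') : unionProb C t' < unionProb C t := by
  obtain ⟨c, hc, hcp⟩ := Finset.exists_lt_of_sum_lt (s := nonzeroWords C) (f := fun _ => (0 : ℝ))
    (g := fun c => pairProb n (hammingNorm c) t') (by simpa [unionProb] using hp)
  exact Finset.sum_lt_sum (fun c _ => antitone_pairProb hn _ h.le)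
    ⟨c, hc, pairProb_lt hn (hammingNorm_pos_of_mem hc) ht h hcp⟩

theorem hammingNorm_one : hammingNorm (fun _ : Fin n => (1 : ZMod 2)) = n := by
  simp [hammingNorm]

theorem unionProb_eq_sum_erase {t : ℝ} (ht : 0 < t) :
    unionProb C t =
      ∑ c ∈ (nonzeroWords C).erase (fun _ => 1), pairProb n (hammingNorm c) t := by
  classical
  symm
  refine Finset.sum_subset (Finset.erase_subset _ _) fun c hc hc' => ?_
  have : c = fun _ => 1 := by
    by_contra h
    exact hc' (Finset.mem_erase.2 ⟨h, hc⟩)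
  rw [this, hammingNorm_one, pairProb, if_neg (lt_irrefl _), if_neg (not_le.2 ht)]

theorem hammingNorm_lt_of_mem_erase {c : Fin n → ZMod 2}
    (hc : c ∈ (nonzeroWords C).erase (fun _ => 1)) : hammingNorm c < n :=
  lt_of_le_of_ne (hammingNorm_le c) fun h => (Finset.mem_erase.1 hc).1 (eq_one_of_hammingNorm_eq h)

/-- The all-one word contributes nothing at t > 0, and the two other nonzero words contribute less
than 1/2 each. -/
theorem unionProb_lt_one (hn : 3 ≤ n) (hC : Module.finrank (ZMod 2) C = 2 ∧ (fun _ => 1) ∈ C)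
    {t : ℝ} (ht : 0 < t) : unionProb C t < 1 := by
  classical
  have h1 : (fun _ => 1 : Fin n → ZMod 2) ∈ nonzeroWords C := by
    refine mem_nonzeroWords.2 ⟨hC.2, fun h => ?_⟩
    exact one_ne_zero (congrFun h ⟨0, by omega⟩)
  have h2 : ((nonzeroWords C).erase (fun _ => 1)).card = 2 := by
    rw [Finset.card_erase_of_mem h1, card_nonzeroWords, hC.1]
    norm_num
  rw [unionProb_eq_sum_erase ht]
  calc _ < ∑ c ∈ (nonzeroWords C).erase (fun _ => 1), (1 / 2 : ℝ) :=
        Finset.sum_lt_sum_of_nonempty (Finset.card_pos.1 (by omega)) fun c hc =>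
          pairProb_lt_half hn (hammingNorm_pos_of_mem (Finset.mem_of_mem_erase hc)) ht
    _ = 1 := by
      rw [Finset.sum_const, h2]
      norm_num

theorem three_le_card_erase (hk : 2 ≤ Module.finrank (ZMod 2) C)
    (hC : ¬ (Module.finrank (ZMod 2) C = 2 ∧ (fun _ => 1) ∈ C)) :
    3 ≤ ((nonzeroWords C).erase (fun _ => 1)).card := by
  classical
  by_cases h : (fun _ => 1 : Fin n → ZMod 2) ∈ C
  · have hk3 : 3 ≤ Module.finrank (ZMod 2) C := by
      by_contra h3
      exact hC ⟨by omega, h⟩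
    have h1 := Finset.pred_card_le_card_erase (s := nonzeroWords C) (a := fun _ => 1)
    have h2 := Nat.pow_le_pow_right two_pos hk3
    rw [card_nonzeroWords] at h1
    omega
  · rw [Finset.erase_eq_of_notMem (fun hc => h (mem_nonzeroWords.1 hc).1)]
    exact three_le_card_nonzeroWords hk

/-- Dropping the all-one word leaves at least three words, whose sum of cap probabilities is
continuous on the whole line and at least 3/2 at 0. It agrees with the union bound for t > 0. -/
theorem exists_one_lt_unionProb (hn : 3 ≤ n) (hk : 2 ≤ Module.finrank (ZMod 2) C)
    (hC : ¬ (Module.finrank (ZMod 2) C = 2 ∧ (fun _ => 1) ∈ C)) :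
    ∃ t, 0 < t ∧ t < 1 ∧ 1 < unionProb C t := by
  classical
  let S := (nonzeroWords C).erase (fun _ => 1)
  let F : ℝ → ℝ := fun t => ∑ c ∈ S, capProb n (threshold n (hammingNorm c) * t)
  have hF : Continuous F := by
    refine continuous_finsetSum _ fun c _ => ?_
    fun_prop
  have hF0 : 1 < F 0 := by
    have h3 : (3 : ℝ) ≤ S.card := by exact_mod_cast three_le_card_erase hk hC
    simp only [F, mul_zero, capProb_zero hn, Finset.sum_const, nsmul_eq_mul]
    linarith
  obtain ⟨ε, hε, hball⟩ := Metric.eventually_nhds_iff.1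
    (hF.continuousAt.eventually (lt_mem_nhds hF0))
  have h0 : 0 < min (ε / 2) (1 / 2) := by positivity
  refine ⟨min (ε / 2) (1 / 2), h0, (min_le_right _ _).trans_lt (by norm_num), ?_⟩
  have h1 : unionProb C (min (ε / 2) (1 / 2)) = F (min (ε / 2) (1 / 2)) := by
    rw [unionProb_eq_sum_erase h0]
    refine Finset.sum_congr rfl fun c hc => ?_
    rw [pairProb, if_pos (hammingNorm_lt_of_mem_erase hc)]
  rw [h1]
  refine hball ?_
  rw [Real.dist_0_eq_abs, abs_of_pos h0]
  exact (min_le_left _ _).trans_lt (by linarith)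

/-- The union bound crosses one exactly once, unless the code is exceptional. -/
theorem exists_unionProb_eq_one (hn : 3 ≤ n) (hk : 2 ≤ Module.finrank (ZMod 2) C)
    (hC : ¬ (Module.finrank (ZMod 2) C = 2 ∧ (fun _ => 1) ∈ C)) :
    ∃ t₁, 0 < t₁ ∧ unionProb C t₁ = 1 := by
  obtain ⟨t, ht0, ht1, ht⟩ := exists_one_lt_unionProb hn hk hC
  have h := intermediate_value_Icc' (f := unionProb C) ht1.le
    (continuousOn_unionProb.mono fun x hx => mem_Ioi.2 (ht0.trans_le hx.1))
  obtain ⟨t₁, h1, h2⟩ := h ⟨by rw [unionProb_eq_zero le_rfl]; exact zero_le_one, ht.le⟩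
  exact ⟨t₁, ht0.trans_le h1.1, h2⟩

/-- Strict decrease is known wherever the larger argument has a positive value, and the value 1 is
positive. -/
theorem unionProb_eq_one_iff (hn : 3 ≤ n) {t t₁ : ℝ} (ht : 0 < t) (ht₁ : 0 < t₁)
    (h1 : unionProb C t₁ = 1) : unionProb C t = 1 ↔ t = t₁ := by
  refine ⟨fun h => ?_, fun h => h ▸ h1⟩
  rcases lt_trichotomy t t₁ with hlt | heq | hlt
  · have := unionProb_lt hn ht hlt (by rw [h1]; exact one_pos)
    linarith
  · exact heq
  · have := unionProb_lt hn ht₁ hlt (by rw [h]; exact one_pos)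
    linarith

theorem capProb_threshold_eq (n d : ℕ) (r : ℝ) : capProb n (threshold n d * (1 / r)) =
    Real.Gamma (((n : ℝ) - 1) / 2) / (Real.sqrt Real.pi * Real.Gamma (((n : ℝ) - 2) / 2)) *
      ∫ φ in (0 : ℝ)..Real.arccos (Real.sqrt ((n : ℝ) * d / ((n : ℝ) - d)) / r),
        Real.sin φ ^ (n - 3) := by
  rw [mul_one_div]
  rfl

theorem le_threshold_iff {d : ℕ} (hdn : d < n) {r : ℝ} (hr : 0 < r) :
    (d : ℝ) ≤ r ^ 2 * n / (r ^ 2 + n) ↔ threshold n d ≤ r := by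
  have h1 : (d : ℝ) < n := by exact_mod_cast hdn
  have h0 : (0 : ℝ) ≤ d := Nat.cast_nonneg d
  rw [threshold, Real.sqrt_le_left hr.le, div_le_iff₀ (by linarith), le_div_iff₀ (by nlinarith)]
  constructor <;> intro h <;> nlinarith

/-- At z = 0 one has t = 1/r. The discarded weights have empty or negligible caps. The weight n must
be discarded: there the formula divides by zero, the threshold becomes 0, and a spurious hemisphere
would appear. -/
theorem fs_eq {r : ℝ} (hr : 0 < r) : fs C r = unionProb C (1 / r) := by
  rw [unionProb, ← sum_weightCount fun d => pairProb n d (1 / r), fs]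
  refine Eq.trans (Finset.sum_congr rfl fun d hd => ?_)
    (Finset.sum_subset (Finset.filter_subset _ _) fun d hd hd' => ?_)
  · have hd2 := (Finset.mem_filter.1 hd).2
    have hdn : d < n := by
      have hle := (Finset.mem_Icc.1 (Finset.mem_filter.1 hd).1).2
      have h1 := (Finset.mem_Icc.1 (Finset.mem_filter.1 hd).1).1
      refine lt_of_le_of_ne hle fun h => ?_
      have h0 : (0 : ℝ) < n := by
        have : 0 < n := by omega
        exact_mod_cast this
      rw [h, le_div_iff₀ (by positivity)] at hd2
      nlinarith
    rw [pairProb, if_pos hdn, capProb_threshold_eq]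
  · rcases lt_or_ge d n with hdn | hdn
    · have h1 : ¬ threshold n d ≤ r := fun h =>
        hd' (Finset.mem_filter.2 ⟨hd, (le_threshold_iff hdn hr).2 h⟩)
      rw [pairProb, if_pos hdn, capProb_eq_zero, mul_zero]
      rw [mul_one_div, le_div_iff₀ hr, one_mul]
      exact (not_le.1 h1).le
    · rw [pairProb, if_neg (not_lt.2 hdn), if_neg (not_le.2 (by positivity)), mul_zero]

/-- Poltyrev's ratio is the cap height at z = 0, so his angles are those of `fs`. -/
theorem sqrt_div_alpha {d : ℕ} (hdn : d < n) (r : ℝ) :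
    Real.sqrt d / alpha n r d = threshold n d * (1 / r) := by
  have h1 : (d : ℝ) < n := by exact_mod_cast hdn
  have hn0 : (0 : ℝ) < n := lt_of_le_of_lt (Nat.cast_nonneg d) h1
  have h2 : (n : ℝ) * d / (n - d) = d / (1 - d / n) := by
    have : (n : ℝ) - d ≠ 0 := by linarith
    field_simp
  rw [alpha, threshold, h2, Real.sqrt_div (Nat.cast_nonneg d), mul_one_div, div_div, mul_comm r]

theorem sqrt_lt_alpha_iff {d : ℕ} (hdn : d < n) {r : ℝ} (hr : 0 < r) :
    Real.sqrt d < alpha n r d ↔ threshold n d * (1 / r) < 1 := by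
  have h1 : (d : ℝ) < n := by exact_mod_cast hdn
  have hn0 : (0 : ℝ) < n := lt_of_le_of_lt (Nat.cast_nonneg d) h1
  have h2 : 0 < alpha n r d := by
    refine mul_pos hr (Real.sqrt_pos.2 (sub_pos.2 ?_))
    rwa [div_lt_one hn0]
  rw [← sqrt_div_alpha hdn, div_lt_one h2]

/-- Sums over the weights below Poltyrev's threshold. -/
theorem sum_filter_sqrt_lt_alpha {r : ℝ} (hr : 0 < r) (F : ℕ → ℝ)
    (hF : ∀ d, 0 < d → d < n → 1 ≤ threshold n d * (1 / r) → F d = 0) :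
    ∑ d ∈ (Finset.Icc 1 n).filter (fun d : ℕ => Real.sqrt d < alpha n r d),
        (weightCount C d : ℝ) * F d =
      ∑ c ∈ nonzeroWords C, if hammingNorm c < n then F (hammingNorm c) else 0 := by
  rw [← sum_weightCount fun d => if d < n then F d else 0]
  refine Eq.trans (Finset.sum_congr rfl fun d hd => ?_)
    (Finset.sum_subset (Finset.filter_subset _ _) fun d hd hd' => ?_)
  · have hd2 := (Finset.mem_filter.1 hd).2
    have hdn : d < n := by
      have hle := (Finset.mem_Icc.1 (Finset.mem_filter.1 hd).1).2
      have h1 := (Finset.mem_Icc.1 (Finset.mem_filter.1 hd).1).1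
      refine lt_of_le_of_ne hle fun h => ?_
      have h0 : (n : ℝ) ≠ 0 := by
        have : n ≠ 0 := by omega
        exact_mod_cast this
      -- At d = n the quantity α_d is zero, so the strict inequality √d < α_d rules out this weight.
      rw [h, alpha, div_self h0, sub_self, Real.sqrt_zero, mul_zero] at hd2
      exact absurd hd2 (not_lt.2 (Real.sqrt_nonneg _))
    rw [if_pos hdn]
  · split_ifs with hdn
    · rw [hF d (Finset.mem_Icc.1 hd).1 hdn, mul_zero]
      by_contra h
      exact hd' (Finset.mem_filter.2 ⟨hd, (sqrt_lt_alpha_iff hdn hr).2 (not_le.1 h)⟩)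
    · rw [mul_zero]

theorem fs_eq_one_iff_poltyrevOptimal (hn : 3 ≤ n) {r : ℝ} (hr : 0 < r) :
    fs C r = 1 ↔ PoltyrevOptimal C r := by
  have hG := gammaRatio_pos hn
  have h1 : ∑ d ∈ (Finset.Icc 1 n).filter (fun d : ℕ => Real.sqrt d < alpha n r d),
      (weightCount C d : ℝ) *
        ∫ φ in (0 : ℝ)..Real.arccos (Real.sqrt d / alpha n r d), Real.sin φ ^ (n - 3) =
      ∑ c ∈ nonzeroWords C, if hammingNorm c < n then
        capIntegral (n - 3) (Real.sqrt (hammingNorm c) / alpha n r (hammingNorm c)) else 0 := by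
    refine sum_filter_sqrt_lt_alpha hr
      (fun d => capIntegral (n - 3) (Real.sqrt d / alpha n r d)) fun d _ hdn h => ?_
    rw [sqrt_div_alpha hdn, capIntegral_eq_zero _ h]
  have h2 : fs C r = Real.Gamma (((n : ℝ) - 1) / 2) /
      (Real.sqrt Real.pi * Real.Gamma (((n : ℝ) - 2) / 2)) *
      ∑ c ∈ nonzeroWords C, if hammingNorm c < n then
        capIntegral (n - 3) (Real.sqrt (hammingNorm c) / alpha n r (hammingNorm c)) else 0 := by
    rw [fs_eq hr, unionProb, Finset.mul_sum]
    refine Finset.sum_congr rfl fun c _ => ?_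
    rw [pairProb]
    split_ifs with hdn h
    · rw [sqrt_div_alpha hdn, capProb]
    · exact absurd h (not_le.2 (by positivity))
    · rw [mul_zero]
  rw [PoltyrevOptimal, h1, h2, ← inv_div (Real.Gamma (((n : ℝ) - 1) / 2)),
    ← mul_eq_one_iff_eq_inv₀ hG.ne', mul_comm]

end Union

/-! ### Pointwise optimal region, sphere bounds and half-space bounds -/

section Bounds

variable {n : ℕ} {σ : ℝ}

theorem integral_radialLaw (hσ : 0 < σ) (h : ℝ → ℝ) (B : Set ℝ) :
    ∫ z in B, h z ∂radialLaw σ = ∫ z in B, h z * radialDensity σ z := by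
  rw [radialLaw_eq hσ, restrict_withDensity' , integral_withDensity_eq_integral_toReal_smul₀]
  · refine integral_congr_ae (Filter.Eventually.of_forall fun z => ?_)
    simp only [smul_eq_mul]
    rw [ENNReal.toReal_ofReal (radialDensity_nonneg σ z), mul_comm]
  · fun_prop
  · exact Filter.Eventually.of_forall fun z => ENNReal.ofReal_lt_top

theorem integral_normLaw (hn : 2 ≤ n) (hσ : 0 < σ) (h : ℝ → ℝ) :
    ∫ r, h r ∂normLaw n σ = ∫ r in Ioi 0, h r * normDensity n σ r := by
  rw [normLaw, integral_withDensity_eq_integral_toReal_smul₀]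
  · refine setIntegral_congr_fun measurableSet_Ioi fun r hr => ?_
    simp only [smul_eq_mul]
    rw [ENNReal.toReal_ofReal (normDensity_nonneg hn hσ (mem_Ioi.1 hr).le), mul_comm]
  · fun_prop
  · exact Filter.Eventually.of_forall fun z => ENNReal.ofReal_lt_top

theorem integrable_normLaw_iff (hn : 2 ≤ n) (hσ : 0 < σ) (h : ℝ → ℝ) :
    Integrable h (normLaw n σ) ↔ IntegrableOn (fun r => h r * normDensity n σ r) (Ioi 0) := by
  rw [normLaw, integrable_withDensity_iff_integrable_smul₀' (by fun_prop)
    (Filter.Eventually.of_forall fun z => ENNReal.ofReal_lt_top)]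
  refine integrableOn_congr_fun (fun r hr => ?_) measurableSet_Ioi
  simp only [smul_eq_mul]
  rw [ENNReal.toReal_ofReal (normDensity_nonneg hn hσ (mem_Ioi.1 hr).le), mul_comm]

theorem integrable_radialLaw_iff (hσ : 0 < σ) (h : ℝ → ℝ) :
    Integrable h (radialLaw σ) ↔ Integrable (fun z => h z * radialDensity σ z) := by
  rw [radialLaw_eq hσ, integrable_withDensity_iff_integrable_smul₀' (by fun_prop)
    (Filter.Eventually.of_forall fun z => ENNReal.ofReal_lt_top)]
  refine integrable_congr (Filter.Eventually.of_forall fun z => ?_)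
  simp only [smul_eq_mul]
  rw [ENNReal.toReal_ofReal (radialDensity_nonneg σ z), mul_comm]

variable (C : Submodule (ZMod 2) (Fin n → ZMod 2))

/-- The conditional union bound as a function of the radial and tangential components. -/
def jointUnion (p : ℝ × ℝ) : ℝ := unionProb C ((1 - p.1 / Real.sqrt n) / p.2)

/-- The conditional first Gallager bound for the region `A`. -/
def jointBound (A : Set (ℝ × ℝ)) (p : ℝ × ℝ) : ℝ :=
  open Classical in if p ∈ A then jointUnion C p else 1

variable {C}

theorem measurable_jointUnion (hn : 3 ≤ n) : Measurable (jointUnion C) :=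
  (antitone_unionProb hn).measurable.comp (by fun_prop)

theorem measurable_jointBound (hn : 3 ≤ n) {A : Set (ℝ × ℝ)} (hA : MeasurableSet A) :
    Measurable (jointBound C A) := by
  classical
  exact Measurable.ite hA (measurable_jointUnion hn) measurable_const

theorem norm_jointUnion_le (hn : 3 ≤ n) (p : ℝ × ℝ) :
    ‖jointUnion C p‖ ≤ (nonzeroWords C).card := by
  rw [jointUnion, Real.norm_of_nonneg (unionProb_nonneg hn _)]
  exact unionProb_le_card hn _

theorem norm_jointBound_le (hn : 3 ≤ n) (A : Set (ℝ × ℝ)) (p : ℝ × ℝ) :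
    ‖jointBound C A p‖ ≤ (nonzeroWords C).card + 1 := by
  unfold jointBound
  split_ifs
  · linarith [norm_jointUnion_le (C := C) hn p]
  · rw [norm_one]
    linarith [Nat.cast_nonneg (α := ℝ) (nonzeroWords C).card]

theorem integrable_jointBound (hn : 3 ≤ n) {A : Set (ℝ × ℝ)} (hA : MeasurableSet A)
    (μ : Measure (ℝ × ℝ)) [IsFiniteMeasure μ] : Integrable (jointBound C A) μ :=
  Integrable.of_bound (measurable_jointBound hn hA).aestronglyMeasurable _
    (Filter.Eventually.of_forall (norm_jointBound_le hn A))

theorem integrable_jointBound_section (hn : 3 ≤ n) {A : Set (ℝ × ℝ)} (hA : MeasurableSet A) (z : ℝ)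
    (μ : Measure ℝ) [IsFiniteMeasure μ] : Integrable (fun r => jointBound C A (z, r)) μ :=
  Integrable.of_bound ((measurable_jointBound hn hA).comp measurable_prodMk_left).aestronglyMeasurable
    _ (Filter.Eventually.of_forall fun r => norm_jointBound_le hn A (z, r))

/-- The points where the conditional union bound is at most one. -/
def optimalSet (C : Submodule (ZMod 2) (Fin n → ZMod 2)) : Set (ℝ × ℝ) := {p | jointUnion C p ≤ 1}

theorem measurableSet_optimalSet (hn : 3 ≤ n) : MeasurableSet (optimalSet C) :=
  measurableSet_le (measurable_jointUnion hn) measurable_const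

theorem jointBound_optimalSet (p : ℝ × ℝ) :
    jointBound C (optimalSet C) p = min (jointUnion C p) 1 := by
  unfold jointBound optimalSet
  split_ifs with h
  · exact (min_eq_left h).symm
  · exact (min_eq_right (not_le.1 h).le).symm

/-- Every region pays either U or 1 at each point, and the minimum of the two is a lower bound. This
one inequality yields the optimality among spheres, cones and all regions in the two components. -/
theorem jointBound_optimalSet_le (A : Set (ℝ × ℝ)) (p : ℝ × ℝ) :
    jointBound C (optimalSet C) p ≤ jointBound C A p := by
  rw [jointBound_optimalSet, jointBound]
  split_ifs
  · exact min_le_left _ _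
  · exact min_le_right _ _

theorem jointBound_optimalSet_nonneg (hn : 3 ≤ n) (p : ℝ × ℝ) :
    0 ≤ jointBound C (optimalSet C) p := by
  rw [jointBound_optimalSet]
  exact le_min (unionProb_nonneg hn _) zero_le_one

theorem jointBound_optimalSet_le_one (p : ℝ × ℝ) : jointBound C (optimalSet C) p ≤ 1 := by
  rw [jointBound_optimalSet]
  exact min_le_right _ _

theorem regionBound_eq (hn : 3 ≤ n) (hσ : 0 < σ) {A : Set (ℝ × ℝ)} (hA : MeasurableSet A) :
    regionBound C σ (components ⁻¹' A) =
      ∫ p, jointBound C A p ∂(radialLaw σ).prod (normLaw n σ) := by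
  classical
  have := isProbabilityMeasure_normLaw (n := n) (by omega) hσ
  have h1 : ∑ c ∈ nonzeroWords C, (received n σ).real (pairError c ∩ components ⁻¹' A) =
      ∫ p in A, jointUnion C p ∂(radialLaw σ).prod (normLaw n σ) := by
    rw [Finset.sum_congr rfl fun c _ => received_pairError_inter (by omega) hσ c hA,
      ← integral_finsetSum]
    · refine integral_congr_ae (ae_restrict_of_ae ?_)
      filter_upwards [ae_snd_pos (n := n) (σ := σ)] with p hp
      exact condUnion_eq hn p.1 hp
    · intro c _
      refine Integrable.of_bound (measurable_condPairError (by omega) c).aestronglyMeasurable 1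
        (Filter.Eventually.of_forall fun p => ?_)
      rw [Real.norm_of_nonneg (condPairError_nonneg _ _ _)]
      exact condPairError_le_one (by omega) _ _ _
  have h2 : (received n σ).real (components ⁻¹' A)ᶜ =
      ∫ p in Aᶜ, 1 ∂(radialLaw σ).prod (normLaw n σ) := by
    rw [← preimage_compl, ← map_measureReal_apply measurable_components hA.compl,
      map_components_received (by omega) hσ]
    simp
  rw [regionBound, h1, h2, ← integral_add_compl hA (integrable_jointBound hn hA _)]
  congr 1
  · exact setIntegral_congr_fun hA fun p hp => (if_pos hp).symm
  · exact setIntegral_congr_fun hA.compl fun p hp => (if_neg hp).symm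

theorem integrable_normDensity (hn : 2 ≤ n) (hσ : 0 < σ) :
    IntegrableOn (normDensity n σ) (Ioi 0) := by
  have := isProbabilityMeasure_normLaw hn hσ
  simpa using (integrable_normLaw_iff hn hσ (fun _ => 1)).1 (integrable_const 1)

/-- The sphere bound as an integral with respect to the law of the tangential noise length. -/
theorem condSphereBound_eq (hn : 3 ≤ n) (hσ : 0 < σ) {A : Set (ℝ × ℝ)} (hA : MeasurableSet A)
    (z : ℝ) {ρ : ℝ} (hρ : 0 ≤ ρ) (hz : ∀ r, 0 < r → ((z, r) ∈ A ↔ r ≤ ρ)) :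
    condSphereBound C σ z ρ = ∫ r, jointBound C A (z, r) ∂normLaw n σ := by
  have := isProbabilityMeasure_normLaw (n := n) (by omega) hσ
  have hint := (integrable_normLaw_iff (n := n) (by omega) hσ _).1
    (integrable_jointBound_section (C := C) hn hA z (normLaw n σ))
  rw [integral_normLaw (by omega) hσ, ← Ioc_union_Ioi_eq_Ioi hρ, setIntegral_union
    (Ioc_disjoint_Ioi le_rfl) measurableSet_Ioi (hint.mono_set Ioc_subset_Ioi_self)
    (hint.mono_set (Ioi_subset_Ioi hρ)), condSphereBound, intervalIntegral.integral_of_le hρ]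
  congr 1
  · refine setIntegral_congr_fun measurableSet_Ioc fun r hr => ?_
    simp only [jointBound, if_pos ((hz r hr.1).2 hr.2), condUnion_eq hn z hr.1]
    rfl
  · refine setIntegral_congr_fun measurableSet_Ioi fun r hr => ?_
    have hr' : ρ < r := hr
    simp only [jointBound, if_neg (mt (hz r (hρ.trans_lt hr')).1 (not_le.2 hr')), one_mul]

theorem measurableSet_snd_le (ρ : ℝ) : MeasurableSet {p : ℝ × ℝ | p.2 ≤ ρ} :=
  measurableSet_le measurable_snd measurable_const

theorem le_condSphereBound (hn : 3 ≤ n) (hσ : 0 < σ) (z : ℝ) {ρ : ℝ} (hρ : 0 ≤ ρ) :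
    ∫ r, jointBound C (optimalSet C) (z, r) ∂normLaw n σ ≤ condSphereBound C σ z ρ := by
  have := isProbabilityMeasure_normLaw (n := n) (by omega) hσ
  rw [condSphereBound_eq hn hσ (measurableSet_snd_le ρ) z hρ fun r _ => Iff.rfl]
  exact integral_mono (integrable_jointBound_section hn (measurableSet_optimalSet hn) z _)
    (integrable_jointBound_section hn (measurableSet_snd_le ρ) z _)
    fun r => jointBound_optimalSet_le _ _

theorem bddBelow_condSphereBound (hn : 3 ≤ n) (hσ : 0 < σ) (z : ℝ) :
    BddBelow (range fun ρ : Ici (0 : ℝ) => condSphereBound C σ z ρ) :=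
  ⟨_, by
    rintro _ ⟨ρ, rfl⟩
    exact le_condSphereBound hn hσ z ρ.2⟩

theorem le_fu (hn : 3 ≤ n) (hσ : 0 < σ) (z : ℝ) :
    ∫ r, jointBound C (optimalSet C) (z, r) ∂normLaw n σ ≤ fu C σ z :=
  le_ciInf fun ρ => le_condSphereBound hn hσ z ρ.2

theorem fu_le (hn : 3 ≤ n) (hσ : 0 < σ) (z : ℝ) {ρ : ℝ} (hρ : 0 ≤ ρ) :
    fu C σ z ≤ condSphereBound C σ z ρ :=
  ciInf_le (bddBelow_condSphereBound hn hσ z) (⟨ρ, hρ⟩ : Ici (0 : ℝ))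

theorem integral_jointBound_congr {A : Set (ℝ × ℝ)} {z : ℝ}
    (h : ∀ r, 0 < r → jointBound C A (z, r) = jointBound C (optimalSet C) (z, r)) :
    ∫ r, jointBound C A (z, r) ∂normLaw n σ =
      ∫ r, jointBound C (optimalSet C) (z, r) ∂normLaw n σ := by
  refine integral_congr_ae ?_
  filter_upwards [normLaw_ae_pos (n := n) (σ := σ)] with r hr
  exact h r hr

/-- If U changes from at most 1 to at least 1 at radius ρ, that sphere realizes the pointwise
minimum, so the universal lower bound is attained. -/
theorem fu_eq_of_forall (hn : 3 ≤ n) (hσ : 0 < σ) {z ρ : ℝ} (hρ : 0 ≤ ρ)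
    (h1 : ∀ r, 0 < r → r ≤ ρ → jointUnion C (z, r) ≤ 1)
    (h2 : ∀ r, ρ < r → 1 ≤ jointUnion C (z, r)) :
    fu C σ z = ∫ r, jointBound C (optimalSet C) (z, r) ∂normLaw n σ ∧
      fu C σ z = condSphereBound C σ z ρ := by
  have h : condSphereBound C σ z ρ =
      ∫ r, jointBound C (optimalSet C) (z, r) ∂normLaw n σ := by
    rw [condSphereBound_eq hn hσ (measurableSet_snd_le ρ) z hρ fun r _ => Iff.rfl]
    refine integral_jointBound_congr fun r hr => ?_
    rw [jointBound_optimalSet, jointBound]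
    split_ifs with hle
    · exact (min_eq_left (h1 r hr hle)).symm
    · exact (min_eq_right (h2 r (not_le.1 hle))).symm
  have h3 := le_fu (C := C) hn hσ z
  have h4 := fu_le (C := C) hn hσ z hρ
  constructor <;> linarith

theorem one_sub_div_sqrt_pos {z : ℝ} (hn : 0 < n) : 0 < 1 - z / Real.sqrt n ↔ z < Real.sqrt n := by
  have : (0 : ℝ) < n := by exact_mod_cast hn
  rw [sub_pos, div_lt_one (Real.sqrt_pos.2 this)]

theorem one_le_jointUnion (hn : 3 ≤ n) (hk : 2 ≤ Module.finrank (ZMod 2) C) {z r : ℝ}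
    (hz : Real.sqrt n ≤ z) (hr : 0 < r) : 1 ≤ jointUnion C (z, r) := by
  refine one_le_unionProb hn hk (div_nonpos_of_nonpos_of_nonneg ?_ hr.le)
  exact not_lt.1 fun h => absurd ((one_sub_div_sqrt_pos (by omega)).1 h) (not_lt.2 hz)

/-- The crossing radius is 0 for z ≥ √n and (1 - z/√n)/t₁ for a regular code below √n. For an
exceptional code U stays below 1 at every radius, and the infimum is reached as a limit of growing
spheres. -/
theorem fu_eq (hn : 3 ≤ n) (hσ : 0 < σ) (hk : 2 ≤ Module.finrank (ZMod 2) C) (z : ℝ) :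
    fu C σ z = ∫ r, jointBound C (optimalSet C) (z, r) ∂normLaw n σ := by
  have := isProbabilityMeasure_normLaw (n := n) (by omega) hσ
  rcases le_or_gt (Real.sqrt n) z with hz | hz
  · exact (fu_eq_of_forall hn hσ le_rfl (fun r h0 h1 => absurd h0 (not_lt.2 h1))
      fun r hr => one_le_jointUnion hn hk hz hr).1
  have ha : 0 < 1 - z / Real.sqrt n := (one_sub_div_sqrt_pos (by omega)).2 hz
  by_cases hC : Module.finrank (ZMod 2) C = 2 ∧ (fun _ => 1) ∈ C
  · refine le_antisymm ?_ (le_fu hn hσ z)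
    have hlim : Filter.Tendsto (fun k : ℕ => ∫ r, jointBound C {p | p.2 ≤ k} (z, r) ∂normLaw n σ)
        Filter.atTop (nhds (∫ r, jointBound C (optimalSet C) (z, r) ∂normLaw n σ)) := by
      refine tendsto_integral_of_dominated_convergence (fun _ => (nonzeroWords C).card + 1)
        (fun k => ((measurable_jointBound hn (measurableSet_snd_le k)).comp
          measurable_prodMk_left).aestronglyMeasurable) (integrable_const _)
        (fun k => Filter.Eventually.of_forall fun r => norm_jointBound_le hn _ _) ?_
      filter_upwards [normLaw_ae_pos (n := n) (σ := σ)] with r hr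
      refine tendsto_const_nhds.congr' ?_
      filter_upwards [Filter.eventually_ge_atTop ⌈r⌉₊] with k hk
      have h1 : jointUnion C (z, r) ≤ 1 := (unionProb_lt_one hn hC (div_pos ha hr)).le
      have h2 : r ≤ k := Nat.ceil_le.1 hk
      simp [jointBound, optimalSet, h1, h2]
    refine ge_of_tendsto' hlim fun k => ?_
    rw [← condSphereBound_eq hn hσ (measurableSet_snd_le k) z (Nat.cast_nonneg k) fun r _ => Iff.rfl]
    exact fu_le hn hσ z (Nat.cast_nonneg k)
  · obtain ⟨t₁, ht₁, h1⟩ := exists_unionProb_eq_one hn hk hC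
    refine (fu_eq_of_forall hn hσ (div_pos ha ht₁).le (fun r h0 hr => ?_) fun r hr => ?_).1
    · rw [← h1]
      exact antitone_unionProb hn ((le_div_comm₀ h0 ht₁).1 hr)
    · rw [← h1]
      exact antitone_unionProb hn ((div_lt_comm₀ ht₁ ((div_pos ha ht₁).trans hr)).1 hr).le

theorem fu_eq_one (hn : 3 ≤ n) (hσ : 0 < σ) (hk : 2 ≤ Module.finrank (ZMod 2) C) {z : ℝ}
    (hz : Real.sqrt n ≤ z) : fu C σ z = 1 ∧ condSphereBound C σ z 0 = fu C σ z := by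
  have := isProbabilityMeasure_normLaw (n := n) (by omega) hσ
  have h := fu_eq_of_forall (C := C) hn hσ le_rfl (fun r h0 h1 => absurd h0 (not_lt.2 h1))
    (fun r hr => one_le_jointUnion hn hk hz hr)
  refine ⟨?_, h.2.symm⟩
  have h1 : condSphereBound C σ z 0 = 1 := by
    rw [condSphereBound_eq hn hσ MeasurableSet.empty z le_rfl (by simp)]
    simp [jointBound]
  rw [h.2, h1]

theorem fu_le_one (hn : 3 ≤ n) (hσ : 0 < σ) (hk : 2 ≤ Module.finrank (ZMod 2) C) (z : ℝ) :
    fu C σ z ≤ 1 := by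
  have := isProbabilityMeasure_normLaw (n := n) (by omega) hσ
  rw [fu_eq hn hσ hk]
  have h := integral_mono (integrable_jointBound_section (C := C) hn (measurableSet_optimalSet hn) z
    (normLaw n σ)) (integrable_const 1) fun r => jointBound_optimalSet_le_one _
  simpa using h

theorem fu_nonneg (hn : 3 ≤ n) (hσ : 0 < σ) (hk : 2 ≤ Module.finrank (ZMod 2) C) (z : ℝ) :
    0 ≤ fu C σ z := by
  rw [fu_eq hn hσ hk]
  exact integral_nonneg fun r => jointBound_optimalSet_nonneg hn _

theorem fu_lt_one (hn : 3 ≤ n) (hσ : 0 < σ) (hk : 2 ≤ Module.finrank (ZMod 2) C) {z : ℝ}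
    (hz : z < Real.sqrt n) : fu C σ z < 1 := by
  have := isProbabilityMeasure_normLaw (n := n) (by omega) hσ
  have ha : 0 < 1 - z / Real.sqrt n := (one_sub_div_sqrt_pos (by omega)).2 hz
  have hint := integrable_jointBound_section (C := C) hn (measurableSet_optimalSet (C := C) hn) z
    (normLaw n σ)
  have hint2 : Integrable (fun r => 1 - jointBound C (optimalSet C) (z, r)) (normLaw n σ) :=
    (integrable_const 1).sub hint
  have h : 0 < ∫ r, (1 - jointBound C (optimalSet C) (z, r)) ∂normLaw n σ := by
    have hi := (integrable_normLaw_iff (n := n) (by omega) hσ _).1 hint2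
    rw [integral_normLaw (by omega) hσ]
    have hnn : ∀ r ∈ Ioi (0 : ℝ),
        0 ≤ (1 - jointBound C (optimalSet C) (z, r)) * normDensity n σ r := fun r hr =>
      mul_nonneg (sub_nonneg.2 (jointBound_optimalSet_le_one _))
        (normDensity_nonneg (by omega) hσ (mem_Ioi.1 hr).le)
    rw [setIntegral_pos_iff_support_of_nonneg_ae
      ((ae_restrict_iff' measurableSet_Ioi).2 (Filter.Eventually.of_forall hnn)) hi]
    -- On these radii t ≥ 1 and U = 0, so the integrand 1 - min(U, 1) is 1 there.
    refine lt_of_lt_of_le ?_ (measure_mono (s := Ioc 0 (1 - z / Real.sqrt n)) fun r hr => ?_)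
    · simpa using ha
    · refine ⟨?_, hr.1⟩
      have h0 : jointUnion C (z, r) = 0 := unionProb_eq_zero ((one_le_div hr.1).2 hr.2)
      rw [Function.mem_support, jointBound_optimalSet, h0, min_eq_left zero_le_one, sub_zero, one_mul]
      exact (normDensity_pos (by omega) hσ hr.1).ne'
  rw [integral_sub (integrable_const 1) hint, ← fu_eq hn hσ hk] at h
  simpa using h

theorem measurable_fu (hn : 3 ≤ n) (hσ : 0 < σ) (hk : 2 ≤ Module.finrank (ZMod 2) C) :
    Measurable (fu C σ) := by
  have := isProbabilityMeasure_normLaw (n := n) (by omega) hσ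
  have h : fu C σ = fun z => ∫ r, jointBound C (optimalSet C) (z, r) ∂normLaw n σ :=
    funext (fu_eq hn hσ hk)
  rw [h]
  exact (measurable_jointBound hn
    (measurableSet_optimalSet hn)).stronglyMeasurable.integral_prod_right'.measurable

theorem integrable_fu (hn : 3 ≤ n) (hσ : 0 < σ) (hk : 2 ≤ Module.finrank (ZMod 2) C) :
    Integrable (fu C σ) (radialLaw σ) := by
  refine Integrable.of_bound (measurable_fu hn hσ hk).aestronglyMeasurable 1
    (Filter.Eventually.of_forall fun z => ?_)
  rw [Real.norm_of_nonneg (fu_nonneg hn hσ hk z)]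
  exact fu_le_one hn hσ hk z

theorem setIntegral_fu (hn : 3 ≤ n) (hσ : 0 < σ) (hk : 2 ≤ Module.finrank (ZMod 2) C) {B : Set ℝ}
    (hB : MeasurableSet B) : ∫ z in B, fu C σ z ∂radialLaw σ =
      ∫ p in Prod.fst ⁻¹' B, jointBound C (optimalSet C) p ∂(radialLaw σ).prod (normLaw n σ) := by
  have := isProbabilityMeasure_normLaw (n := n) (by omega) hσ
  have h := setIntegral_prod (μ := radialLaw σ) (ν := normLaw n σ) (s := B) (t := univ)
    (jointBound C (optimalSet C)) (integrable_jointBound hn (measurableSet_optimalSet hn) _).integrableOn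
  rw [← prod_univ, h]
  refine setIntegral_congr_fun hB fun z _ => ?_
  simp only [Measure.restrict_univ]
  exact fu_eq hn hσ hk z

/-- The bound in which all half-spaces are used up to `z`. -/
theorem halfSpaceBound_eq (hn : 3 ≤ n) (hσ : 0 < σ) (hk : 2 ≤ Module.finrank (ZMod 2) C) (z : ℝ) :
    halfSpaceBound C σ z = (∫ x, fu C σ x ∂radialLaw σ) + ∫ x in Ioi z, (1 - fu C σ x) ∂radialLaw σ := by
  have h1 := integral_radialLaw hσ (fu C σ) (Iic z)
  have h2 := integral_radialLaw hσ (fun _ => 1) (Ioi z)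
  simp only [one_mul] at h2
  have hi := integrable_fu hn hσ hk (C := C)
  rw [halfSpaceBound, ← h1, ← h2, ← integral_add_compl measurableSet_Iic hi, compl_Iic,
    integral_sub (integrable_const 1).integrableOn hi.integrableOn]
  ring

theorem halfSpaceBound_sqrt (hn : 3 ≤ n) (hσ : 0 < σ) (hk : 2 ≤ Module.finrank (ZMod 2) C) {z : ℝ}
    (hz : Real.sqrt n ≤ z) : halfSpaceBound C σ z = ∫ x, fu C σ x ∂radialLaw σ := by
  rw [halfSpaceBound_eq hn hσ hk, setIntegral_eq_zero_of_forall_eq_zero, add_zero]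
  intro x hx
  rw [(fu_eq_one hn hσ hk (hz.trans (mem_Ioi.1 hx).le)).1, sub_self]

/-- The excess is the integral of (1 - f_u) g over (z, ∞), whose integrand is positive on (z, √n).
-/
theorem halfSpaceBound_lt (hn : 3 ≤ n) (hσ : 0 < σ) (hk : 2 ≤ Module.finrank (ZMod 2) C) {z : ℝ}
    (hz : z < Real.sqrt n) : halfSpaceBound C σ (Real.sqrt n) < halfSpaceBound C σ z := by
  rw [halfSpaceBound_sqrt hn hσ hk le_rfl, halfSpaceBound_eq hn hσ hk, lt_add_iff_pos_right]
  have hi : Integrable (fun x => 1 - fu C σ x) (radialLaw σ) :=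
    (integrable_const 1).sub (integrable_fu hn hσ hk)
  rw [integral_radialLaw hσ, setIntegral_pos_iff_support_of_nonneg_ae
    (Filter.Eventually.of_forall fun x => mul_nonneg (sub_nonneg.2 (fu_le_one hn hσ hk x))
      (radialDensity_nonneg σ x)) ((integrable_radialLaw_iff hσ _).1 hi).integrableOn]
  refine lt_of_lt_of_le ?_ (measure_mono (s := Ioo z (Real.sqrt n)) fun x hx => ?_)
  · simpa using hz
  · refine ⟨?_, hx.1⟩
    exact (mul_pos (sub_pos.2 (fu_lt_one hn hσ hk hx.2)) (radialDensity_pos hσ x)).ne'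

theorem halfSpaceBound_sqrt_eq_integral (hn : 3 ≤ n) (hσ : 0 < σ)
    (hk : 2 ≤ Module.finrank (ZMod 2) C) : halfSpaceBound C σ (Real.sqrt n) =
      ∫ p, jointBound C (optimalSet C) p ∂(radialLaw σ).prod (normLaw n σ) := by
  have h := setIntegral_fu (C := C) hn hσ hk MeasurableSet.univ
  simpa [halfSpaceBound_sqrt hn hσ hk le_rfl] using h

theorem halfSpaceBound_le_regionBound (hn : 3 ≤ n) (hσ : 0 < σ)
    (hk : 2 ≤ Module.finrank (ZMod 2) C) {A : Set (ℝ × ℝ)} (hA : MeasurableSet A) :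
    halfSpaceBound C σ (Real.sqrt n) ≤ regionBound C σ (components ⁻¹' A) := by
  have := isProbabilityMeasure_normLaw (n := n) (by omega) hσ
  rw [halfSpaceBound_sqrt_eq_integral hn hσ hk, regionBound_eq hn hσ hA]
  exact integral_mono (integrable_jointBound hn (measurableSet_optimalSet hn) _)
    (integrable_jointBound hn hA _) fun p => jointBound_optimalSet_le A p

theorem received_radial (hn : 2 ≤ n) (hσ : 0 < σ) {B : Set ℝ} (hB : MeasurableSet B) :
    (received n σ).real (radial ⁻¹' B) = (radialLaw σ).real B := by
  rw [← map_radial_received hn hσ, map_measureReal_apply (by fun_prop) hB]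

/-- Over B, the union bound is used where U ≤ 1 and the trivial bound elsewhere; the two integrals
add up to that of min(U, 1). -/
theorem errorEvent_le (hn : 3 ≤ n) (hσ : 0 < σ) (hk : 2 ≤ Module.finrank (ZMod 2) C) {B : Set ℝ}
    (hB : MeasurableSet B) : (received n σ).real (errorEvent C ∩ radial ⁻¹' B) ≤
      ∫ z in B, fu C σ z ∂radialLaw σ := by
  classical
  have := isProbabilityMeasure_normLaw (n := n) (by omega) hσ
  let A : Set (ℝ × ℝ) := Prod.fst ⁻¹' B ∩ optimalSet C
  let A' : Set (ℝ × ℝ) := Prod.fst ⁻¹' B \ optimalSet C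
  have hB' : MeasurableSet (Prod.fst ⁻¹' B : Set (ℝ × ℝ)) := measurable_fst hB
  have hO := measurableSet_optimalSet (C := C) hn
  have hA : MeasurableSet A := hB'.inter hO
  have hA' : MeasurableSet A' := hB'.diff hO
  have hsub : errorEvent C ∩ radial ⁻¹' B ⊆
      (⋃ c ∈ nonzeroWords C, pairError c ∩ components ⁻¹' A) ∪ components ⁻¹' A' := by
    rintro y ⟨⟨c, hc, hc0, hy⟩, hyB⟩
    by_cases hyO : components y ∈ optimalSet C
    · exact Or.inl (mem_biUnion (mem_nonzeroWords.2 ⟨hc, hc0⟩) ⟨hy, hyB, hyO⟩)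
    · exact Or.inr ⟨hyB, hyO⟩
  have h1 : ∑ c ∈ nonzeroWords C, (received n σ).real (pairError c ∩ components ⁻¹' A) =
      ∫ p in A, jointBound C (optimalSet C) p ∂(radialLaw σ).prod (normLaw n σ) := by
    -- The union-bound term alone is extracted by cancelling the mass of the complement of `A` on
    -- both sides.
    have e := regionBound_eq (C := C) hn hσ hA
    have e2 : (received n σ).real (components ⁻¹' A)ᶜ =
        ∫ p in Aᶜ, 1 ∂(radialLaw σ).prod (normLaw n σ) := by
      rw [← preimage_compl, ← map_measureReal_apply measurable_components hA.compl,
        map_components_received (by omega) hσ]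
      simp
    rw [regionBound, e2, ← integral_add_compl hA (integrable_jointBound hn hA _)] at e
    have e3 : ∫ p in Aᶜ, jointBound C A p ∂(radialLaw σ).prod (normLaw n σ) =
        ∫ p in Aᶜ, 1 ∂(radialLaw σ).prod (normLaw n σ) :=
      setIntegral_congr_fun hA.compl fun p hp => if_neg hp
    rw [e3, add_left_inj] at e
    rw [e]
    refine setIntegral_congr_fun hA fun p hp => ?_
    simp only [jointBound, if_pos hp, if_pos hp.2]
  have h2 : (received n σ).real (components ⁻¹' A') =
      ∫ p in A', jointBound C (optimalSet C) p ∂(radialLaw σ).prod (normLaw n σ) := by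
    have e : ∫ p in A', jointBound C (optimalSet C) p ∂(radialLaw σ).prod (normLaw n σ) =
        ∫ p in A', 1 ∂(radialLaw σ).prod (normLaw n σ) :=
      setIntegral_congr_fun hA' fun p hp => if_neg hp.2
    rw [← map_measureReal_apply measurable_components hA', map_components_received (by omega) hσ, e]
    simp
  have hi := integrable_jointBound (C := C) hn hO ((radialLaw σ).prod (normLaw n σ))
  calc _ ≤ (received n σ).real
        ((⋃ c ∈ nonzeroWords C, pairError c ∩ components ⁻¹' A) ∪ components ⁻¹' A') :=
        measureReal_mono hsub
    _ ≤ (received n σ).real (⋃ c ∈ nonzeroWords C, pairError c ∩ components ⁻¹' A) +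
        (received n σ).real (components ⁻¹' A') := measureReal_union_le _ _
    _ ≤ (∑ c ∈ nonzeroWords C, (received n σ).real (pairError c ∩ components ⁻¹' A)) +
        (received n σ).real (components ⁻¹' A') := by
        gcongr
        exact measureReal_biUnion_finset_le _ _
    _ = ∫ p in Prod.fst ⁻¹' B, jointBound C (optimalSet C) p ∂(radialLaw σ).prod (normLaw n σ) := by
        rw [h1, h2]
        exact integral_inter_add_sdiff hO hi.integrableOn
    _ = _ := (setIntegral_fu hn hσ hk hB).symm

end Bounds

/-! ### Poltyrev's bracket as a conditional sphere bound -/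

section Poltyrev

open Metric Module
open scoped ENNReal

variable {n : ℕ} {σ : ℝ}

theorem gaussDensity_sqrt (hn : 3 ≤ n) (t s : ℝ) :
    gaussDensity (n - 1) σ (Real.sqrt (t ^ 2 + s ^ 2)) =
      radialDensity σ t * gaussDensity (n - 2) σ s := by
  obtain ⟨k, rfl⟩ : ∃ k, n = k + 3 := ⟨n - 3, by omega⟩
  rw [gaussDensity, Real.sq_sqrt (by positivity), radialDensity_eq, gaussDensity, neg_add, add_div,
    Real.exp_add, show k + 3 - 1 = k + 1 + 1 by omega, show k + 3 - 2 = k + 1 by omega, pow_succ _ (k + 1)]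
  ring

theorem sqrt_le_iff_le_sqrt {t s ρ : ℝ} (ht : 0 ≤ t) (hs : 0 < s) (hρ : 0 ≤ ρ) :
    Real.sqrt (t ^ 2 + s ^ 2) ≤ ρ ↔ t ≤ ρ ∧ s ≤ Real.sqrt (ρ ^ 2 - t ^ 2) := by
  rw [Real.sqrt_le_left hρ, Real.le_sqrt' hs]
  constructor
  · intro h
    exact ⟨by nlinarith, by linarith⟩
  · intro h
    linarith [h.2]

/-- The Gaussian measure of the cap `{x₁ ≥ β} ∩ {‖x‖ ≤ ρ}`, in polar and in cylindrical
coordinates. -/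
theorem lintegral_capProb_mul_normDensity (hn : 3 ≤ n) (hσ : 0 < σ) {β ρ : ℝ} (hβ : 0 < β)
    (hρ : 0 < ρ) :
    ∫⁻ s in Ioc 0 ρ, ENNReal.ofReal (capProb n (β / s) * normDensity n σ s) =
      ∫⁻ x in Icc β ρ, ENNReal.ofReal
        (radialDensity σ x * ∫ s in (0 : ℝ)..Real.sqrt (ρ ^ 2 - x ^ 2), normDensity (n - 1) σ s) := by
  classical
  let E := EuclideanSpace ℝ (Fin (n - 1))
  have hd : finrank ℝ E = n - 1 := by simp [E]
  have : Nontrivial E := by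
    rw [← finrank_pos_iff (R := ℝ), hd]
    omega
  obtain ⟨v, hv⟩ := exists_norm_eq E zero_le_one
  -- The Gaussian density of dimension n - 1 on the cap, as a function of one coordinate and the
  -- norm. Polar coordinates produce the left side, and slicing along the coordinate produces the
  -- right side.
  let F : ℝ × ℝ → ℝ≥0∞ := fun p => if β ≤ p.1 ∧ p.2 ≤ ρ then
    ENNReal.ofReal (gaussDensity (n - 1) σ p.2) else 0
  have hF : Measurable F := by
    have h1 : MeasurableSet {p : ℝ × ℝ | β ≤ p.1} := measurableSet_le (by fun_prop) (by fun_prop)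
    have h2 : MeasurableSet {p : ℝ × ℝ | p.2 ≤ ρ} := measurableSet_le (by fun_prop) (by fun_prop)
    exact Measurable.ite (h1.inter h2) (by fun_prop) measurable_const
  have hS2 := sphereArea_pos (p := n - 2) (by omega)
  have hS1 := sphereArea_pos (p := n - 1) (by omega)
  have hA : ∫⁻ x : E, F (inner ℝ x v, ‖x‖) =
      ∫⁻ s in Ioc 0 ρ, ENNReal.ofReal (capProb n (β / s) * normDensity n σ s) := by
    rw [lintegral_polar (fun x => F (inner ℝ x v, ‖x‖)) (by fun_prop),
      ← lintegral_indicator measurableSet_Ioi, ← lintegral_indicator measurableSet_Ioc]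
    refine lintegral_congr fun r => ?_
    by_cases hr : 0 < r
    swap
    · rw [indicator_of_notMem (fun h : r ∈ Ioi 0 => hr h),
        indicator_of_notMem (fun h : r ∈ Ioc 0 ρ => hr h.1)]
    rw [indicator_of_mem (mem_Ioi.2 hr), hd]
    have key : ∀ u : sphere (0 : E) 1, F (inner ℝ (r • (u : E)) v, ‖r • (u : E)‖) =
        (if r ≤ ρ then ENNReal.ofReal (gaussDensity (n - 1) σ r) else 0) *
          {u : sphere (0 : E) 1 | β / r ≤ inner ℝ (u : E) v}.indicator 1 u := by
      intro u
      have e1 : ‖r • (u : E)‖ = r := by simp [norm_smul, abs_of_pos hr]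
      have e3 : β ≤ inner ℝ (r • (u : E)) v ↔ β / r ≤ inner ℝ (u : E) v := by
        rw [inner_smul_left, conj_trivial, div_le_iff₀ hr, mul_comm r]
      simp only [F, e1, e3, indicator, mem_ofPred_eq]
      split_ifs <;> simp_all
    have hms : MeasurableSet {u : sphere (0 : E) 1 | β / r ≤ inner ℝ (u : E) v} :=
      measurableSet_le (by fun_prop) (by fun_prop)
    rw [lintegral_congr key, lintegral_const_mul _ (measurable_one.indicator hms),
      lintegral_indicator_one hms, toSphere_cap (by rw [hd]; omega) v hv, hd]
    by_cases hrρ : r ≤ ρ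
    · rw [indicator_of_mem (show r ∈ Ioc 0 ρ from ⟨hr, hrρ⟩), if_pos hrρ,
        ← ENNReal.ofReal_mul (by rw [show n - 1 - 1 = n - 2 by omega]; exact hS2.le),
        ← ENNReal.ofReal_mul (gaussDensity_nonneg _ _ _), ← ENNReal.ofReal_mul (by positivity)]
      congr 1
      rw [capProb_eq hn, normDensity_eq (by omega) hσ, show n - 1 - 1 = n - 2 by omega,
        show n - 1 - 2 = n - 3 by omega]
      field_simp
    · rw [indicator_of_notMem (fun h : r ∈ Ioc 0 ρ => hrρ h.2), if_neg hrρ, zero_mul, mul_zero]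
  have hB : ENNReal.ofReal (sphereArea (n - 2)) * ∫⁻ t : ℝ, ∫⁻ s in Ioi (0 : ℝ),
        ENNReal.ofReal (s ^ (n - 3)) * F (t, Real.sqrt (t ^ 2 + s ^ 2)) =
      ∫⁻ x in Icc β ρ, ENNReal.ofReal
        (radialDensity σ x * ∫ s in (0 : ℝ)..Real.sqrt (ρ ^ 2 - x ^ 2), normDensity (n - 1) σ s) := by
    rw [← lintegral_const_mul' _ _ ENNReal.ofReal_ne_top, ← lintegral_indicator measurableSet_Icc]
    refine lintegral_congr fun t => ?_
    by_cases ht : t ∈ Icc β ρ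
    · have ht0 : 0 < t := hβ.trans_le ht.1
      rw [indicator_of_mem ht, intervalIntegral.integral_of_le (Real.sqrt_nonneg _),
        ENNReal.ofReal_mul (radialDensity_nonneg σ t), ofReal_integral_eq_lintegral_ofReal
          (Continuous.integrableOn_Ioc (by fun_prop))
          ((ae_restrict_iff' measurableSet_Ioc).2 (Filter.Eventually.of_forall fun s hs =>
            normDensity_nonneg (by omega) hσ hs.1.le)),
        ← lintegral_const_mul _ (by fun_prop), ← lintegral_const_mul' _ _ ENNReal.ofReal_ne_top,
        ← lintegral_indicator measurableSet_Ioi, ← lintegral_indicator measurableSet_Ioc]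
      refine lintegral_congr fun s => ?_
      by_cases hs : 0 < s
      swap
      · rw [indicator_of_notMem (fun h : s ∈ Ioi 0 => hs h),
          indicator_of_notMem (fun h : s ∈ Ioc 0 _ => hs h.1)]
      have hiff := sqrt_le_iff_le_sqrt ht0.le hs hρ.le
      rw [indicator_of_mem (mem_Ioi.2 hs)]
      by_cases hs2 : s ≤ Real.sqrt (ρ ^ 2 - t ^ 2)
      · rw [indicator_of_mem (show s ∈ Ioc 0 _ from ⟨hs, hs2⟩)]
        simp only [F, ht.1, hiff.2 ⟨ht.2, hs2⟩, and_self, if_true]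
        rw [← ENNReal.ofReal_mul (by positivity), ← ENNReal.ofReal_mul hS2.le,
          ← ENNReal.ofReal_mul (radialDensity_nonneg σ t), gaussDensity_sqrt hn,
          normDensity_eq (by omega) hσ, show n - 1 - 1 = n - 2 by omega,
          show n - 1 - 2 = n - 3 by omega]
        congr 1
        ring
      · rw [indicator_of_notMem (fun h => hs2 h.2)]
        simp only [F]
        rw [if_neg (fun h => hs2 (hiff.1 h.2).2), mul_zero, mul_zero]
    · rw [indicator_of_notMem ht]
      have h0 : ∀ s ∈ Ioi (0 : ℝ),
          ENNReal.ofReal (s ^ (n - 3)) * F (t, Real.sqrt (t ^ 2 + s ^ 2)) = 0 := by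
        intro s hs
        simp only [F]
        rw [if_neg, mul_zero]
        rintro ⟨h1, h2⟩
        exact ht ⟨h1, ((sqrt_le_iff_le_sqrt (hβ.le.trans h1) hs hρ.le).1 h2).1⟩
      rw [setLIntegral_congr_fun measurableSet_Ioi h0]
      simp
  have hax := lintegral_axial (by rw [hd]; omega) v hv F hF
  rw [hA, hd, show n - 1 - 1 = n - 2 by omega, show n - 1 - 2 = n - 3 by omega, hB] at hax
  exact hax

/-- The condition β ≤ ρ keeps the interval integral on the right correctly oriented. -/
theorem integral_capProb_mul_normDensity (hn : 3 ≤ n) (hσ : 0 < σ) {β ρ : ℝ} (hβ : 0 < β)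
    (hβρ : β ≤ ρ) :
    ∫ s in (0 : ℝ)..ρ, capProb n (β / s) * normDensity n σ s =
      ∫ x in β..ρ, radialDensity σ x *
        ∫ s in (0 : ℝ)..Real.sqrt (ρ ^ 2 - x ^ 2), normDensity (n - 1) σ s := by
  have hρ := hβ.trans_le hβρ
  have hc : Continuous fun x : ℝ =>
      ∫ s in (0 : ℝ)..Real.sqrt (ρ ^ 2 - x ^ 2), normDensity (n - 1) σ s :=
    (intervalIntegral.continuous_primitive (μ := volume)
      (fun _ _ => Continuous.intervalIntegrable (by fun_prop) _ _) 0).comp (by fun_prop)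
  have hm : Measurable fun s => capProb n (β / s) * normDensity n σ s :=
    ((continuous_capProb n).measurable.comp (by fun_prop)).mul (by fun_prop)
  rw [intervalIntegral.integral_of_le hρ.le, intervalIntegral.integral_of_le hβρ,
    ← integral_Icc_eq_integral_Ioc (x := β), integral_eq_lintegral_of_nonneg_ae,
    integral_eq_lintegral_of_nonneg_ae, lintegral_capProb_mul_normDensity hn hσ hβ hρ]
  · refine Filter.Eventually.of_forall fun x => mul_nonneg (radialDensity_nonneg σ x) ?_
    exact intervalIntegral.integral_nonneg (Real.sqrt_nonneg _) fun s hs =>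
      normDensity_nonneg (by omega) hσ hs.1
  · exact ((continuous_radialDensity σ).mul hc).aestronglyMeasurable
  · exact (ae_restrict_iff' measurableSet_Ioc).2 (Filter.Eventually.of_forall fun s hs =>
      mul_nonneg (capProb_nonneg hn _) (normDensity_nonneg (by omega) hσ hs.1.le))
  · exact hm.aestronglyMeasurable

/-- The substitution `v = κ s²`. -/
theorem integral_comp_sq (f : ℝ → ℝ) {κ L : ℝ} (hκ : 0 < κ) (hL : 0 ≤ L) :
    ∫ v in (0 : ℝ)..κ * L ^ 2, f v = ∫ s in (0 : ℝ)..L, 2 * κ * s * f (κ * s ^ 2) := by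
  have himg : (fun s : ℝ => κ * s ^ 2) '' Ioo 0 L = Ioo 0 (κ * L ^ 2) := by
    ext v
    constructor
    · rintro ⟨s, hs, rfl⟩
      exact ⟨mul_pos hκ (pow_pos hs.1 2),
        mul_lt_mul_of_pos_left (pow_lt_pow_left₀ hs.2 hs.1.le two_ne_zero) hκ⟩
    · intro hv
      refine ⟨Real.sqrt (v / κ), ⟨Real.sqrt_pos.2 (div_pos hv.1 hκ), ?_⟩, ?_⟩
      · rw [Real.sqrt_lt' (lt_of_le_of_ne hL ?_), div_lt_iff₀ hκ, mul_comm]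
        · exact hv.2
        · rintro rfl
          have := hv.1.trans hv.2
          simp at this
      · simp only
        rw [Real.sq_sqrt (div_pos hv.1 hκ).le, mul_div_cancel₀ _ hκ.ne']
  have hder : ∀ s ∈ Ioo 0 L,
      HasDerivWithinAt (fun s : ℝ => κ * s ^ 2) (2 * κ * s) (Ioo 0 L) s := by
    intro s _
    exact (((hasDerivAt_pow 2 s).const_mul κ).congr_deriv (by push_cast; ring)).hasDerivWithinAt
  have hinj : InjOn (fun s : ℝ => κ * s ^ 2) (Ioo 0 L) := by
    intro s hs t ht h
    have h1 : s ^ 2 = t ^ 2 := mul_left_cancel₀ hκ.ne' h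
    exact (pow_left_inj₀ hs.1.le ht.1.le two_ne_zero).1 h1
  rw [intervalIntegral.integral_of_le (by positivity), intervalIntegral.integral_of_le hL,
    integral_Ioc_eq_integral_Ioo, integral_Ioc_eq_integral_Ioo, ← himg,
    integral_image_eq_integral_abs_deriv_smul measurableSet_Ioo hder hinj]
  refine setIntegral_congr_fun measurableSet_Ioo fun s hs => ?_
  simp only [smul_eq_mul]
  rw [abs_of_nonneg (by have := hs.1; positivity)]

/-- Substitute v = s². The index n - 1 on the right is deliberate: `normDensity (n - 1)` belongs to
n - 2 Gaussian variables, as does the density of V. -/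
theorem integral_chiSqDensity (hn : 3 ≤ n) {L : ℝ} (hL : 0 ≤ L) :
    ∫ v in (0 : ℝ)..L ^ 2, chiSqDensity n σ v = ∫ s in (0 : ℝ)..L, normDensity (n - 1) σ s := by
  have h := integral_comp_sq (chiSqDensity n σ) one_pos hL
  rw [one_mul] at h
  rw [h, intervalIntegral.integral_of_le hL, intervalIntegral.integral_of_le hL]
  refine setIntegral_congr_fun measurableSet_Ioc fun s hs => ?_
  have hs0 : 0 < s := hs.1
  obtain ⟨k, rfl⟩ : ∃ k, n = k + 3 := ⟨n - 3, by omega⟩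
  have c1 : ((k + 3 - 1 : ℕ) : ℝ) - 1 = ((k + 3 : ℕ) : ℝ) - 2 := by
    rw [Nat.cast_sub (by omega)]
    push_cast
    ring
  have h1 : s * (s ^ 2) ^ ((((k + 3 : ℕ) : ℝ) - 4) / 2) = s ^ (k + 3 - 1 - 2) := by
    rw [← Real.rpow_natCast s 2, ← Real.rpow_mul hs0.le]
    nth_rewrite 1 [← Real.rpow_one s]
    rw [← Real.rpow_add hs0, ← Real.rpow_natCast]
    congr 1
    rw [show k + 3 - 1 - 2 = k by omega]
    push_cast
    ring
  simp only [chiSqDensity, normDensity, one_mul, mul_one]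
  rw [c1, ← h1, show k + 3 - 1 - 1 = k + 3 - 2 by omega]
  ring

/-- Substitute t = s²/(2σ²). -/
theorem lowerGammaReg_eq (hn : 3 ≤ n) (hσ : 0 < σ) {ρ : ℝ} (hρ : 0 ≤ ρ) :
    lowerGammaReg (((n : ℝ) - 1) / 2) (ρ ^ 2 / (2 * σ ^ 2)) =
      ∫ s in (0 : ℝ)..ρ, normDensity n σ s := by
  have h := integral_comp_sq (fun t => t ^ (((n : ℝ) - 1) / 2 - 1) * Real.exp (-t))
    (κ := (2 * σ ^ 2)⁻¹) (by positivity) hρ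
  rw [inv_mul_eq_div] at h
  rw [lowerGammaReg, h, ← intervalIntegral.integral_div, intervalIntegral.integral_of_le hρ,
    intervalIntegral.integral_of_le hρ]
  refine setIntegral_congr_fun measurableSet_Ioc fun s hs => ?_
  have hs0 : 0 < s := hs.1
  obtain ⟨k, rfl⟩ : ∃ k, n = k + 3 := ⟨n - 3, by omega⟩
  have e1 : (((k + 3 : ℕ) : ℝ) - 1) / 2 - 1 = (k : ℝ) / 2 := by
    push_cast
    ring
  have e2 : (((k + 3 : ℕ) : ℝ) - 1) / 2 = (k : ℝ) / 2 + 1 := by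
    push_cast
    ring
  have h1 : ((2 * σ ^ 2)⁻¹ * s ^ 2) ^ ((k : ℝ) / 2) = s ^ k / ((2 : ℝ) ^ ((k : ℝ) / 2) * σ ^ k) := by
    have e : ∀ x : ℝ, 0 < x → (x ^ 2) ^ ((k : ℝ) / 2) = x ^ k := by
      intro x hx
      rw [← Real.rpow_natCast x 2, ← Real.rpow_mul hx.le, ← Real.rpow_natCast]
      congr 1
      push_cast
      ring
    rw [inv_mul_eq_div, Real.div_rpow (by positivity) (by positivity),
      Real.mul_rpow (by positivity) (by positivity), e s hs0, e σ hσ]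
  have h2 := Real.Gamma_pos_of_pos (s := (k : ℝ) / 2 + 1) (by positivity)
  have h3 : (0 : ℝ) < (2 : ℝ) ^ ((k : ℝ) / 2) := by positivity
  simp only [normDensity]
  rw [e1, e2, h1, Real.rpow_add_one two_ne_zero, show k + 3 - 2 = k + 1 by omega,
    show k + 3 - 1 = k + 2 by omega, inv_mul_eq_div, neg_div]
  field_simp
  ring

variable {C : Submodule (ZMod 2) (Fin n → ZMod 2)}

theorem integral_normDensity_Ioi (hn : 3 ≤ n) (hσ : 0 < σ) {ρ : ℝ} (hρ : 0 ≤ ρ) :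
    ∫ s in Ioi ρ, normDensity n σ s = 1 - ∫ s in (0 : ℝ)..ρ, normDensity n σ s := by
  have := isProbabilityMeasure_normLaw (n := n) (by omega) hσ
  have hi := integrable_normDensity (n := n) (by omega) hσ
  have h1 := integral_normLaw (n := n) (by omega) hσ (fun _ => 1)
  simp only [one_mul, integral_const, probReal_univ, smul_eq_mul, mul_one] at h1
  rw [← Ioc_union_Ioi_eq_Ioi hρ, setIntegral_union (Ioc_disjoint_Ioi le_rfl) measurableSet_Ioi
    (hi.mono_set Ioc_subset_Ioi_self) (hi.mono_set (Ioi_subset_Ioi hρ))] at h1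
  rw [intervalIntegral.integral_of_le hρ]
  linarith

theorem integrableOn_pairProb (hn : 3 ≤ n) (d : ℕ) (a ρ : ℝ) :
    IntegrableOn (fun s => pairProb n d (a / s) * normDensity n σ s) (Ioc 0 ρ) := by
  have hi : IntegrableOn (normDensity n σ) (Ioc 0 ρ) :=
    Continuous.integrableOn_Ioc (by fun_prop)
  refine Integrable.bdd_mul hi (c := 1)
    ((antitone_pairProb hn d).measurable.comp (by fun_prop)).aestronglyMeasurable
    (Filter.Eventually.of_forall fun s => ?_)
  rw [Real.norm_of_nonneg (pairProb_nonneg hn _ _)]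
  exact pairProb_le_one hn _ _

theorem beta_eq {d : ℕ} (hdn : d < n) (z : ℝ) :
    beta n z d = threshold n d * (1 - z / Real.sqrt n) := by
  have h := sqrt_div_alpha hdn 1
  rw [alpha, one_mul, div_one, mul_one] at h
  rw [beta, ← h]
  ring

/-- The bracket in Poltyrev's bound is a conditional sphere bound. -/
theorem poltyrevIntegrand_eq (hn : 3 ≤ n) (hσ : 0 < σ) {z r : ℝ} (hz : z < Real.sqrt n)
    (hr : 0 < r) : poltyrevIntegrand C σ r z = condSphereBound C σ z (coneRadius n r z) := by
  have ha : 0 < 1 - z / Real.sqrt n := (one_sub_div_sqrt_pos (by omega)).2 hz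
  have hρ : 0 < coneRadius n r z := mul_pos ha hr
  set ρ := coneRadius n r z with hρdef
  set a := 1 - z / Real.sqrt n with hadef
  have hρa : ρ = a * r := rfl
  let F : ℕ → ℝ := fun d => ∫ s in (0 : ℝ)..ρ, pairProb n d (a / s) * normDensity n σ s
  have h1 : ∀ d ∈ (Finset.Icc 1 n).filter (fun d : ℕ => Real.sqrt d < alpha n r d),
      (weightCount C d : ℝ) * ∫ x in beta n z d..ρ, gaussianPDFReal 0 ⟨σ ^ 2, sq_nonneg σ⟩ x *
        ∫ v in (0 : ℝ)..(ρ ^ 2 - x ^ 2), chiSqDensity n σ v = (weightCount C d : ℝ) * F d := by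
    intro d hd
    congr 1
    have hd2 := (Finset.mem_filter.1 hd).2
    have hd1 := (Finset.mem_Icc.1 (Finset.mem_filter.1 hd).1).1
    have hdn : d < n := by
      have hle := (Finset.mem_Icc.1 (Finset.mem_filter.1 hd).1).2
      refine lt_of_le_of_ne hle fun h => ?_
      have h0 : (n : ℝ) ≠ 0 := by
        have : n ≠ 0 := by omega
        exact_mod_cast this
      rw [h, alpha, div_self h0, sub_self, Real.sqrt_zero, mul_zero] at hd2
      exact absurd hd2 (not_lt.2 (Real.sqrt_nonneg _))
    rw [sqrt_lt_alpha_iff hdn hr, mul_one_div, div_lt_one hr] at hd2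
    have hβ := threshold_pos hd1 hdn
    have hβ0 : 0 < threshold n d * a := mul_pos hβ ha
    have hβρ : threshold n d * a ≤ ρ := by
      rw [hρa, mul_comm]
      exact mul_le_mul_of_nonneg_left hd2.le ha.le
    have h2 := integral_capProb_mul_normDensity hn hσ hβ0 hβρ
    have h3 : F d = ∫ s in (0 : ℝ)..ρ, capProb n (threshold n d * a / s) * normDensity n σ s := by
      refine intervalIntegral.integral_congr fun s _ => ?_
      simp only [pairProb, if_pos hdn, mul_div_assoc]
    rw [h3, h2, beta_eq hdn]
    refine intervalIntegral.integral_congr fun x hx => ?_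
    rw [uIcc_of_le hβρ] at hx
    have h4 : 0 ≤ ρ ^ 2 - x ^ 2 := by nlinarith [hx.1, hx.2]
    have h5 := integral_chiSqDensity (σ := σ) hn (Real.sqrt_nonneg (ρ ^ 2 - x ^ 2))
    rw [Real.sq_sqrt h4] at h5
    simp only [h5]
    rfl
  -- Weights outside Poltyrev's range have decision boundaries that do not enter the interior of the
  -- cone, so their caps have zero area up to radius ρ.
  have h2 : ∀ d, 0 < d → d < n → 1 ≤ threshold n d * (1 / r) → F d = 0 := by
    intro d hd hdn h
    have e : ∫ s in (0 : ℝ)..ρ, pairProb n d (a / s) * normDensity n σ s = ∫ s in (0 : ℝ)..ρ, 0 := by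
      rw [intervalIntegral.integral_of_le hρ.le, intervalIntegral.integral_of_le hρ.le]
      refine setIntegral_congr_fun measurableSet_Ioc fun s hs => ?_
      simp only [pairProb, if_pos hdn]
      rw [capProb_eq_zero, zero_mul]
      refine h.trans (mul_le_mul_of_nonneg_left ?_ (Real.sqrt_nonneg _))
      rw [div_le_div_iff₀ hr hs.1, one_mul]
      exact hs.2
    rw [intervalIntegral.integral_zero] at e
    exact e
  have h3 : ∑ c ∈ nonzeroWords C, (if hammingNorm c < n then F (hammingNorm c) else 0) =
      ∫ s in (0 : ℝ)..ρ, condUnion C z s * normDensity n σ s := by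
    have e1 : ∀ c ∈ nonzeroWords C, (if hammingNorm c < n then F (hammingNorm c) else 0) =
        ∫ s in Ioc 0 ρ, pairProb n (hammingNorm c) (a / s) * normDensity n σ s := by
      intro c _
      rw [← intervalIntegral.integral_of_le hρ.le]
      split_ifs with hdn
      · rfl
      · rw [intervalIntegral.integral_of_le hρ.le]
        symm
        refine setIntegral_eq_zero_of_forall_eq_zero fun s hs => ?_
        rw [pairProb, if_neg hdn, if_neg (not_le.2 (div_pos ha hs.1)), zero_mul]
    rw [Finset.sum_congr rfl e1, ← integral_finsetSum _ fun c _ => integrableOn_pairProb hn _ _ _,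
      intervalIntegral.integral_of_le hρ.le]
    refine setIntegral_congr_fun measurableSet_Ioc fun s hs => ?_
    simp only [condUnion_eq hn z hs.1, unionProb, Finset.sum_mul]
    rfl
  rw [poltyrevIntegrand, Finset.sum_congr rfl h1, sum_filter_sqrt_lt_alpha hr F h2, h3,
    lowerGammaReg_eq hn hσ hρ.le, condSphereBound, integral_normDensity_Ioi hn hσ hρ.le]

end Poltyrev

/-! ### Half-cones, Poltyrev's bound and rescaling -/

section Cone

variable {n : ℕ} {σ : ℝ}

/-- The half-cone with cone parameter `r`, in terms of the radial and tangential components. -/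
def coneSet (n : ℕ) (r : ℝ) : Set (ℝ × ℝ) := {p | p.1 < Real.sqrt n ∧ p.2 ≤ coneRadius n r p.1}

theorem measurableSet_coneSet (n : ℕ) (r : ℝ) : MeasurableSet (coneSet n r) := by
  have h1 : MeasurableSet {p : ℝ × ℝ | p.1 < Real.sqrt n} :=
    measurableSet_lt measurable_fst measurable_const
  have h2 : MeasurableSet {p : ℝ × ℝ | p.2 ≤ coneRadius n r p.1} := by
    unfold coneRadius
    exact measurableSet_le measurable_snd (by fun_prop)
  exact h1.inter h2

variable {C : Submodule (ZMod 2) (Fin n → ZMod 2)}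

theorem jointBound_of_mem {A : Set (ℝ × ℝ)} {p : ℝ × ℝ} (h : p ∈ A) :
    jointBound C A p = jointUnion C p := if_pos h

theorem jointBound_of_notMem {A : Set (ℝ × ℝ)} {p : ℝ × ℝ} (h : p ∉ A) :
    jointBound C A p = 1 := if_neg h

/-- Below √n each section of the cone gives a conditional sphere bound. From √n on the section is
empty and costs 1, which is the correction term. -/
theorem poltyrevBound_eq (hn : 3 ≤ n) (hσ : 0 < σ) {r : ℝ} (hr : 0 < r) :
    poltyrevBound C σ r =
      ∫ p, jointBound C (coneSet n r) p ∂(radialLaw σ).prod (normLaw n σ) := by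
  have := isProbabilityMeasure_normLaw (n := n) (by omega) hσ
  have hi := integrable_jointBound (C := C) hn (measurableSet_coneSet n r)
    ((radialLaw σ).prod (normLaw n σ))
  have h1 : ∫ z in Iio (Real.sqrt n), radialDensity σ z * poltyrevIntegrand C σ r z =
      ∫ z in Iio (Real.sqrt n), ∫ s, jointBound C (coneSet n r) (z, s) ∂normLaw n σ ∂radialLaw σ := by
    rw [integral_radialLaw hσ]
    refine setIntegral_congr_fun measurableSet_Iio fun z hz => ?_
    have hz' : z < Real.sqrt n := hz
    have ha := (one_sub_div_sqrt_pos (by omega : 0 < n)).2 hz'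
    have hρ : 0 ≤ coneRadius n r z := (mul_pos ha hr).le
    have e := condSphereBound_eq (C := C) hn hσ (measurableSet_coneSet n r) z hρ
      fun s _ => and_iff_right hz'
    rw [poltyrevIntegrand_eq hn hσ hz' hr, e, mul_comm]
  have h2 : (received n σ).real {y | Real.sqrt n ≤ radial y} =
      ∫ z in (Iio (Real.sqrt n))ᶜ, ∫ s, jointBound C (coneSet n r) (z, s) ∂normLaw n σ
        ∂radialLaw σ := by
    have e : (received n σ).real {y | Real.sqrt n ≤ radial y} =
        (radialLaw σ).real (Ici (Real.sqrt n)) :=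
      received_radial (by omega) hσ measurableSet_Ici
    rw [e, compl_Iio, setIntegral_congr_fun (g := fun _ => (1 : ℝ)) measurableSet_Ici]
    · simp
    · intro z hz
      have hz' : ¬ z < Real.sqrt n := not_lt.2 hz
      simp [jointBound, coneSet, hz']
  rw [poltyrevBound, h1, h2, integral_prod _ hi]
  exact integral_add_compl measurableSet_Iio hi.integral_prod_left

theorem integral_jointBound_eq_of_forall {A : Set (ℝ × ℝ)}
    (h : ∀ᵐ p ∂(radialLaw σ).prod (normLaw n σ), 0 < p.2 →
      (p ∈ A → jointUnion C p ≤ 1) ∧ (p ∉ A → 1 ≤ jointUnion C p)) :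
    ∫ p, jointBound C A p ∂(radialLaw σ).prod (normLaw n σ) =
      ∫ p, jointBound C (optimalSet C) p ∂(radialLaw σ).prod (normLaw n σ) := by
  refine integral_congr_ae ?_
  filter_upwards [h, ae_snd_pos (n := n) (σ := σ)] with p hp h0
  rw [jointBound_optimalSet, jointBound]
  split_ifs with hA
  · exact (min_eq_left ((hp h0).1 hA)).symm
  · exact (min_eq_right ((hp h0).2 hA)).symm

theorem halfSpaceBound_le_poltyrevBound (hn : 3 ≤ n) (hσ : 0 < σ)
    (hk : 2 ≤ Module.finrank (ZMod 2) C) {r : ℝ} (hr : 0 < r) :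
    halfSpaceBound C σ (Real.sqrt n) ≤ poltyrevBound C σ r := by
  rw [poltyrevBound_eq hn hσ hr, ← regionBound_eq hn hσ (measurableSet_coneSet n r)]
  exact halfSpaceBound_le_regionBound hn hσ hk (measurableSet_coneSet n r)

/-- Below √n, lying in the cone means t ≥ t₁, and monotonicity decides on which side of 1 the union
bound lies. From √n on it is at least 1 anyway. -/
theorem jointUnion_coneSet (hn : 3 ≤ n) (hk : 2 ≤ Module.finrank (ZMod 2) C) {t₁ : ℝ} (ht₁ : 0 < t₁)
    (h1 : unionProb C t₁ = 1) (p : ℝ × ℝ) (hp : 0 < p.2) :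
    (p ∈ coneSet n (1 / t₁) → jointUnion C p ≤ 1) ∧
      (p ∉ coneSet n (1 / t₁) → 1 ≤ jointUnion C p) := by
  have hle : p.2 ≤ coneRadius n (1 / t₁) p.1 ↔ t₁ ≤ (1 - p.1 / Real.sqrt n) / p.2 := by
    rw [coneRadius, mul_one_div, le_div_comm₀ hp ht₁]
  constructor
  · intro h
    rw [← h1]
    exact antitone_unionProb hn (hle.1 h.2)
  · intro h
    rcases le_or_gt (Real.sqrt n) p.1 with hz | hz
    · exact one_le_jointUnion hn hk hz hp
    · rw [← h1]
      refine antitone_unionProb hn (not_le.1 fun h' => h ⟨hz, hle.2 h'⟩).le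

theorem poltyrevBound_eq_halfSpaceBound (hn : 3 ≤ n) (hσ : 0 < σ)
    (hk : 2 ≤ Module.finrank (ZMod 2) C) {t₁ : ℝ} (ht₁ : 0 < t₁) (h1 : unionProb C t₁ = 1) :
    halfSpaceBound C σ (Real.sqrt n) = poltyrevBound C σ (1 / t₁) := by
  rw [poltyrevBound_eq hn hσ (one_div_pos.2 ht₁), halfSpaceBound_sqrt_eq_integral hn hσ hk]
  exact (integral_jointBound_eq_of_forall
    (Filter.Eventually.of_forall (jointUnion_coneSet hn hk ht₁ h1))).symm

/-- The widening cones exhaust z < √n, where U < 1, so the integrand eventually equals min(U, 1) at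
almost every point, and dominated convergence applies. -/
theorem tendsto_poltyrevBound (hn : 3 ≤ n) (hσ : 0 < σ) (hk : 2 ≤ Module.finrank (ZMod 2) C)
    (hC : Module.finrank (ZMod 2) C = 2 ∧ (fun _ => 1) ∈ C) :
    Filter.Tendsto (fun k : ℕ => poltyrevBound C σ ((k : ℝ) + 1)) Filter.atTop
      (nhds (halfSpaceBound C σ (Real.sqrt n))) := by
  have := isProbabilityMeasure_normLaw (n := n) (by omega) hσ
  have e : (fun k : ℕ => poltyrevBound C σ ((k : ℝ) + 1)) = fun k : ℕ =>
      ∫ p, jointBound C (coneSet n ((k : ℝ) + 1)) p ∂(radialLaw σ).prod (normLaw n σ) :=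
    funext fun k => poltyrevBound_eq hn hσ (by positivity)
  rw [e, halfSpaceBound_sqrt_eq_integral hn hσ hk]
  refine tendsto_integral_of_dominated_convergence (fun _ => (nonzeroWords C).card + 1)
    (fun k => (measurable_jointBound hn (measurableSet_coneSet n _)).aestronglyMeasurable)
    (integrable_const _) (fun k => Filter.Eventually.of_forall (norm_jointBound_le hn _)) ?_
  filter_upwards [ae_snd_pos (n := n) (σ := σ)] with p hp
  refine tendsto_const_nhds.congr' ?_
  rcases le_or_gt (Real.sqrt n) p.1 with hz | hz
  · refine Filter.Eventually.of_forall fun k => ?_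
    rw [jointBound_optimalSet, min_eq_right (one_le_jointUnion hn hk hz hp)]
    exact (jointBound_of_notMem fun h => absurd h.1 (not_lt.2 hz)).symm
  · have ha := (one_sub_div_sqrt_pos (by omega : 0 < n)).2 hz
    filter_upwards [Filter.eventually_ge_atTop ⌈p.2 / (1 - p.1 / Real.sqrt n)⌉₊] with k hk
    have h2 : p.2 / (1 - p.1 / Real.sqrt n) ≤ k := Nat.ceil_le.1 hk
    have h3 : p.2 ≤ coneRadius n ((k : ℝ) + 1) p.1 := by
      rw [div_le_iff₀ ha] at h2
      rw [coneRadius]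
      linarith
    have h4 : jointUnion C p ≤ 1 := (unionProb_lt_one hn hC (div_pos ha hp)).le
    have h5 : p ∈ coneSet n ((k : ℝ) + 1) := ⟨hz, h3⟩
    rw [jointBound_optimalSet, min_eq_left h4]
    exact (jointBound_of_mem h5).symm

theorem isGLB_poltyrevBound (hn : 3 ≤ n) (hσ : 0 < σ) (hk : 2 ≤ Module.finrank (ZMod 2) C) :
    IsGLB (poltyrevBound C σ '' Ioi 0) (halfSpaceBound C σ (Real.sqrt n)) := by
  refine ⟨?_, fun b hb => ?_⟩
  · rintro _ ⟨r, hr, rfl⟩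
    exact halfSpaceBound_le_poltyrevBound hn hσ hk hr
  · by_cases hC : Module.finrank (ZMod 2) C = 2 ∧ (fun _ => 1) ∈ C
    · exact ge_of_tendsto' (tendsto_poltyrevBound hn hσ hk hC) fun k =>
        hb ⟨_, mem_Ioi.2 (by positivity), rfl⟩
    · obtain ⟨t₁, ht₁, h1⟩ := exists_unionProb_eq_one hn hk hC
      rw [poltyrevBound_eq_halfSpaceBound hn hσ hk ht₁ h1]
      exact hb ⟨_, mem_Ioi.2 (one_div_pos.2 ht₁), rfl⟩

theorem inner_sent_eq (hn : 0 < n) (y : Signal n) :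
    inner ℝ (sent n) y = n * (1 - radial y / Real.sqrt n) := by
  have h0 : (0 : ℝ) < n := by exact_mod_cast hn
  have h1 := Real.sq_sqrt h0.le
  have h2 := Real.sqrt_pos.2 h0
  rw [radial, inner_neg_right, inner_smul_right, inner_sub_left, real_inner_self_eq_norm_sq,
    norm_sent, h1, real_inner_comm]
  field_simp
  rw [h1]
  ring

theorem inner_sent_sub_center (hn : 0 < n) (y : Signal n) :
    inner ℝ (sent n) (y - center n (radial y)) = 0 := by
  have h0 : (0 : ℝ) < n := by exact_mod_cast hn
  rw [inner_sub_right, inner_sent_eq hn, center, inner_smul_right, real_inner_self_eq_norm_sq,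
    norm_sent, Real.sq_sqrt h0.le]
  ring

theorem angle_sent_le_pi_div_two_iff (hn : 0 < n) (y : Signal n) :
    InnerProductGeometry.angle (sent n) y ≤ Real.pi / 2 ↔ radial y ≤ Real.sqrt n := by
  have h0 : (0 : ℝ) < n := by exact_mod_cast hn
  rw [InnerProductGeometry.angle, Real.arccos_le_pi_div_two, inner_sent_eq hn]
  have h2 := Real.sqrt_pos.2 h0
  -- By convention the zero vector makes the angle π/2 with everything; its radial component is √n,
  -- so it satisfies both conditions.
  by_cases hy : y = 0
  · have h : radial (0 : Signal n) = Real.sqrt n := by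
      have h3 := inner_sent_eq hn (0 : Signal n)
      rw [inner_zero_right, eq_comm, mul_eq_zero, or_iff_right h0.ne', sub_eq_zero,
        eq_div_iff h2.ne', one_mul] at h3
      exact h3.symm
    simp [hy, h]
  · have h3 : 0 < ‖sent n‖ * ‖y‖ :=
      mul_pos (norm_pos_iff.2 (sent_ne_zero hn)) (norm_pos_iff.2 hy)
    rw [le_div_iff₀ h3, zero_mul, mul_nonneg_iff_of_pos_left h0, sub_nonneg, div_le_one h2]

theorem halfCone_pi_div_two (hn : 0 < n) :
    halfCone n (Real.pi / 2) = components ⁻¹' {p | p.1 ≤ Real.sqrt n} :=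
  ext fun y => angle_sent_le_pi_div_two_iff hn y

/-- Below √n the tangent of the angle is the tangential length over the axial length. The apex has
radial component √n and conventional angle π/2, so both descriptions exclude it; this is why
`coneSet` uses a strict inequality. -/
theorem halfCone_arctan (hn : 0 < n) (r : ℝ) :
    halfCone n (Real.arctan (r / Real.sqrt n)) = components ⁻¹' coneSet n r := by
  have h0 : (0 : ℝ) < n := by exact_mod_cast hn
  have h2 := Real.sqrt_pos.2 h0
  ext y
  change InnerProductGeometry.angle (sent n) y ≤ _ ↔
    radial y < Real.sqrt n ∧ tangentialNorm y ≤ (1 - radial y / Real.sqrt n) * r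
  rcases lt_or_ge (radial y) (Real.sqrt n) with hz | hz
  · have ha := (one_sub_div_sqrt_pos hn).2 hz
    have hdec : y = center n (radial y) + (y - center n (radial y)) := by abel
    have hang : InnerProductGeometry.angle (sent n) y =
        Real.arctan (tangentialNorm y / ((1 - radial y / Real.sqrt n) * Real.sqrt n)) := by
      have h3 : inner ℝ (center n (radial y)) (y - center n (radial y)) = 0 := by
        nth_rewrite 1 [center]
        rw [inner_smul_left, inner_sent_sub_center hn, mul_zero]
      have h4 : center n (radial y) ≠ 0 := smul_ne_zero ha.ne' (sent_ne_zero hn)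
      have h5 := InnerProductGeometry.angle_add_eq_arctan_of_inner_eq_zero h3 h4
      rw [← hdec] at h5
      have h6 : InnerProductGeometry.angle (center n (radial y)) y =
          InnerProductGeometry.angle (sent n) y :=
        InnerProductGeometry.angle_smul_left_of_pos _ _ ha
      have h7 : ‖center n (radial y)‖ = (1 - radial y / Real.sqrt n) * Real.sqrt n := by
        rw [center, norm_smul, norm_sent, Real.norm_of_nonneg ha.le]
      rw [← h6, h5, h7]
      rfl
    rw [hang, Real.arctan_le_arctan_iff, and_iff_right hz, div_le_div_iff₀ (mul_pos ha h2) h2,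
      mul_comm r, mul_right_comm, mul_le_mul_iff_left₀ h2]
  · refine iff_of_false (fun h => ?_) fun h => absurd h.1 (not_lt.2 hz)
    have h3 := h.trans_lt (Real.arctan_lt_pi_div_two _)
    rw [InnerProductGeometry.angle, Real.arccos_lt_pi_div_two, inner_sent_eq hn] at h3
    refine absurd h3 (not_lt.2 (div_nonpos_of_nonpos_of_nonneg ?_ (by positivity)))
    refine mul_nonpos_of_nonneg_of_nonpos h0.le ?_
    exact not_lt.1 fun h4 => absurd ((one_sub_div_sqrt_pos hn).1 h4) (not_lt.2 hz)

theorem regionBound_halfCone (hn : 3 ≤ n) (hσ : 0 < σ) (hk : 2 ≤ Module.finrank (ZMod 2) C)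
    {t₁ : ℝ} (ht₁ : 0 < t₁) (h1 : unionProb C t₁ = 1) :
    halfSpaceBound C σ (Real.sqrt n) =
      regionBound C σ (halfCone n (Real.arctan (1 / t₁ / Real.sqrt n))) := by
  rw [halfCone_arctan (by omega), regionBound_eq hn hσ (measurableSet_coneSet n _),
    ← poltyrevBound_eq hn hσ (one_div_pos.2 ht₁)]
  exact poltyrevBound_eq_halfSpaceBound hn hσ hk ht₁ h1

theorem regionBound_halfSpace (hn : 3 ≤ n) (hσ : 0 < σ) (hk : 2 ≤ Module.finrank (ZMod 2) C)
    (hC : Module.finrank (ZMod 2) C = 2 ∧ (fun _ => 1) ∈ C) :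
    halfSpaceBound C σ (Real.sqrt n) = regionBound C σ (halfCone n (Real.pi / 2)) := by
  rw [halfCone_pi_div_two (by omega), regionBound_eq hn hσ
    (measurableSet_le measurable_fst measurable_const), halfSpaceBound_sqrt_eq_integral hn hσ hk]
  refine (integral_jointBound_eq_of_forall ?_).symm
  -- The closed half-space contains the hyperplane z = √n, where U ≤ 1 is not available; this
  -- hyperplane is negligible.
  have hne : ∀ᵐ z ∂radialLaw σ, z ≠ Real.sqrt n := by
    rw [radialLaw_eq hσ]
    have h : ∀ᵐ z : ℝ, z ≠ Real.sqrt n := by simp [ae_iff]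
    exact (withDensity_absolutelyContinuous _ _).ae_le h
  have hne2 : ∀ᵐ p ∂(radialLaw σ).prod (normLaw n σ), p.1 ≠ Real.sqrt n :=
    Measure.quasiMeasurePreserving_fst.ae hne
  filter_upwards [hne2] with p hp h0
  refine ⟨fun h => ?_, fun h => one_le_jointUnion hn hk (not_le.1 h).le h0⟩
  have ha := (one_sub_div_sqrt_pos (by omega : 0 < n)).2 (lt_of_le_of_ne h hp)
  exact (unionProb_lt_one hn hC (div_pos ha h0)).le

theorem scaledDev_eq (hn : 0 < n) (σ z : ℝ) : scaledDev n σ z = σ / (1 - z / Real.sqrt n) := by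
  have h0 : (0 : ℝ) < n := by exact_mod_cast hn
  have h2 := (Real.sqrt_pos.2 h0).ne'
  rw [scaledDev, one_sub_div h2, div_div_eq_mul_div, mul_comm]

theorem condUnion_eq_fs (hn : 3 ≤ n) {z r : ℝ} (hz : z < Real.sqrt n) (hr : 0 < r) :
    condUnion C z r = fs C (r * Real.sqrt n / (Real.sqrt n - z)) := by
  have h0 : (0 : ℝ) < n := by
    have : 0 < n := by omega
    exact_mod_cast this
  have h2 := Real.sqrt_pos.2 h0
  have h3 : 0 < Real.sqrt n - z := sub_pos.2 hz
  rw [condUnion_eq hn z hr, fs_eq (by positivity), one_sub_div h2.ne', one_div_div, div_div,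
    mul_comm r]

/-- A change of scale with Jacobian a. It turns σ into σ̃ when a = 1 - z/√n. -/
theorem mul_normDensity_mul (hn : 3 ≤ n) (a r : ℝ) :
    a * normDensity n σ (a * r) = normDensity n (σ / a) r := by
  obtain ⟨k, rfl⟩ : ∃ k, n = k + 3 := ⟨n - 3, by omega⟩
  have h1 : -(a * r) ^ 2 / (2 * σ ^ 2) = -r ^ 2 / (2 * (σ / a) ^ 2) := by
    rw [div_pow, mul_pow, mul_div_assoc', div_div_eq_mul_div]
    ring
  simp only [normDensity]
  rw [h1, show k + 3 - 2 = k + 1 by omega, show k + 3 - 1 = k + 2 by omega, mul_pow,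
    div_pow σ a (k + 2)]
  generalize Real.exp (-r ^ 2 / (2 * (σ / a) ^ 2)) = e
  generalize (2 : ℝ) ^ ((((k + 3 : ℕ) : ℝ) - 1) / 2) = b
  rw [← mul_div_assoc, mul_div_assoc', div_mul_eq_mul_div, div_div_eq_mul_div]
  ring

/-- A conditional sphere bound, rescaled to the hyperplane through the transmitted signal. -/
theorem condSphereBound_scaled (hn : 3 ≤ n) {z r₁ : ℝ} (hz : z < Real.sqrt n) (hr₁ : 0 < r₁) :
    condSphereBound C σ z ((1 - z / Real.sqrt n) * r₁) =
      (∫ r in (0 : ℝ)..r₁, fs C r * normDensity n (scaledDev n σ z) r) +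
        ∫ r in Ioi r₁, normDensity n (scaledDev n σ z) r := by
  have ha := (one_sub_div_sqrt_pos (by omega : 0 < n)).2 hz
  rw [scaledDev_eq (by omega), condSphereBound]
  set a := 1 - z / Real.sqrt n with hadef
  congr 1
  · have h := intervalIntegral.mul_integral_comp_mul_left (a := 0) (b := r₁)
      (f := fun r => condUnion C z r * normDensity n σ r) a
    rw [mul_zero] at h
    rw [← h, ← intervalIntegral.integral_const_mul, intervalIntegral.integral_of_le hr₁.le,
      intervalIntegral.integral_of_le hr₁.le]
    refine setIntegral_congr_fun measurableSet_Ioc fun r hr => ?_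
    rw [← mul_normDensity_mul hn a, condUnion_eq hn z (mul_pos ha hr.1), fs_eq hr.1, ← hadef,
      ← div_div, div_self ha.ne']
    ring
  · have h := integral_comp_mul_left_Ioi (normDensity n σ) r₁ ha
    rw [eq_inv_smul_iff₀ ha.ne', smul_eq_mul] at h
    rw [← h, ← integral_const_mul]
    exact integral_congr_ae (Filter.Eventually.of_forall fun r => mul_normDensity_mul hn a r)

theorem fu_eq_condSphereBound (hn : 3 ≤ n) (hσ : 0 < σ) {t₁ z : ℝ} (ht₁ : 0 < t₁)
    (h1 : unionProb C t₁ = 1) (hz : z < Real.sqrt n) :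
    fu C σ z = condSphereBound C σ z ((1 - z / Real.sqrt n) * (1 / t₁)) := by
  have ha := (one_sub_div_sqrt_pos (by omega : 0 < n)).2 hz
  rw [mul_one_div]
  refine (fu_eq_of_forall hn hσ (div_pos ha ht₁).le (fun r h0 hr => ?_) fun r hr => ?_).2
  · rw [← h1]
    exact antitone_unionProb hn ((le_div_comm₀ h0 ht₁).1 hr)
  · rw [← h1]
    exact antitone_unionProb hn ((div_lt_comm₀ ht₁ ((div_pos ha ht₁).trans hr)).1 hr).le

theorem halfSpaceBound_sqrt_eq_add (hn : 3 ≤ n) (hσ : 0 < σ) :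
    halfSpaceBound C σ (Real.sqrt n) =
      (∫ z in Iio (Real.sqrt n), fu C σ z * radialDensity σ z) +
        (received n σ).real {y | Real.sqrt n ≤ radial y} := by
  have e : (received n σ).real {y | Real.sqrt n ≤ radial y} =
      ∫ x in Ici (Real.sqrt n), radialDensity σ x := by
    have h := integral_radialLaw hσ (fun _ => 1) (Ici (Real.sqrt n))
    simp only [one_mul] at h
    rw [← h]
    refine (received_radial (by omega) hσ measurableSet_Ici).trans ?_
    simp
  rw [halfSpaceBound, integral_Iic_eq_integral_Iio, e, integral_Ici_eq_integral_Ioi]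

end Cone

end

end TSB

/-! ### Assembly of the theorem -/

theorem mainTheorem7 (n : ℕ) (hn : 3 ≤ n) (σ : ℝ) (hσ : 0 < σ)
    (C : Submodule (ZMod 2) (Fin n → ZMod 2)) (hk : 2 ≤ Module.finrank (ZMod 2) C) :
    -- the conditional sphere bound is below one for `z < √n` and equal to one for `z ≥ √n`,
    -- where the optimal radius is zero
    (∀ z < Real.sqrt n, TSB.fu C σ z < 1) ∧
    (∀ z ≥ Real.sqrt n, TSB.fu C σ z = 1 ∧ TSB.condSphereBound C σ z 0 = TSB.fu C σ z) ∧
    -- the parameter has density `g`, and `f_u` bounds the conditional error probability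
    (MeasureTheory.Measure.map TSB.radial (TSB.received n σ) =
      MeasureTheory.volume.withDensity (fun z => ENNReal.ofReal (TSB.radialDensity σ z))) ∧
    (∀ B : Set ℝ, MeasurableSet B →
      (TSB.received n σ).real (TSB.errorEvent C ∩ TSB.radial ⁻¹' B) ≤
        ∫ z in B, TSB.fu C σ z * TSB.radialDensity σ z) ∧
    -- `√n` is an optimal parameter, and the smallest one
    MeasureTheory.Integrable (fun z => TSB.fu C σ z * TSB.radialDensity σ z) ∧
    (∀ z, TSB.halfSpaceBound C σ (Real.sqrt n) ≤ TSB.halfSpaceBound C σ z ∧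
      (TSB.halfSpaceBound C σ z = TSB.halfSpaceBound C σ (Real.sqrt n) ↔ Real.sqrt n ≤ z)) ∧
    -- the resulting bound
    (TSB.received n σ).real (TSB.errorEvent C) ≤ TSB.halfSpaceBound C σ (Real.sqrt n) ∧
    TSB.halfSpaceBound C σ (Real.sqrt n) =
      (∫ z in Set.Iio (Real.sqrt n), TSB.fu C σ z * TSB.radialDensity σ z) +
        (TSB.received n σ).real {y | Real.sqrt n ≤ TSB.radial y} ∧
    -- the conditional union bound below `√n`, after rescaling to the hyperplane `z = 0`
    (∀ z < Real.sqrt n, ∀ r > 0,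
      TSB.condUnion C z r = TSB.fs C (r * Real.sqrt n / (Real.sqrt n - z))) ∧
    -- the bound is Poltyrev's, optimized over the cone parameter
    IsGLB (TSB.poltyrevBound C σ '' Set.Ioi 0) (TSB.halfSpaceBound C σ (Real.sqrt n)) ∧
    (∀ r > 0, TSB.fs C r = 1 ↔ TSB.PoltyrevOptimal C r) ∧
    -- no region that depends on the radial and tangential noise only does better
    (∀ A : Set (ℝ × ℝ), MeasurableSet A →
      TSB.halfSpaceBound C σ (Real.sqrt n) ≤
        TSB.regionBound C σ {y | (TSB.radial y, TSB.tangentialNorm y) ∈ A}) ∧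
    -- the optimal radius and the optimal half-cone
    (¬ (Module.finrank (ZMod 2) C = 2 ∧ (fun _ => 1) ∈ C) →
      ∃ r₁ > 0, (∀ r > 0, TSB.fs C r = 1 ↔ r = r₁) ∧
        (∀ z < Real.sqrt n,
          TSB.fu C σ z =
              (∫ r in (0 : ℝ)..r₁, TSB.fs C r * TSB.normDensity n (TSB.scaledDev n σ z) r) +
                ∫ r in Set.Ioi r₁, TSB.normDensity n (TSB.scaledDev n σ z) r) ∧
        (∀ z < Real.sqrt n, TSB.fu C σ z =
          TSB.condSphereBound C σ z (r₁ * (Real.sqrt n - z) / Real.sqrt n)) ∧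
        TSB.halfSpaceBound C σ (Real.sqrt n) = TSB.poltyrevBound C σ r₁ ∧
        TSB.halfSpaceBound C σ (Real.sqrt n) =
          TSB.regionBound C σ (TSB.halfCone n (Real.arctan (r₁ / Real.sqrt n)))) ∧
    -- the exceptional codes, for which the optimal half-cone opens up to a half-space
    (Module.finrank (ZMod 2) C = 2 ∧ (fun _ => 1) ∈ C →
      (∀ r > 0, TSB.fs C r < 1) ∧
        TSB.halfSpaceBound C σ (Real.sqrt n) =
          TSB.regionBound C σ (TSB.halfCone n (Real.pi / 2))) := by
  have hn0 : 0 < n := by omega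
  have hsq : 0 < Real.sqrt n := Real.sqrt_pos.2 (by exact_mod_cast hn0)
  refine ⟨fun z hz => TSB.fu_lt_one hn hσ hk hz, fun z hz => TSB.fu_eq_one hn hσ hk hz,
    (TSB.map_radial_received (by omega) hσ).trans (TSB.radialLaw_eq hσ), fun B hB => ?_,
    (TSB.integrable_radialLaw_iff hσ _).1 (TSB.integrable_fu hn hσ hk), fun z => ?_, ?_,
    TSB.halfSpaceBound_sqrt_eq_add hn hσ, fun z hz r hr => TSB.condUnion_eq_fs hn hz hr,
    TSB.isGLB_poltyrevBound hn hσ hk, fun r hr => TSB.fs_eq_one_iff_poltyrevOptimal hn hr,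
    fun A hA => TSB.halfSpaceBound_le_regionBound hn hσ hk hA, fun hC => ?_, fun hC =>
    ⟨fun r hr => ?_, TSB.regionBound_halfSpace hn hσ hk hC⟩⟩
  · rw [← TSB.integral_radialLaw hσ]
    exact TSB.errorEvent_le hn hσ hk hB
  · rcases le_or_gt (Real.sqrt n) z with hz | hz
    · have h : TSB.halfSpaceBound C σ z = TSB.halfSpaceBound C σ (Real.sqrt n) := by
        rw [TSB.halfSpaceBound_sqrt hn hσ hk hz, TSB.halfSpaceBound_sqrt hn hσ hk le_rfl]
      exact ⟨h.ge, iff_of_true h hz⟩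
    · have h := TSB.halfSpaceBound_lt (C := C) hn hσ hk hz
      exact ⟨h.le, iff_of_false h.ne' (not_le.2 hz)⟩
  · have h := TSB.errorEvent_le (C := C) hn hσ hk MeasurableSet.univ
    rw [TSB.halfSpaceBound_sqrt hn hσ hk le_rfl]
    simpa using h
  · obtain ⟨t₁, ht₁, h1⟩ := TSB.exists_unionProb_eq_one hn hk hC
    -- At z = 0 the variable is t = 1/r, so the crossing point t₁ corresponds to the radius 1/t₁.
    refine ⟨1 / t₁, one_div_pos.2 ht₁, fun r hr => ?_, fun z hz => ?_, fun z hz => ?_,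
      TSB.poltyrevBound_eq_halfSpaceBound hn hσ hk ht₁ h1, TSB.regionBound_halfCone hn hσ hk ht₁ h1⟩
    · rw [TSB.fs_eq hr, TSB.unionProb_eq_one_iff hn (one_div_pos.2 hr) ht₁ h1, one_div, one_div,
        inv_eq_iff_eq_inv]
    · rw [TSB.fu_eq_condSphereBound hn hσ ht₁ h1 hz,
        TSB.condSphereBound_scaled hn hz (one_div_pos.2 ht₁)]
    · rw [TSB.fu_eq_condSphereBound hn hσ ht₁ h1 hz, one_sub_div hsq.ne', div_mul_eq_mul_div,
        mul_comm (1 / t₁)]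
  · rw [TSB.fs_eq hr]
    exact TSB.unionProb_lt_one hn hC (one_div_pos.2 hr)
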